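/- **Setting.** For $t\in\mathbb Z$ let $y_t=m_t+u_t$, where $m_t=\sum_{j\ge1}\beta_jx_{t,j}$ (convergence in mean square), $\beta=(\beta_j)_{j\ge 1}$ is a fixed sequence, and $E[u_tx_{t,j}]=0$ for all $j\ge 1$. For sample size $T$ let $p=p_T\ge 2$, let $\mathbf X$ be the $T\times p$ matrix with entries $x_{t,j}$ ($1\le t\le T$, $1\le j\le p$), and let $\mathbf y,\mathbf m,\mathbf u$ be the sample vectors, $\|v\|_T^2=\frac1T\sum_{t\le T}v_t^2$. Let $\mathcal G=\mathcal G_T$ be a partition of $[p]=\{1,\dots,p\}$ into groups of size at most a constant $\bar g$, let $\alpha\in[0,1]$ be fixed, and put $\Omega(b)=\alpha|b|_1+(1-\alpha)\sum_{G\in\mathcal G}|b_G|_2$ for $b\in\mathbb R^p$. The sparse-group LASSO $\hat\beta$ is any minimizer of $b\mapsto\|\mathbf y-\mathbf Xb\|_T^2+2\lambda\Omega(b)$ over $\mathbb R^p$. Write also $\beta$ for $(\beta_1,\dots,\beta_p)$, assume that it is nonzero for all large $T$, and let $\sqrt{s_\alpha}=\alpha\sqrt{|S_0|}+(1-\alpha)\sqrt{|\mathcal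 G_0|}$ with $S_0=\{j\le p:\beta_j\neq0\}$, $\mathcal G_0=\{G\in\mathcal G:\beta_G\ne0\}$. Let $$\hat\sigma^2=\|\mathbf y-\mathbf X\hat\beta\|_T^2+\lambda\Omega(\hat\beta),\qquad \sigma^2=E\|\mathbf u\|_T^2 .$$ For a real process $(\xi_t)_{t\in\mathbb Z}$ with $\mathcal M_t=\sigma(\xi_t,\xi_{t-1},\dots)$, the $\tau$-mixing coefficients are $$\tau_k=\sup_{j\ge1}\frac1j\sup_{t+k\le t_1<\dots<t_j}E\Big[\sup_{f}\big|E(f(\xi_{t_1},\dots,\xi_{t_j})\mid\mathcal M_t)-E f(\xi_{t_1},\dots,\xi_{t_j})\big|\Big],$$ the inner supremum being over $f:\mathbb R^j\to\mathbb R$ that are $1$-Lipschitz for the $\ell_1$ distance. **Assumptions.** 1. For every $d\ge 1$ the processes $(u_tx_{t,j})_{j\le d}$ and $(x_{t,j}x_{t,l})_{j,l\le d}$, $t\in\mathbb Z$, are strictly stationary. For some $r>4$, $q>2r/(r-2)$ and $K$, $\|u_t\|_q\le K$ and $\|x_{t,j}\|_r\le K$ for all $t,j$. With $\varsigma=qr/(q+r)$,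 for all $j,l$ and $k\ge 1$ the $\tau$-mixing coefficients of $(u_tx_{t,j})_t$ and $(x_{t,j}x_{t,l})_t$ are at most $ck^{-a}$ and $ck^{-b}$, for some $c>0$, $a>(\varsigma-1)/(\varsigma-2)$, $b>(r-2)/(r-4)$. 2. There is $\gamma>0$ such that for every $d$ all eigenvalues of $(E[x_{t,j}x_{t,l}])_{j,l\le d}$ are at least $\gamma$. 3. $\delta\in(0,1)$ is fixed and for some constant $C_1$ and all large $T$, $C_0\rho_T\le\lambda\le C_1\rho_T$, where $\rho_T=\left(\frac p{\delta T^{\kappa-1}}\right)^{1/\kappa}\vee\sqrt{\frac{\log(8p/\delta)}T}$, $\kappa=\frac{(a+1)\varsigma-1}{a+\varsigma-1}$, and $C_0$ is the constant of the proposition. 4. $\|\mathbf m-\mathbf X\beta\|_T^2=O_P(s_\alpha\lambda^2)$; $s_\alpha^\mu p^2T^{1-\mu}\to0$ with $\mu=\frac{(b+1)r-2}{r+2(b-1)}$; and $p^2\exp(-c'T/s_\alpha^2)\to0$ for some $c'>0$. 5. $(u_t^2)$ has a finite long-run variance: $u_t^2$ is square integrable and $\lim_{T\to\infty}\operatorname{Var}\big(T^{-1/2}\sum_{t=1}^Tu_t^2\big)$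 exists and is finite. **Proposition.** There is a constant $C_0>0$, depending only on $q,r,a,b,c,K,\bar g$, such that under Assumptions 1--5 (the third one with this $C_0$), if $$\frac{s_\alpha p^{1/\kappa}}{T^{1-1/\kappa}}\vee s_\alpha\sqrt{\frac{\log p}T}=o(1)\quad\text{as }T\to\infty,$$ then $$\hat\sigma^2=\sigma^2+O_P\left(\frac{s_\alpha p^{1/\kappa}}{T^{1-1/\kappa}}\vee s_\alpha\sqrt{\frac{\log p}T}\right),$$ and in particular $\hat\sigma^2-\sigma^2\to0$ in probability. -/

import Mathlib

open MeasureTheory ProbabilityTheory Filter Topology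
open scoped ENNReal

namespace SGL

noncomputable section

/-! ### Sample quantities -/

/-- The empirical inner product `⟨u, v⟩_T = (1/T) ∑ₜ uₜ vₜ`. -/
def empInner {T : ℕ} (u v : Fin T → ℝ) : ℝ := (∑ t, u t * v t) / (T : ℝ)

/-- The squared empirical norm `‖v‖_T² = ⟨v, v⟩_T`. -/
def empNormSq {T : ℕ} (v : Fin T → ℝ) : ℝ := empInner v v

/-- The sample `(z₁, …, z_T)` of a process indexed by `ℤ`, at the outcome `ω`. -/
def sample {Ω : Type*} (z : ℤ → Ω → ℝ) (T : ℕ) (ω : Ω) : Fin T → ℝ :=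
  fun t => z ((t : ℤ) + 1) ω

/-- The `T × p` design matrix with rows `x₁, …, x_T`, built from the first `p` covariates. -/
def design {Ω : Type*} (x : ℤ → ℕ → Ω → ℝ) (T p : ℕ) (ω : Ω) : Matrix (Fin T) (Fin p) ℝ :=
  Matrix.of fun t j => x ((t : ℤ) + 1) j ω

/-- The first `p` coordinates of the sequence of coefficients. -/
def trunc (β : ℕ → ℝ) (p : ℕ) : Fin p → ℝ := fun j => β j

/-! ### The sparse-group LASSO -/

/-- A partition of `[p]` into groups. -/
abbrev Groups (p : ℕ) := Finpartition (Finset.univ : Finset (Fin p))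

/-- The penalty `Ω(b) = α |b|₁ + (1 - α) ∑_G |b_G|₂`. -/
def penalty {p : ℕ} (α : ℝ) (P : Groups p) (b : Fin p → ℝ) : ℝ :=
  α * ∑ j, |b j| + (1 - α) * ∑ G ∈ P.parts, √(∑ j ∈ G, b j ^ 2)

/-- `b` solves `min_b ‖y - X b‖_T² + 2 l Ω(b)`. -/
def IsSgLasso {T p : ℕ} (y : Fin T → ℝ) (X : Matrix (Fin T) (Fin p) ℝ) (l α : ℝ) (P : Groups p)
    (b : Fin p → ℝ) : Prop :=
  ∀ b' : Fin p → ℝ, empNormSq (y - X.mulVec b) + 2 * l * penalty α P b ≤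
    empNormSq (y - X.mulVec b') + 2 * l * penalty α P b'

/-- The regularized variance estimator `‖y - X b‖_T² + l Ω(b)`. -/
def sigmaHatSq {T p : ℕ} (y : Fin T → ℝ) (X : Matrix (Fin T) (Fin p) ℝ) (l α : ℝ) (P : Groups p)
    (b : Fin p → ℝ) : ℝ :=
  empNormSq (y - X.mulVec b) + l * penalty α P b

/-- The support `{j : b_j ≠ 0}`. -/
def supp {p : ℕ} (b : Fin p → ℝ) : Finset (Fin p) := by
  classical exact Finset.univ.filter fun j => b j ≠ 0

/-- The group support `{G : b_G ≠ 0}`. -/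
def groupSupp {p : ℕ} (P : Groups p) (b : Fin p → ℝ) : Finset (Finset (Fin p)) := by
  classical exact P.parts.filter fun G => ∃ j ∈ G, b j ≠ 0

/-- The effective sparsity `s_α`, with `√s_α = α √|S₀| + (1 - α) √|𝒢₀|`. -/
def effSparsity {p : ℕ} (α : ℝ) (P : Groups p) (b : Fin p → ℝ) : ℝ :=
  (α * √((supp b).card : ℝ) + (1 - α) * √((groupSupp P b).card : ℝ)) ^ 2

/-! ### Dependence and stochastic order -/

/-- The `1`-Lipschitz functions on `ℝˡ` for the `ℓ₁` distance. -/
def lipOne (l : ℕ) : Set ((Fin l → ℝ) → ℝ) :=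
  {f | ∀ z w, |f z - f w| ≤ ∑ i, |z i - w i|}

/-- The regular conditional distribution of `ξ` given the sub-`σ`-algebra `M`. -/
def condLaw {Ω : Type*} {mΩ : MeasurableSpace Ω} (μ : Measure Ω) [IsFiniteMeasure μ]
    (M : MeasurableSpace Ω) {l : ℕ} (ξ : Ω → Fin l → ℝ) (ω : Ω) : Measure (Fin l → ℝ) :=
  (@condDistrib Ω Ω (Fin l → ℝ) _ _ _ mΩ M ξ id μ _) ω

/-- `τ(M, ξ) = ‖ sup_{f ∈ Lip₁} |E(f(ξ) | M) - E f(ξ)| ‖₁`, where the conditional expectations are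
integrals against the regular conditional distribution of `ξ` given `M`. -/
def tau {Ω : Type*} {mΩ : MeasurableSpace Ω} (μ : Measure Ω) [IsFiniteMeasure μ]
    (M : MeasurableSpace Ω) {l : ℕ} (ξ : Ω → Fin l → ℝ) : ℝ≥0∞ :=
  ∫⁻ ω, ⨆ f ∈ lipOne l,
    ENNReal.ofReal |∫ z, f z ∂(condLaw μ M ξ ω) - ∫ ω', f (ξ ω') ∂μ| ∂μ

/-- The natural filtration `σ(v_t, v_{t-1}, …)` of a real process. -/
@[reducible] def past {Ω : Type*} (v : ℤ → Ω → ℝ) (t : ℤ) : MeasurableSpace Ω :=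
  ⨆ s : ℤ, ⨆ _ : s ≤ t, MeasurableSpace.comap (v s) inferInstance

/-- The `τ`-mixing coefficients
`τ_k = sup_{j ≥ 1} (1/j) sup_{t + k ≤ t₁ < ⋯ < t_j} τ(σ(v_t, v_{t-1}, …), (v_{t₁}, …, v_{t_j}))`
of a real process. -/
def tauMixing {Ω : Type*} [MeasurableSpace Ω] (μ : Measure Ω) [IsFiniteMeasure μ]
    (v : ℤ → Ω → ℝ) (k : ℕ) : ℝ≥0∞ :=
  ⨆ (j : ℕ) (_ : 1 ≤ j) (t : ℤ) (s : Fin j → ℤ) (_ : StrictMono s) (_ : ∀ i, t + (k : ℤ) ≤ s i),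
    (j : ℝ≥0∞)⁻¹ * tau μ (past v t) (fun ω i => v (s i) ω)

/-- Strict stationarity: all time shifts of the process have the same law (on path space). -/
def IsStationary {Ω E : Type*} [MeasurableSpace Ω] [MeasurableSpace E] (μ : Measure Ω)
    (Y : ℤ → Ω → E) : Prop :=
  ∀ h : ℤ, μ.map (fun ω (t : ℤ) => Y (t + h) ω) = μ.map (fun ω (t : ℤ) => Y t ω)

/-- `Z_T = O_P(r_T)` as `T → ∞`. -/
def IsBigOP {Ω : Type*} [MeasurableSpace Ω] (μ : Measure Ω) (Z : ℕ → Ω → ℝ) (r : ℕ → ℝ) : Prop :=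
  ∀ ε : ℝ, 0 < ε → ∃ C : ℝ, 0 < C ∧
    ∀ᶠ T in atTop, μ {ω | C * |r T| < |Z T ω|} ≤ ENNReal.ofReal ε

/-- The process is square integrable and `lim_{T → ∞} Var(T^{-1/2} ∑_{t=1}^T v_t)` exists and is
finite. -/
def HasFiniteLongRunVariance {Ω : Type*} [MeasurableSpace Ω] (μ : Measure Ω)
    (v : ℤ → Ω → ℝ) : Prop :=
  (∀ t, MemLp (v t) 2 μ) ∧
    ∃ V : ℝ, Tendsto (fun T : ℕ => variance (fun ω => (√(T : ℝ))⁻¹ * ∑ t, sample v T ω t) μ)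
      atTop (𝓝 V)

/-! ### Exponents and rates -/

/-- `ς = q r / (q + r)`. -/
def varsigma (q r : ℝ) : ℝ := q * r / (q + r)

/-- `κ = ((a + 1) ς - 1) / (a + ς - 1)`. -/
def kappa (a q r : ℝ) : ℝ := ((a + 1) * varsigma q r - 1) / (a + varsigma q r - 1)

/-- The exponent `((b + 1) r - 2) / (r + 2 (b - 1))`. -/
def muExp (b r : ℝ) : ℝ := ((b + 1) * r - 2) / (r + 2 * (b - 1))

/-- `(p / (δ T^{κ-1}))^{1/κ} ∨ √(log(8 p / δ) / T)`. -/
def lambdaRate (κ δ : ℝ) (p T : ℕ) : ℝ :=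
  max (((p : ℝ) / (δ * (T : ℝ) ^ (κ - 1))) ^ (1 / κ)) √(Real.log (8 * (p : ℝ) / δ) / (T : ℝ))

/-- `s p^{1/κ} / T^{1 - 1/κ} ∨ s √(log p / T)`. -/
def varianceRate (κ s : ℝ) (p T : ℕ) : ℝ :=
  max (s * (p : ℝ) ^ (1 / κ) / (T : ℝ) ^ (1 - 1 / κ)) (s * √(Real.log (p : ℝ) / (T : ℝ)))

/-! ### The model and the assumptions -/

/-- The linear projection model `y_t = m_t + u_t`, `m_t = ∑_{j ≥ 1} β_j x_{t,j}` (the series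
converges in mean square), with `E[u_t x_{t,j}] = 0` for all `j`. -/
structure LinearProjection {Ω : Type*} [MeasurableSpace Ω] (μ : Measure Ω)
    (y m u : ℤ → Ω → ℝ) (x : ℤ → ℕ → Ω → ℝ) (β : ℕ → ℝ) : Prop where
  measurable_m : ∀ t, Measurable (m t)
  measurable_u : ∀ t, Measurable (u t)
  measurable_x : ∀ t j, Measurable (x t j)
  series : ∀ t, Tendsto
    (fun n : ℕ => eLpNorm (fun ω => ∑ j ∈ Finset.range n, β j * x t j ω - m t ω) 2 μ)
    atTop (𝓝 0)
  model : ∀ t, ∀ ω, y t ω = m t ω + u t ω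
  orthogonal : ∀ t j, ∫ ω, u t ω * x t j ω ∂μ = 0

/-- Stationarity, moment and `τ`-mixing conditions on the data. -/
structure DataAssumption {Ω : Type*} [MeasurableSpace Ω] (μ : Measure Ω) [IsFiniteMeasure μ]
    (u : ℤ → Ω → ℝ) (x : ℤ → ℕ → Ω → ℝ) (q r a b c K : ℝ) : Prop where
  stationary_ux : ∀ p : ℕ, IsStationary μ (fun t ω (j : Fin p) => u t ω * x t j ω)
  stationary_xx : ∀ p : ℕ, IsStationary μ (fun t ω (j l : Fin p) => x t j ω * x t l ω)
  moment_u : ∀ t, eLpNorm (u t) (ENNReal.ofReal q) μ ≤ ENNReal.ofReal K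
  moment_x : ∀ t j, eLpNorm (x t j) (ENNReal.ofReal r) μ ≤ ENNReal.ofReal K
  mixing_ux : ∀ (j k : ℕ), 1 ≤ k →
    tauMixing μ (fun t ω => u t ω * x t j ω) k ≤ ENNReal.ofReal (c * (k : ℝ) ^ (-a))
  mixing_xx : ∀ (j l k : ℕ), 1 ≤ k →
    tauMixing μ (fun t ω => x t j ω * x t l ω) k ≤ ENNReal.ofReal (c * (k : ℝ) ^ (-b))

/-- The matrix `Σ = E[x_t x_tᵀ]` of the first `p` covariates. -/
def covMatrix {Ω : Type*} [MeasurableSpace Ω] (μ : Measure Ω) (x : ℤ → ℕ → Ω → ℝ) (t : ℤ)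
    (p : ℕ) : Matrix (Fin p) (Fin p) ℝ :=
  Matrix.of fun j l => ∫ ω, x t j ω * x t l ω ∂μ

/-- For every `p`, all eigenvalues of `Σ` are at least `γ`. -/
def CovarianceAssumption {Ω : Type*} [MeasurableSpace Ω] (μ : Measure Ω) (x : ℤ → ℕ → Ω → ℝ)
    (γ : ℝ) : Prop :=
  ∀ (t : ℤ) (p : ℕ) (θ : ℝ),
    Module.End.HasEigenvalue (Matrix.toLin' (covMatrix μ x t p)) θ → γ ≤ θ

/-- The regularization parameter satisfies `C₀ ρ_T ≤ λ_T ≤ C₁ ρ_T` for large `T`, where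
`ρ_T` is the rate `lambdaRate`. -/
def RegularizationAssumption (κ δ C₀ : ℝ) (p : ℕ → ℕ) (lam : ℕ → ℝ) : Prop :=
  ∃ C₁ : ℝ, ∀ᶠ T in atTop,
    C₀ * lambdaRate κ δ (p T) T ≤ lam T ∧ lam T ≤ C₁ * lambdaRate κ δ (p T) T

/-- Conditions on the misspecification error and on the growth of `s_T`, `p_T`. -/
structure RateAssumption {Ω : Type*} [MeasurableSpace Ω] (μ : Measure Ω)
    (m : ℤ → Ω → ℝ) (x : ℤ → ℕ → Ω → ℝ) (β : ℕ → ℝ) (ν : ℝ) (p : ℕ → ℕ) (s lam : ℕ → ℝ) :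
    Prop where
  misspecification : IsBigOP μ
    (fun T ω => empNormSq (sample m T ω - (design x T (p T) ω).mulVec (trunc β (p T))))
    (fun T => s T * lam T ^ 2)
  polynomial : Tendsto (fun T : ℕ => s T ^ ν * (p T : ℝ) ^ 2 * (T : ℝ) ^ (1 - ν)) atTop (𝓝 0)
  exponential : ∃ c' : ℝ, 0 < c' ∧
    Tendsto (fun T : ℕ => (p T : ℝ) ^ 2 * Real.exp (-c' * (T : ℝ) / s T ^ 2)) atTop (𝓝 0)

/-- `σ² = E ‖u‖_T²`. -/
def sigmaSq {Ω : Type*} [MeasurableSpace Ω] (μ : Measure Ω) (u : ℤ → Ω → ℝ) (T : ℕ) : ℝ :=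
  ∫ ω, empNormSq (sample u T ω) ∂μ

end

end SGL

/-!
The variance estimator is compared with `‖u‖_T²`, whose distance from `σ²` is `O_P(T^{-1/2})` by
Chebyshev's inequality (`isBigOP_empNormSq_sub_sigmaSq`). Since `s ≥ 1`, both this rate and `s λ`
are of at most the order of the asserted rate (`exists_mul_lambdaRate_le`,
`inv_sqrt_le_varianceRate`), so it remains to show that `σ̂² - ‖u‖_T² = O_P(s λ)`.

The upper bound follows from minimality at `β` and from `Ω(β) ≤ |β|₁ ≲ √s |β|₂`, where `|β|₂` is
bounded because the series for `m` converges in mean square and the covariance matrices are bounded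
below (`exists_sqrt_sum_sq_le`). The lower bound needs `⟨u, X(β̂ - β)⟩ = O_P(s λ)`. As `δ` is fixed,
the penalty dominates the noise `max_j |⟨u, X_j⟩|` only with a probability that need not tend to
one. However, the tail bound at the level `λ` is of order `1 / p`, so the expected number of
covariates with `|⟨u, X_j⟩| ≳ λ` is bounded: up to a small probability these covariates form a set
`B` with boundedly many elements, on which `|⟨u, X_j⟩| ≤ M λ`. The basic inequality then gives
`|β̂ - β|₁ ≲ √s + |β̂ - β|₂`. Since the sample covariance matrix is uniformly within `c / s` of the
population one, for any fixed `c > 0`, the eigenvalue condition turns this into `|β̂ - β|₂ ≲ 1` and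
`|β̂ - β|₁ ≲ √s` (`exists_abs_sigmaHatSq_sub_le`).

Both tail bounds, for `u_t x_{t,j}` and for `x_{t,j} x_{t,l}`, are instances of a Fuk–Nagaev
inequality for `τ`-mixing processes (`exists_fukNagaev`). It is proved without coupling: the
probability is bounded by the expectation of a Lipschitz ramp of a sum of blocks, and in this
expectation the last block is replaced by an independent copy, at a cost given by the
`τ`-coefficient, since the supremum over Lipschitz functions in its definition stands inside the
expectation (`abs_integral_sub_decoupled_le`, `integral_comp_sum_le`). For the independent copies
the truncated exponential moments are estimated directly (`exp_mul_min_le`). The variance of a block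
is linear in its length by a covariance inequality (`abs_integral_centered_mul_le`), and the block
length is chosen to balance the moment term against the mixing term (`rpow_exponent_balance`).
-/

namespace SGL

universe u

/-! ### Decoupling by the `τ`-coefficient -/

/-- For `F` Lipschitz in its second argument, replacing `ξ` by a copy independent of `M` changes
`E F(ω, ξ)` by at most a multiple of the `τ`-coefficient. For each `ω` the function `F(ω, ·)` is one
of the competitors in the supremum defining `τ`. -/
theorem abs_integral_sub_decoupled_le {Ω : Type u} {mΩ : MeasurableSpace Ω} (μ : Measure Ω)
    [IsProbabilityMeasure μ] {M : MeasurableSpace Ω} (hM : M ≤ mΩ) {l : ℕ} {ξ : Ω → Fin l → ℝ}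
    (hξ : Measurable[mΩ] ξ) (F : Ω → (Fin l → ℝ) → ℝ)
    (hF : Measurable[@Prod.instMeasurableSpace _ _ M _] (fun p : Ω × (Fin l → ℝ) => F p.1 p.2))
    {D : ℝ} (hD : 0 < D) (hLip : ∀ ω z w, |F ω z - F ω w| ≤ D * ∑ i, |z i - w i|)
    (hint : Integrable (fun ω => F ω (ξ ω)) μ)
    (hG : Integrable (fun ω => ∫ ω', F ω (ξ ω') ∂μ) μ) {τ : ℝ} (hτ0 : 0 ≤ τ)
    (hτ : tau μ M ξ ≤ ENNReal.ofReal τ) :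
    |(∫ ω, F ω (ξ ω) ∂μ) - ∫ ω, ∫ ω', F ω (ξ ω') ∂μ ∂μ| ≤ D * τ := by
  have hid : @Measurable Ω Ω mΩ M id := measurable_id'' hM
  have hFs : StronglyMeasurable[@Prod.instMeasurableSpace _ _ M _]
      (fun p : Ω × (Fin l → ℝ) => F p.1 p.2) := hF.stronglyMeasurable
  have hce := condExp_prod_ae_eq_integral_condDistrib (mβ := M) (X := id) (Y := ξ) (μ := μ)
    (f := fun p => F p.1 p.2) hid hξ.aemeasurable hFs hint
  have hcomap : M.comap id = M := MeasurableSpace.comap_id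
  rw [hcomap] at hce
  set H : Ω → ℝ := fun ω => ∫ z, F ω z ∂(condLaw μ M ξ ω) with hH
  have hceH : μ[fun a => F a (ξ a) | M] =ᵐ[μ] H := hce
  have hHint : Integrable H μ := (integrable_condExp (m := M)).congr hceH
  have hHeq : ∫ ω, F ω (ξ ω) ∂μ = ∫ ω, H ω ∂μ := by
    rw [← integral_condExp hM]; exact integral_congr_ae hceH
  rw [hHeq, ← integral_sub hHint hG]
  have hpt : ∀ ω, ENNReal.ofReal |H ω - ∫ ω', F ω (ξ ω') ∂μ| ≤ ENNReal.ofReal D *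
      ⨆ f ∈ lipOne l, ENNReal.ofReal |∫ z, f z ∂(condLaw μ M ξ ω) - ∫ ω', f (ξ ω') ∂μ| := by
    intro ω
    have hmem : (fun z => D⁻¹ * F ω z) ∈ lipOne l := by
      intro z w
      rw [← mul_sub, abs_mul, abs_of_pos (inv_pos.2 hD), inv_mul_le_iff₀ hD]
      exact hLip ω z w
    refine le_trans ?_ (mul_le_mul_right (le_iSup₂ (f := fun f (_ : f ∈ lipOne l) =>
      ENNReal.ofReal |∫ z, f z ∂(condLaw μ M ξ ω) - ∫ ω', f (ξ ω') ∂μ|) _ hmem) _)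
    rw [← ENNReal.ofReal_mul hD.le]
    refine ENNReal.ofReal_le_ofReal (le_of_eq ?_)
    rw [integral_const_mul, integral_const_mul, ← mul_sub, abs_mul, abs_of_pos (inv_pos.2 hD),
      mul_inv_cancel_left₀ hD.ne']
  have hle : ∫⁻ ω, ENNReal.ofReal |H ω - ∫ ω', F ω (ξ ω') ∂μ| ∂μ ≤ ENNReal.ofReal (D * τ) := by
    rw [ENNReal.ofReal_mul hD.le]
    refine (lintegral_mono hpt).trans ?_
    rw [lintegral_const_mul' _ _ ENNReal.ofReal_ne_top]
    gcongr
    exact hτ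
  calc |∫ ω, (H ω - ∫ ω', F ω (ξ ω') ∂μ) ∂μ| ≤ ∫ ω, |H ω - ∫ ω', F ω (ξ ω') ∂μ| ∂μ :=
        abs_integral_le_integral_abs
    _ = (∫⁻ ω, ENNReal.ofReal |H ω - ∫ ω', F ω (ξ ω') ∂μ| ∂μ).toReal :=
        integral_eq_lintegral_of_nonneg_ae (ae_of_all _ fun _ => abs_nonneg _)
          (hHint.sub hG).abs.aestronglyMeasurable
    _ ≤ D * τ := ENNReal.toReal_le_of_le_ofReal (by positivity) hle

/-- The bridge between the dependent sum and independent summands: peeling off the last summand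
replaces it by an independent copy, at a price controlled by the `τ`-coefficient. -/
theorem integral_comp_sum_le {Ω : Type u} {mΩ : MeasurableSpace Ω} (μ : Measure Ω)
    [IsProbabilityMeasure μ] {l : ℕ} (M : ℕ → MeasurableSpace Ω) (hM : ∀ i, M i ≤ mΩ)
    (ξ : ℕ → Ω → Fin l → ℝ) (hξ : ∀ i, Measurable (ξ i)) (h : ℕ → (Fin l → ℝ) → ℝ)
    (hh : ∀ i, h i ∈ lipOne l)
    (hS : ∀ n, Measurable[M n] (fun ω => ∑ i ∈ Finset.range n, h i (ξ i ω)))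
    {τ : ℝ} (hτ0 : 0 ≤ τ) (hτ : ∀ i, tau μ (M i) (ξ i) ≤ ENNReal.ofReal τ)
    {θ y B Q D : ℝ} (hD : 0 < D)
    (hB : ∀ i, Integrable (fun ω => Real.exp (θ * min (h i (ξ i ω)) y)) μ ∧
      ∫ ω, Real.exp (θ * min (h i (ξ i ω)) y) ∂μ ≤ B)
    (hQ : ∀ i, μ.real {ω | y < h i (ξ i ω)} ≤ Q) (n : ℕ) :
    ∀ (φ : ℝ → ℝ) (A E : ℝ), 0 ≤ A → 0 ≤ E → (∀ s t, |φ s - φ t| ≤ D * |s - t|) →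
      (∀ s, 0 ≤ φ s) → (∀ s, φ s ≤ 1) → (∀ s, φ s ≤ A * Real.exp (θ * s) + E) →
      ∫ ω, φ (∑ i ∈ Finset.range n, h i (ξ i ω)) ∂μ ≤ A * B ^ n + E + n * Q + n * (D * τ) := by
  have hlipc : ∀ i, Continuous (h i) := by
    intro i
    refine LipschitzWith.continuous (K := (l : NNReal)) (LipschitzWith.of_dist_le_mul ?_)
    intro z w
    rw [Real.dist_eq]
    refine (hh i z w).trans ?_
    calc ∑ k, |z k - w k| ≤ ∑ _k : Fin l, dist z w :=
          Finset.sum_le_sum fun k _ => by rw [← Real.dist_eq]; exact dist_le_pi_dist z w k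
      _ = _ := by simp
  have hXm : ∀ i, Measurable (fun ω => h i (ξ i ω)) := fun i => (hlipc i).measurable.comp (hξ i)
  induction n with
  | zero =>
    intro φ A E hA hE _ _ _ hbd
    simpa using hbd 0
  | succ n ih =>
    intro φ A E hA hE hlip h0 h1 hbd
    have hφc : Continuous φ := by
      refine LipschitzWith.continuous (K := ⟨D, hD.le⟩) (LipschitzWith.of_dist_le_mul ?_)
      intro s t
      rw [Real.dist_eq, Real.dist_eq]
      exact hlip s t
    set X : Ω → ℝ := fun ω => h n (ξ n ω) with hX
    set S : Ω → ℝ := fun ω => ∑ i ∈ Finset.range n, h i (ξ i ω) with hSdef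
    have hbint : ∀ f : Ω → ℝ, Measurable f → Integrable (fun ω => φ (f ω)) μ := by
      intro f hf
      refine Integrable.of_bound (hφc.measurable.comp hf).aestronglyMeasurable 1 ?_
      filter_upwards with ω
      rw [Real.norm_eq_abs, abs_of_nonneg (h0 _)]
      exact h1 _
    set ψ : ℝ → ℝ := fun s => ∫ ω, φ (s + X ω) ∂μ with hψ
    have hsX : ∀ s, Integrable (fun ω => φ (s + X ω)) μ :=
      fun s => hbint _ ((hXm n).const_add s)
    -- Averaging over an independent copy of the last summand preserves all properties of `φ`.
    have hψlip : ∀ s t, |ψ s - ψ t| ≤ D * |s - t| := by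
      intro s t
      rw [hψ]
      simp only
      rw [← integral_sub (hsX s) (hsX t)]
      refine abs_integral_le_integral_abs.trans ?_
      calc ∫ ω, |φ (s + X ω) - φ (t + X ω)| ∂μ ≤ ∫ _ω, D * |s - t| ∂μ := by
            refine integral_mono ((hsX s).sub (hsX t)).abs (integrable_const _) fun ω => ?_
            refine (hlip _ _).trans (le_of_eq ?_)
            congr 2
            ring
        _ = D * |s - t| := by simp
    have hψ0 : ∀ s, 0 ≤ ψ s := fun s => integral_nonneg fun ω => h0 _
    have hψ1 : ∀ s, ψ s ≤ 1 := fun s => by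
      calc ψ s ≤ ∫ _ω, (1 : ℝ) ∂μ := integral_mono (hsX s) (integrable_const _) fun ω => h1 _
        _ = 1 := by simp
    have hψc : Continuous ψ := by
      refine LipschitzWith.continuous (K := ⟨D, hD.le⟩) (LipschitzWith.of_dist_le_mul ?_)
      intro s t
      rw [Real.dist_eq, Real.dist_eq]
      exact hψlip s t
    have hψbd : ∀ s, ψ s ≤ (A * B) * Real.exp (θ * s) + (E + Q) := by
      intro s
      have hmset : MeasurableSet {ω | y < X ω} := measurableSet_lt measurable_const (hXm n)
      have hI1 : Integrable (fun ω => A * Real.exp (θ * s) * Real.exp (θ * min (X ω) y)) μ :=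
        (hB n).1.const_mul _
      have hI3 : Integrable ({ω | y < X ω}.indicator (fun _ => (1 : ℝ))) μ :=
        (integrable_const _).indicator hmset
      calc ψ s ≤ ∫ ω, (A * Real.exp (θ * s) * Real.exp (θ * min (X ω) y) + E +
              {ω | y < X ω}.indicator (fun _ => (1 : ℝ)) ω) ∂μ := by
            refine integral_mono (hsX s) ((hI1.add (integrable_const _)).add hI3) fun ω => ?_
            by_cases hy : y < X ω
            · have : {ω | y < X ω}.indicator (fun _ => (1 : ℝ)) ω = 1 :=
                Set.indicator_of_mem (s := {ω | y < X ω}) hy _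
              simp only [this]
              have := h1 (s + X ω)
              have h3 : 0 ≤ A * Real.exp (θ * s) * Real.exp (θ * min (X ω) y) := by positivity
              linarith
            · have : {ω | y < X ω}.indicator (fun _ => (1 : ℝ)) ω = 0 :=
                Set.indicator_of_notMem (s := {ω | y < X ω}) hy _
              simp only [this]
              rw [min_eq_left (not_lt.1 hy), mul_assoc, ← Real.exp_add, ← mul_add, add_zero]
              exact hbd _
        _ = A * Real.exp (θ * s) * ∫ ω, Real.exp (θ * min (X ω) y) ∂μ + E +
              μ.real {ω | y < X ω} := by
            have hI2 : Integrable
                (fun ω => A * Real.exp (θ * s) * Real.exp (θ * min (X ω) y) + E) μ :=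
              hI1.add (integrable_const _)
            rw [integral_add hI2 hI3,
              integral_add hI1 (integrable_const _), integral_const_mul,
              integral_indicator hmset]
            simp
        _ ≤ A * Real.exp (θ * s) * B + E + Q := by
            have := hQ n
            have h2 := (hB n).2
            gcongr
        _ = _ := by ring
    have hB0 : 0 ≤ B := (integral_nonneg fun ω => (Real.exp_pos _).le).trans (hB n).2
    have hQ0 : 0 ≤ Q := measureReal_nonneg.trans (hQ n)
    have hrec := ih ψ (A * B) (E + Q) (by positivity) (by positivity) hψlip hψ0 hψ1 hψbd
    have hSm : Measurable S := (hS n).mono (hM n) le_rfl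
    have hdec := abs_integral_sub_decoupled_le μ (hM n) (hξ n)
      (fun ω z => φ (S ω + h n z)) (D := D) ?_ hD ?_ (hbint _ (hSm.add (hXm n))) ?_ hτ0 (hτ n)
    · have hd := (abs_le.1 hdec).2
      have e1 : ∀ ω, φ (∑ i ∈ Finset.range (n + 1), h i (ξ i ω)) = φ (S ω + h n (ξ n ω)) := by
        intro ω
        rw [Finset.sum_range_succ]
      simp_rw [e1]
      have hd' : ∫ ω, φ (S ω + h n (ξ n ω)) ∂μ ≤ ∫ ω, ψ (S ω) ∂μ + D * τ := by
        have : ∫ ω, ψ (S ω) ∂μ = ∫ ω, ∫ ω', φ (S ω + h n (ξ n ω')) ∂μ ∂μ := rfl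
        linarith
      have hr2 : ∫ ω, ψ (S ω) ∂μ ≤ A * B * B ^ n + (E + Q) + n * Q + n * (D * τ) := hrec
      push_cast
      rw [pow_succ]
      nlinarith
    · refine hφc.measurable.comp (Measurable.add ?_ ?_)
      · exact (hS n).comp (@measurable_fst _ _ (M n) _)
      · exact (hlipc n).measurable.comp (@measurable_snd _ _ (M n) _)
    · intro ω z w
      refine (hlip _ _).trans ?_
      rw [add_sub_add_left_eq_sub]
      gcongr
      exact hh n z w
    · exact Integrable.of_bound (hψc.measurable.comp hSm).aestronglyMeasurable 1
        (ae_of_all _ fun ω => by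
          rw [Real.norm_eq_abs]
          exact (abs_of_nonneg (hψ0 (S ω))).trans_le (hψ1 _))

/-! ### A Fuk–Nagaev inequality for weakly dependent summands -/

theorem exp_le_one_add_add_sq {z ς : ℝ} (hς : 0 ≤ ς) (hz : z ≤ ς) :
    Real.exp z ≤ 1 + z + Real.exp ς * z ^ 2 := by
  rcases le_total 0 z with h0 | h0
  · have h1 : Real.exp z * (1 - z) ≤ 1 := by
      have := Real.add_one_le_exp (-z)
      calc Real.exp z * (1 - z) ≤ Real.exp z * Real.exp (-z) := by
            gcongr; linarith
        _ = 1 := by rw [← Real.exp_add]; simp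
    have h2 : Real.exp z * z ^ 2 ≤ Real.exp ς * z ^ 2 := by gcongr
    nlinarith
  · have h1 : Real.exp z * (1 - z) ≤ 1 := by
      have := Real.add_one_le_exp (-z)
      calc Real.exp z * (1 - z) ≤ Real.exp z * Real.exp (-z) := by
            gcongr; linarith
        _ = 1 := by rw [← Real.exp_add]; simp
    have h2 : z ^ 2 ≤ Real.exp ς * z ^ 2 := by
      have := Real.one_le_exp hς
      nlinarith [sq_nonneg z]
    have h3 : (1 - z) * Real.exp z ≤ (1 - z) * (1 + z + z ^ 2) := by
      nlinarith [pow_nonneg (neg_nonneg.2 h0) 3]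
    have := le_of_mul_le_mul_left h3 (by linarith)
    linarith

/-- Beyond `ς / θ` the exponential grows faster than the power `ς`, so on `[ς / θ, y]` it lies
below the multiple of that power which agrees with it at `y`; below `ς / θ` a second order
expansion is enough. -/
theorem exp_mul_min_le {X y θ ς : ℝ} (hθ : 0 < θ) (hy : 0 < y) (hς : 0 < ς) :
    Real.exp (θ * min X y) ≤ 1 + θ * X + Real.exp ς * θ ^ 2 * X ^ 2 +
      |X| ^ ς / y ^ ς * Real.exp (θ * y) := by
  have hpow : 0 ≤ |X| ^ ς / y ^ ς * Real.exp (θ * y) := by positivity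
  rcases le_total (θ * min X y) ς with h | h
  · have h1 := exp_le_one_add_add_sq hς.le h
    have h2 : (min X y) ^ 2 ≤ X ^ 2 := by
      rcases le_total X y with hxy | hxy
      · rw [min_eq_left hxy]
      · rw [min_eq_right hxy]; gcongr
    have h3 : θ * min X y ≤ θ * X := by gcongr; exact min_le_left _ _
    have h4 : Real.exp ς * (θ * min X y) ^ 2 ≤ Real.exp ς * θ ^ 2 * X ^ 2 := by
      rw [mul_pow, mul_assoc]; gcongr
    linarith
  · set Y := min X y with hY
    have hYpos : 0 < Y := by
      by_contra hneg
      push Not at hneg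
      nlinarith
    have hXY : Y ≤ X := min_le_left _ _
    have hYy : Y ≤ y := min_le_right _ _
    have hX : 0 < X := hYpos.trans_le hXY
    have hlog : ς * Real.log (y / Y) ≤ θ * (y - Y) := by
      have h1 := Real.log_le_sub_one_of_pos (div_pos hy hYpos)
      have h2 : ς * (y / Y - 1) ≤ θ * (y - Y) := by
        have : ς * (y / Y - 1) = ς / Y * (y - Y) := by field_simp
        rw [this]
        have h3 : ς / Y ≤ θ := by rw [div_le_iff₀ hYpos]; exact h
        gcongr
      have := mul_le_mul_of_nonneg_left h1 hς.le
      linarith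
    have hrp : (y / Y) ^ ς ≤ Real.exp (θ * (y - Y)) := by
      rw [Real.rpow_def_of_pos (div_pos hy hYpos), mul_comm]
      exact Real.exp_le_exp.2 hlog
    rw [Real.div_rpow hy.le hYpos.le, div_le_iff₀ (by positivity)] at hrp
    have hmain : Real.exp (θ * Y) ≤ |X| ^ ς / y ^ ς * Real.exp (θ * y) := by
      rw [div_mul_eq_mul_div, le_div_iff₀ (by positivity)]
      have hsplit : Real.exp (θ * y) = Real.exp (θ * Y) * Real.exp (θ * (y - Y)) := by
        rw [← Real.exp_add]; ring_nf
      have hYX : Y ^ ς ≤ |X| ^ ς := by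
        rw [abs_of_pos hX]
        exact Real.rpow_le_rpow hYpos.le hXY hς.le
      calc Real.exp (θ * Y) * y ^ ς ≤ Real.exp (θ * Y) * (Real.exp (θ * (y - Y)) * Y ^ ς) := by
            gcongr
        _ = Y ^ ς * Real.exp (θ * y) := by rw [hsplit]; ring
        _ ≤ _ := by gcongr
    have : 0 ≤ 1 + θ * X + Real.exp ς * θ ^ 2 * X ^ 2 := by positivity
    linarith

theorem integral_exp_mul_min_le {Ω : Type u} [MeasurableSpace Ω] (μ : Measure Ω)
    [IsProbabilityMeasure μ] {X : Ω → ℝ} (hXm : Measurable X) {y θ ς A v : ℝ} (hθ : 0 < θ)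
    (hy : 0 < y) (hς : 0 < ς) (hX : Integrable X μ) (hX0 : ∫ ω, X ω ∂μ = 0)
    (hX2 : Integrable (fun ω => X ω ^ 2) μ) (hv : ∫ ω, X ω ^ 2 ∂μ ≤ v)
    (hXς : Integrable (fun ω => |X ω| ^ ς) μ) (hA : ∫ ω, |X ω| ^ ς ∂μ ≤ A) :
    Integrable (fun ω => Real.exp (θ * min (X ω) y)) μ ∧
      ∫ ω, Real.exp (θ * min (X ω) y) ∂μ ≤
        Real.exp (Real.exp ς * θ ^ 2 * v + A / y ^ ς * Real.exp (θ * y)) := by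
  have hI : Integrable (fun ω => 1 + θ * X ω + Real.exp ς * θ ^ 2 * X ω ^ 2 +
      |X ω| ^ ς / y ^ ς * Real.exp (θ * y)) μ :=
    (((integrable_const _).add (hX.const_mul _)).add (hX2.const_mul _)).add
      ((hXς.div_const _).mul_const _)
  have hle : Integrable (fun ω => Real.exp (θ * min (X ω) y)) μ := by
    refine hI.mono' (by fun_prop) (ae_of_all _ fun ω => ?_)
    rw [Real.norm_eq_abs, abs_of_pos (Real.exp_pos _)]
    exact exp_mul_min_le hθ hy hς
  refine ⟨hle, ?_⟩
  have h1 : Integrable (fun ω => 1 + θ * X ω) μ := (integrable_const _).add (hX.const_mul _)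
  have h2 : Integrable (fun ω => 1 + θ * X ω + Real.exp ς * θ ^ 2 * X ω ^ 2) μ :=
    h1.add (hX2.const_mul _)
  calc ∫ ω, Real.exp (θ * min (X ω) y) ∂μ
      ≤ ∫ ω, (1 + θ * X ω + Real.exp ς * θ ^ 2 * X ω ^ 2 +
          |X ω| ^ ς / y ^ ς * Real.exp (θ * y)) ∂μ :=
        integral_mono hle hI fun ω => exp_mul_min_le hθ hy hς
    _ = 1 + Real.exp ς * θ ^ 2 * ∫ ω, X ω ^ 2 ∂μ +
          (∫ ω, |X ω| ^ ς ∂μ) / y ^ ς * Real.exp (θ * y) := by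
        rw [integral_add h2 ((hXς.div_const _).mul_const _), integral_add h1 (hX2.const_mul _),
          integral_add (integrable_const _) (hX.const_mul _), integral_const_mul,
          integral_const_mul, integral_mul_const, integral_div, hX0]
        simp
    _ ≤ 1 + (Real.exp ς * θ ^ 2 * v + A / y ^ ς * Real.exp (θ * y)) := by
        have e1 : Real.exp ς * θ ^ 2 * ∫ ω, X ω ^ 2 ∂μ ≤ Real.exp ς * θ ^ 2 * v := by gcongr
        have e2 : (∫ ω, |X ω| ^ ς ∂μ) / y ^ ς * Real.exp (θ * y) ≤
            A / y ^ ς * Real.exp (θ * y) := by gcongr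
        linarith
    _ ≤ _ := by
        have := Real.add_one_le_exp (Real.exp ς * θ ^ 2 * v + A / y ^ ς * Real.exp (θ * y))
        linarith

theorem measureReal_lt_le_of_rpow {Ω : Type u} [MeasurableSpace Ω] (μ : Measure Ω)
    [IsProbabilityMeasure μ] {X : Ω → ℝ} {y ς A : ℝ} (hy : 0 < y) (hς : 0 < ς)
    (hXς : Integrable (fun ω => |X ω| ^ ς) μ) (hA : ∫ ω, |X ω| ^ ς ∂μ ≤ A) :
    μ.real {ω | y < X ω} ≤ A / y ^ ς := by
  have hsub : {ω | y < X ω} ⊆ {ω | y ^ ς ≤ |X ω| ^ ς} := by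
    intro ω hω
    exact Real.rpow_le_rpow hy.le ((le_of_lt hω).trans (le_abs_self _)) hς.le
  have h1 := mul_meas_ge_le_integral_of_nonneg (μ := μ) (f := fun ω => |X ω| ^ ς)
    (ae_of_all _ fun ω => by positivity) hXς (y ^ ς)
  rw [le_div_iff₀ (by positivity), mul_comm]
  calc y ^ ς * μ.real {ω | y < X ω} ≤ y ^ ς * μ.real {ω | y ^ ς ≤ |X ω| ^ ς} := by
        gcongr
        exact measure_ne_top _ _
    _ ≤ A := h1.trans hA

/-- A choice of `θ` for which the exponential bound of the truncated sum splits into a Gaussian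
and a power term. -/
theorem exists_exp_optimal {x V A' ς : ℝ} (hx : 0 < x) (hV : 0 < V) (hA : 0 < A')
    (hA1 : A' < 1) :
    ∃ θ, 0 < θ ∧ Real.exp (-(θ * x)) *
      Real.exp (Real.exp ς * θ ^ 2 * V + A' * Real.exp (θ * (x / 2))) ≤
        Real.exp 1 * (Real.exp (-(x ^ 2 / (4 * Real.exp ς * V))) + A') := by
  set C := Real.exp ς with hC
  have hCpos : 0 < C := Real.exp_pos _
  set θ := min (x / (2 * C * V)) (-Real.log A' / (x / 2)) with hθ
  have hlog : 0 < -Real.log A' := by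
    have := Real.log_neg hA hA1
    linarith
  have hθpos : 0 < θ := lt_min (by positivity) (by positivity)
  refine ⟨θ, hθpos, ?_⟩
  have h1 : A' * Real.exp (θ * (x / 2)) ≤ 1 := by
    have : θ * (x / 2) ≤ -Real.log A' := by
      rw [← le_div_iff₀ (by positivity)]
      exact min_le_right _ _
    calc A' * Real.exp (θ * (x / 2)) ≤ A' * Real.exp (-Real.log A') := by gcongr
      _ = 1 := by rw [Real.exp_neg, Real.exp_log hA, mul_inv_cancel₀ hA.ne']
  have h2 : C * θ ^ 2 * V ≤ θ * x / 2 := by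
    have : θ ≤ x / (2 * C * V) := min_le_left _ _
    rw [le_div_iff₀ (by positivity)] at this
    nlinarith
  have h3 : Real.exp (-(θ * x / 2)) ≤ Real.exp (-(x ^ 2 / (4 * C * V))) + A' := by
    rcases min_choice (x / (2 * C * V)) (-Real.log A' / (x / 2)) with h | h
    · have : Real.exp (-(θ * x / 2)) = Real.exp (-(x ^ 2 / (4 * C * V))) := by
        rw [hθ, h]; congr 2; field_simp; ring
      rw [this]; linarith
    · have : Real.exp (-(θ * x / 2)) = A' := by
        rw [hθ, h]
        have : -(-Real.log A' / (x / 2) * x / 2) = Real.log A' := by field_simp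
        rw [this, Real.exp_log hA]
      rw [this]
      have := Real.exp_pos (-(x ^ 2 / (4 * C * V)))
      linarith
  calc Real.exp (-(θ * x)) * Real.exp (C * θ ^ 2 * V + A' * Real.exp (θ * (x / 2)))
      = Real.exp (-(θ * x) + (C * θ ^ 2 * V + A' * Real.exp (θ * (x / 2)))) :=
        (Real.exp_add _ _).symm
    _ ≤ Real.exp (1 + -(θ * x / 2)) := Real.exp_le_exp.2 (by linarith)
    _ = Real.exp 1 * Real.exp (-(θ * x / 2)) := Real.exp_add _ _
    _ ≤ _ := by gcongr

/-- A Fuk–Nagaev inequality for sums of functionals of `ξ₀, ξ₁, …`, each nearly independent, in the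
sense of `τ`, of the preceding ones. The indicator of `[2x, ∞)` is replaced by a ramp with slope
`1 / x`, for which the comparison with independent summands costs `n τ / x`. -/
theorem measureReal_sum_ge_le {Ω : Type u} {mΩ : MeasurableSpace Ω} (μ : Measure Ω)
    [IsProbabilityMeasure μ] {l : ℕ} (M : ℕ → MeasurableSpace Ω) (hM : ∀ i, M i ≤ mΩ)
    (ξ : ℕ → Ω → Fin l → ℝ) (hξ : ∀ i, Measurable (ξ i)) (h : ℕ → (Fin l → ℝ) → ℝ)
    (hh : ∀ i, h i ∈ lipOne l) (hhm : ∀ i, Measurable (h i))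
    (hS : ∀ n, Measurable[M n] (fun ω => ∑ i ∈ Finset.range n, h i (ξ i ω)))
    {τ : ℝ} (hτ0 : 0 ≤ τ) (hτ : ∀ i, tau μ (M i) (ξ i) ≤ ENNReal.ofReal τ)
    {ς A v : ℝ} (hς : 0 < ς) (hA0 : 0 < A) (hv0 : 0 < v)
    (hI : ∀ i, Integrable (fun ω => h i (ξ i ω)) μ) (hI0 : ∀ i, ∫ ω, h i (ξ i ω) ∂μ = 0)
    (hI2 : ∀ i, Integrable (fun ω => h i (ξ i ω) ^ 2) μ) (hv : ∀ i, ∫ ω, h i (ξ i ω) ^ 2 ∂μ ≤ v)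
    (hIς : ∀ i, Integrable (fun ω => |h i (ξ i ω)| ^ ς) μ)
    (hA : ∀ i, ∫ ω, |h i (ξ i ω)| ^ ς ∂μ ≤ A) {n : ℕ} (hn : 0 < n) {x : ℝ} (hx : 0 < x) :
    μ.real {ω | 2 * x ≤ ∑ i ∈ Finset.range n, h i (ξ i ω)} ≤
      (1 + Real.exp 1) * (n * A / (x / 2) ^ ς) +
        Real.exp 1 * Real.exp (-(x ^ 2 / (4 * Real.exp ς * (n * v)))) + n * τ / x := by
  have hn' : (0 : ℝ) < n := by exact_mod_cast hn
  set A' : ℝ := n * A / (x / 2) ^ ς with hA'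
  have hA'0 : 0 < A' := by positivity
  have he := Real.exp_pos 1
  rcases lt_or_ge A' 1 with hA1 | hA1
  swap
  -- If `A' ≥ 1` the right-hand side exceeds one.
  · have h1 : μ.real {ω | 2 * x ≤ ∑ i ∈ Finset.range n, h i (ξ i ω)} ≤ 1 := measureReal_le_one
    have h2 : 0 ≤ Real.exp 1 * Real.exp (-(x ^ 2 / (4 * Real.exp ς * (n * v)))) := by positivity
    have h3 : 0 ≤ n * τ / x := by positivity
    nlinarith
  obtain ⟨θ, hθ, hopt⟩ := exists_exp_optimal (ς := ς) hx (V := n * v) (by positivity) hA'0 hA1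
  set φ : ℝ → ℝ := fun s => max 0 (min 1 ((s - x) / x)) with hφ
  have hφ1 : ∀ s, φ s ≤ 1 := fun s => max_le zero_le_one (min_le_left _ _)
  have hφ0 : ∀ s, 0 ≤ φ s := fun s => le_max_left _ _
  have hφl : ∀ s t, |φ s - φ t| ≤ x⁻¹ * |s - t| := by
    intro s t
    have e1 := abs_max_sub_max_le_max 0 (min 1 ((s - x) / x)) 0 (min 1 ((t - x) / x))
    have e2 := abs_min_sub_min_le_max 1 ((s - x) / x) 1 ((t - x) / x)
    rw [sub_self, abs_zero, max_eq_right (abs_nonneg (min 1 ((s - x) / x) - _))] at e1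
    rw [sub_self, abs_zero, max_eq_right (abs_nonneg ((s - x) / x - _))] at e2
    refine (e1.trans e2).trans (le_of_eq ?_)
    rw [← sub_div, sub_sub_sub_cancel_right,
      abs_div, abs_of_pos hx, div_eq_inv_mul]
  have hφe : ∀ s, φ s ≤ Real.exp (-(θ * x)) * Real.exp (θ * s) + 0 := by
    intro s
    rw [add_zero, ← Real.exp_add]
    rcases le_total s x with hs | hs
    · have : φ s = 0 := by
        refine max_eq_left ((min_le_right _ _).trans ?_)
        exact div_nonpos_of_nonpos_of_nonneg (by linarith) hx.le
      rw [this]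
      positivity
    · refine (hφ1 s).trans (Real.one_le_exp ?_)
      nlinarith
  set B : ℝ := Real.exp (Real.exp ς * θ ^ 2 * v + A / (x / 2) ^ ς * Real.exp (θ * (x / 2)))
    with hB
  have key := integral_comp_sum_le μ M hM ξ hξ h hh hS hτ0 hτ (θ := θ) (y := x / 2) (B := B)
    (Q := A / (x / 2) ^ ς) (D := x⁻¹) (inv_pos.2 hx)
    (fun i => integral_exp_mul_min_le μ ((hhm i).comp (hξ i)) hθ (by positivity) hς (hI i) (hI0 i)
      (hI2 i) (hv i) (hIς i) (hA i))
    (fun i => measureReal_lt_le_of_rpow μ (by positivity) hς (hIς i) (hA i)) n φ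
    (Real.exp (-(θ * x))) 0 (Real.exp_pos _).le le_rfl hφl hφ0 hφ1 hφe
  have hBn : B ^ n = Real.exp (Real.exp ς * θ ^ 2 * (n * v) + A' * Real.exp (θ * (x / 2))) := by
    rw [hB, ← Real.exp_nat_mul]
    congr 1
    rw [hA']
    ring
  rw [hBn] at key
  have hSm : Measurable (fun ω => ∑ i ∈ Finset.range n, h i (ξ i ω)) :=
    (hS n).mono (hM n) le_rfl
  have hφc : Measurable φ := by fun_prop
  have hms : MeasurableSet {ω | 2 * x ≤ ∑ i ∈ Finset.range n, h i (ξ i ω)} :=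
    measurableSet_le measurable_const hSm
  have hlow : μ.real {ω | 2 * x ≤ ∑ i ∈ Finset.range n, h i (ξ i ω)} ≤
      ∫ ω, φ (∑ i ∈ Finset.range n, h i (ξ i ω)) ∂μ := by
    rw [← integral_indicator_one hms]
    refine integral_mono ((integrable_const _).indicator hms) ?_ fun ω => ?_
    · refine Integrable.of_bound (hφc.comp hSm).aestronglyMeasurable 1 (ae_of_all _ fun ω => ?_)
      rw [Real.norm_eq_abs, abs_of_nonneg (hφ0 _)]
      exact hφ1 _
    · by_cases hω : 2 * x ≤ ∑ i ∈ Finset.range n, h i (ξ i ω)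
      · rw [Set.indicator_of_mem (by exact hω)]
        have : 1 ≤ (∑ i ∈ Finset.range n, h i (ξ i ω) - x) / x := by
          rw [le_div_iff₀ hx]; linarith
        exact le_max_of_le_right (le_min le_rfl this)
      · rw [Set.indicator_of_notMem (by exact hω)]
        exact hφ0 _
  have hfin : (n : ℝ) * (A / (x / 2) ^ ς) = A' := by rw [hA']; ring
  have hfin2 : (n : ℝ) * (x⁻¹ * τ) = n * τ / x := by field_simp
  rw [hfin, hfin2] at key
  linarith

/-! ### Covariances and block sums of `τ`-mixing processes -/

/-- The process minus its mean. -/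
noncomputable def centered {Ω : Type u} [MeasurableSpace Ω] (μ : Measure Ω) (v : ℤ → Ω → ℝ)
    (t : ℤ) (ω : Ω) : ℝ := v t ω - ∫ ω', v t ω' ∂μ

/-- A real process whose centred marginals have absolute moments of order `ς` bounded by `A`, and
whose `τ`-mixing coefficients are at most `c k^{-a}`. -/
structure WeaklyDependent {Ω : Type u} [MeasurableSpace Ω] (μ : Measure Ω) [IsFiniteMeasure μ]
    (v : ℤ → Ω → ℝ) (ς a c A : ℝ) : Prop where
  measurable : ∀ t, Measurable (v t)
  integrable : ∀ t, Integrable (v t) μ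
  integrable_rpow : ∀ t, Integrable (fun ω => |centered μ v t ω| ^ ς) μ
  moment : ∀ t, ∫ ω, |centered μ v t ω| ^ ς ∂μ ≤ A
  mixing : ∀ k : ℕ, 1 ≤ k → tauMixing μ v k ≤ ENNReal.ofReal (c * (k : ℝ) ^ (-a))

theorem past_le {Ω : Type u} {mΩ : MeasurableSpace Ω} {v : ℤ → Ω → ℝ}
    (hv : ∀ t, Measurable (v t)) (t : ℤ) : past v t ≤ mΩ :=
  iSup₂_le fun s _ => (hv s).comap_le

theorem measurable_past {Ω : Type u} (v : ℤ → Ω → ℝ) {s t : ℤ} (h : s ≤ t) :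
    Measurable[past v t] (v s) :=
  measurable_iff_comap_le.2 (le_iSup₂ (f := fun (s : ℤ) (_ : s ≤ t) =>
    MeasurableSpace.comap (v s) inferInstance) s h)

theorem sq_le_one_add_rpow {ς z : ℝ} (hς : 2 ≤ ς) (hz : 0 ≤ z) : z ^ 2 ≤ 1 + z ^ ς := by
  rcases le_total z 1 with h1 | h1
  · have := Real.rpow_nonneg hz ς
    nlinarith
  · have := Real.rpow_le_rpow_of_exponent_le h1 hς
    rw [Real.rpow_two] at this
    linarith

namespace WeaklyDependent

variable {Ω : Type u} [MeasurableSpace Ω] {μ : Measure Ω} [IsProbabilityMeasure μ]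
  {v : ℤ → Ω → ℝ} {ς a c A : ℝ}

/-- The `τ`-coefficient of a vector of `j` observations at a distance of at least `k`. -/
theorem tau_le (h : WeaklyDependent μ v ς a c A) {j k : ℕ} (hj : 1 ≤ j) (hk : 1 ≤ k) (t : ℤ)
    (s : Fin j → ℤ) (hs : StrictMono s) (hts : ∀ i, t + (k : ℤ) ≤ s i) :
    tau μ (past v t) (fun ω i => v (s i) ω) ≤ ENNReal.ofReal (j * (c * (k : ℝ) ^ (-a))) := by
  have h1 : (j : ℝ≥0∞)⁻¹ * tau μ (past v t) (fun ω i => v (s i) ω) ≤ tauMixing μ v k := by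
    unfold tauMixing
    refine le_iSup_of_le j (le_iSup_of_le hj (le_iSup_of_le t (le_iSup_of_le s
      (le_iSup_of_le hs (le_iSup_of_le hts le_rfl)))))
  have h2 := h1.trans (h.mixing k hk)
  have hj0 : (j : ℝ≥0∞) ≠ 0 := by
    simp only [ne_eq, Nat.cast_eq_zero]; omega
  rw [ENNReal.inv_mul_le_iff hj0 (ENNReal.natCast_ne_top j)] at h2
  refine h2.trans (le_of_eq ?_)
  rw [ENNReal.ofReal_mul (p := (j : ℝ)) (Nat.cast_nonneg j), ENNReal.ofReal_natCast]

theorem measurable_centered (h : WeaklyDependent μ v ς a c A) (t : ℤ) :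
    Measurable (centered μ v t) := (h.measurable t).sub_const _

theorem integrable_centered (h : WeaklyDependent μ v ς a c A) (t : ℤ) :
    Integrable (centered μ v t) μ := (h.integrable t).sub (integrable_const _)

theorem integral_centered (h : WeaklyDependent μ v ς a c A) (t : ℤ) :
    ∫ ω, centered μ v t ω ∂μ = 0 := by
  unfold centered
  rw [integral_sub (h.integrable t) (integrable_const _)]
  simp

theorem moment_nonneg (h : WeaklyDependent μ v ς a c A) : 0 ≤ A :=
  (integral_nonneg fun _ => by positivity).trans (h.moment 0)

theorem memLp_two_centered (h : WeaklyDependent μ v ς a c A) (hς : 2 < ς) (t : ℤ) :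
    MemLp (centered μ v t) 2 μ := by
  rw [memLp_two_iff_integrable_sq (h.measurable_centered t).aestronglyMeasurable]
  refine ((integrable_const 1).add (h.integrable_rpow t)).mono'
    ((h.measurable_centered t).pow_const 2).aestronglyMeasurable (ae_of_all _ fun ω => ?_)
  rw [Real.norm_eq_abs, abs_of_nonneg (sq_nonneg _), ← sq_abs]
  exact sq_le_one_add_rpow hς.le (abs_nonneg _)

theorem integral_centered_sq_le (h : WeaklyDependent μ v ς a c A) (hς : 2 < ς) (t : ℤ) :
    ∫ ω, centered μ v t ω ^ 2 ∂μ ≤ 1 + A := by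
  calc ∫ ω, centered μ v t ω ^ 2 ∂μ ≤ ∫ ω, (1 + |centered μ v t ω| ^ ς) ∂μ := by
        refine integral_mono (h.memLp_two_centered hς t).integrable_sq
          ((integrable_const 1).add (h.integrable_rpow t)) fun ω => ?_
        simp only
        rw [← sq_abs]
        exact sq_le_one_add_rpow hς.le (abs_nonneg _)
    _ ≤ 1 + A := by
        rw [integral_add (integrable_const _) (h.integrable_rpow t)]
        simpa using h.moment t

theorem integrable_centered_mul (h : WeaklyDependent μ v ς a c A) (hς : 2 < ς) (s t : ℤ) :
    Integrable (fun ω => centered μ v s ω * centered μ v t ω) μ :=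
  (h.memLp_two_centered hς s).integrable_mul (h.memLp_two_centered hς t)

/-- The covariance inequality: the factor in the past is truncated at the level
`k ^ (a / (ς - 1))`, which balances the `τ`-coefficient against the tail. -/
theorem abs_integral_centered_mul_le (h : WeaklyDependent μ v ς a c A) (hς : 2 < ς) (hc : 0 < c)
    (s : ℤ) {k : ℕ} (hk : 1 ≤ k) :
    |∫ ω, centered μ v s ω * centered μ v (s + k) ω ∂μ| ≤
      (c + 2 * A) * (k : ℝ) ^ (-(a * (ς - 2) / (ς - 1))) := by
  have hk0 : (0 : ℝ) < k := by exact_mod_cast hk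
  set N : ℝ := (k : ℝ) ^ (a / (ς - 1)) with hN
  have hN0 : 0 < N := by positivity
  set Z := centered μ v s with hZ
  set W := centered μ v (s + k) with hW
  set Y : Ω → ℝ := fun ω => max (-N) (min (Z ω) N) with hY
  have hYb : ∀ ω, |Y ω| ≤ N := fun ω =>
    abs_le.2 ⟨le_max_left _ _, max_le (by linarith) (min_le_right _ _)⟩
  have hZpast : Measurable[past v s] Z := (measurable_past v le_rfl).sub_const _
  have hYpast : Measurable[past v s] Y := measurable_const.max (hZpast.min measurable_const)
  have hYm : Measurable Y := hYpast.mono (past_le h.measurable s) le_rfl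
  have hYW : Integrable (fun ω => Y ω * W ω) μ :=
    (h.integrable_centered (s + k)).bdd_mul hYm.aestronglyMeasurable
      (ae_of_all _ fun ω => by rw [Real.norm_eq_abs]; exact hYb ω)
  have hW0 : ∫ ω, W ω ∂μ = 0 := h.integral_centered _
  have h1 : |∫ ω, Y ω * W ω ∂μ| ≤ N * (c * (k : ℝ) ^ (-a)) := by
    have hGz : ∀ ω, ∫ ω', Y ω * (v (s + k) ω' - ∫ ω'', v (s + k) ω'' ∂μ) ∂μ = 0 := by
      intro ω
      rw [integral_const_mul]
      have : ∫ ω', (v (s + k) ω' - ∫ ω'', v (s + k) ω'' ∂μ) ∂μ = 0 := hW0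
      rw [this, mul_zero]
    have := abs_integral_sub_decoupled_le μ (past_le h.measurable s)
      (ξ := fun ω (_ : Fin 1) => v (s + k) ω)
      (measurable_pi_lambda _ fun _ => h.measurable _)
      (fun ω z => Y ω * (z 0 - ∫ ω', v (s + k) ω' ∂μ)) (D := N) ?_ hN0 ?_ hYW ?_
      (τ := c * (k : ℝ) ^ (-a)) (by positivity) ?_
    · simp only [hGz, integral_zero, sub_zero] at this
      exact this
    · refine Measurable.mul (hYpast.comp (@measurable_fst _ _ (past v s) _)) ?_
      exact ((measurable_pi_apply (0 : Fin 1)).comp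
        (@measurable_snd _ _ (past v s) _)).sub_const _
    · intro ω z w
      rw [← mul_sub, sub_sub_sub_cancel_right, abs_mul]
      simp only [Finset.univ_unique, Fin.default_eq_zero, Finset.sum_singleton]
      exact mul_le_mul_of_nonneg_right (hYb ω) (abs_nonneg _)
    · simp only [hGz]
      exact integrable_zero _ _ _
    · have := h.tau_le le_rfl hk s (fun _ : Fin 1 => s + k) (Subsingleton.strictMono _)
        (fun _ => le_rfl)
      simpa using this
  -- Above the level `N` both factors are at most `U > N`, and `U ^ 2 ≤ N ^ (2 - ς) * U ^ ς`.
  have hdiff : ∀ ω, |Z ω * W ω - Y ω * W ω| ≤ N ^ (2 - ς) * (|Z ω| ^ ς + |W ω| ^ ς) := by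
    intro ω
    have hpos : 0 ≤ N ^ (2 - ς) * (|Z ω| ^ ς + |W ω| ^ ς) := by positivity
    rw [← sub_mul, abs_mul]
    rcases le_or_gt |Z ω| N with hz | hz
    · have : Y ω = Z ω := by
        have := abs_le.1 hz
        simp only [hY]
        rw [min_eq_left this.2, max_eq_right this.1]
      rw [this, sub_self, abs_zero, zero_mul]
      exact hpos
    · have hle : |Z ω - Y ω| ≤ |Z ω| := by
        simp only [hY]
        rcases lt_abs.1 hz with h2 | h2
        · rw [min_eq_right h2.le, max_eq_right (by linarith), abs_of_pos (by linarith),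
            abs_of_pos (by linarith)]
          linarith
        · rw [min_eq_left (by linarith), max_eq_left (by linarith), abs_of_neg (by linarith),
            abs_of_neg (by linarith)]
          linarith
      set U := max |Z ω| |W ω| with hU
      have hUN : N ≤ U := hz.le.trans (le_max_left _ _)
      have hU0 : 0 < U := hN0.trans_le hUN
      calc |Z ω - Y ω| * |W ω| ≤ U * U :=
            mul_le_mul (hle.trans (le_max_left _ _)) (le_max_right _ _) (abs_nonneg _) hU0.le
        _ = U ^ (2 - ς) * U ^ ς := by
            rw [← Real.rpow_add hU0, sub_add_cancel, Real.rpow_two, sq]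
        _ ≤ N ^ (2 - ς) * (|Z ω| ^ ς + |W ω| ^ ς) := by
            refine mul_le_mul (Real.rpow_le_rpow_of_nonpos hN0 hUN (by linarith)) ?_
              (by positivity) (by positivity)
            have e1 : 0 ≤ |Z ω| ^ ς := by positivity
            have e2 : 0 ≤ |W ω| ^ ς := by positivity
            rcases max_choice |Z ω| |W ω| with hm | hm <;> rw [hU, hm] <;> linarith
  have hZW := h.integrable_centered_mul hς s (s + k)
  have h2 : |∫ ω, (Z ω * W ω - Y ω * W ω) ∂μ| ≤ N ^ (2 - ς) * (2 * A) := by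
    refine abs_integral_le_integral_abs.trans ?_
    calc ∫ ω, |Z ω * W ω - Y ω * W ω| ∂μ
        ≤ ∫ ω, N ^ (2 - ς) * (|Z ω| ^ ς + |W ω| ^ ς) ∂μ :=
          integral_mono (hZW.sub hYW).abs
            (((h.integrable_rpow s).add (h.integrable_rpow (s + k))).const_mul _) hdiff
      _ = N ^ (2 - ς) * (∫ ω, |Z ω| ^ ς ∂μ + ∫ ω, |W ω| ^ ς ∂μ) := by
          rw [integral_const_mul]
          congr 1
          exact integral_add (h.integrable_rpow s) (h.integrable_rpow (s + k))
      _ ≤ N ^ (2 - ς) * (2 * A) := by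
          have e1 : ∫ ω, |Z ω| ^ ς ∂μ ≤ A := h.moment s
          have e2 : ∫ ω, |W ω| ^ ς ∂μ ≤ A := h.moment (s + k)
          gcongr
          linarith
  have hς1 : ς - 1 ≠ 0 := by linarith
  have p1 : N * (k : ℝ) ^ (-a) = (k : ℝ) ^ (-(a * (ς - 2) / (ς - 1))) := by
    rw [hN, ← Real.rpow_add hk0]
    congr 1
    field_simp
    ring
  have p2 : N ^ (2 - ς) = (k : ℝ) ^ (-(a * (ς - 2) / (ς - 1))) := by
    rw [hN, ← Real.rpow_mul hk0.le]
    congr 1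
    field_simp
    ring
  rw [integral_sub hZW hYW] at h2
  rw [p2] at h2
  have h1' : |∫ ω, Y ω * W ω ∂μ| ≤ c * (k : ℝ) ^ (-(a * (ς - 2) / (ς - 1))) := by
    rw [← p1]; linarith
  have := abs_add_le (∫ ω, Z ω * W ω ∂μ - ∫ ω, Y ω * W ω ∂μ) (∫ ω, Y ω * W ω ∂μ)
  rw [sub_add_cancel] at this
  linarith

end WeaklyDependent

/-- A bound on the covariance of two observations of a weakly dependent process which are `d`
apart. -/
noncomputable def covBound (ς a c A : ℝ) (d : ℕ) : ℝ :=
  if d = 0 then 1 + A else (c + 2 * A) * (d : ℝ) ^ (-(a * (ς - 2) / (ς - 1)))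

theorem summable_covBound {ς a c A : ℝ} (hς : 2 < ς) (ha : (ς - 1) / (ς - 2) < a) :
    Summable (covBound ς a c A) := by
  have hρ : 1 < a * (ς - 2) / (ς - 1) := by
    rw [div_lt_iff₀ (by linarith)] at ha
    rw [lt_div_iff₀ (by linarith)]
    linarith
  have h1 : Summable fun d : ℕ => (c + 2 * A) * (d : ℝ) ^ (-(a * (ς - 2) / (ς - 1))) :=
    (Real.summable_nat_rpow.2 (by linarith)).mul_left _
  refine (summable_nat_add_iff 1).1 ?_
  refine ((summable_nat_add_iff 1).2 h1).congr fun d => ?_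
  simp [covBound]

theorem covBound_nonneg {ς a c A : ℝ} (hc : 0 < c) (hA : 0 ≤ A) (d : ℕ) :
    0 ≤ covBound ς a c A d := by
  unfold covBound
  split_ifs <;> positivity

theorem sum_natAbs_sub_le_tsum {b : ℕ → ℝ} (hb : ∀ d, 0 ≤ b d) (hs : Summable b) (L k : ℕ) :
    ∑ l ∈ Finset.range L, b ((k : ℤ) - l).natAbs ≤ 2 * ∑' d, b d := by
  have hinj : ∀ (S : Finset ℕ) (f : ℕ → ℕ), Set.InjOn f S → ∑ l ∈ S, b (f l) ≤ ∑' d, b d := by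
    intro S f hf
    rw [← Finset.sum_image (f := b) hf]
    exact hs.sum_le_tsum _ fun d _ => hb d
  rw [← Finset.sum_filter_add_sum_filter_not (Finset.range L) (fun l => l ≤ k), two_mul]
  refine add_le_add (hinj _ _ ?_) (hinj _ _ ?_)
  · intro x hx y hy hxy
    simp only [Finset.coe_filter, Finset.mem_range, Set.mem_ofPred_eq] at hx hy
    simp only at hxy
    omega
  · intro x hx y hy hxy
    simp only [Finset.coe_filter, Finset.mem_range, Set.mem_ofPred_eq] at hx hy
    simp only at hxy
    omega

namespace WeaklyDependent

variable {Ω : Type u} [MeasurableSpace Ω] {μ : Measure Ω} [IsProbabilityMeasure μ]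
  {v : ℤ → Ω → ℝ} {ς a c A : ℝ}

theorem abs_integral_centered_mul_le_covBound (h : WeaklyDependent μ v ς a c A) (hς : 2 < ς)
    (hc : 0 < c) (s t : ℤ) :
    |∫ ω, centered μ v s ω * centered μ v t ω ∂μ| ≤ covBound ς a c A (s - t).natAbs := by
  have key : ∀ s t : ℤ, s < t → |∫ ω, centered μ v s ω * centered μ v t ω ∂μ| ≤
      covBound ς a c A (s - t).natAbs := by
    intro s t hst
    obtain ⟨k, rfl⟩ : ∃ k : ℕ, t = s + k := ⟨(t - s).toNat, by omega⟩
    have hk : 1 ≤ k := by omega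
    have hnat : (s - (s + (k : ℤ))).natAbs = k := by omega
    rw [hnat, covBound, if_neg (by omega)]
    exact h.abs_integral_centered_mul_le hς hc s hk
  rcases lt_trichotomy s t with hst | rfl | hst
  · exact key s t hst
  · simp only [sub_self, Int.natAbs_zero, covBound, if_true]
    have : ∀ ω, centered μ v s ω * centered μ v s ω = centered μ v s ω ^ 2 := fun ω => by ring
    simp only [this]
    rw [abs_of_nonneg (integral_nonneg fun ω => sq_nonneg _)]
    exact h.integral_centered_sq_le hς s
  · have := key t s hst
    rw [show (s - t).natAbs = (t - s).natAbs by omega]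
    simpa only [mul_comm] using this

theorem integral_blockSum_sq_le (h : WeaklyDependent μ v ς a c A) (hς : 2 < ς)
    (ha : (ς - 1) / (ς - 2) < a) (hc : 0 < c) (t₀ : ℤ) (L : ℕ) (w : ℕ → ℝ)
    (hw : ∀ k, |w k| ≤ 1) :
    ∫ ω, (∑ k ∈ Finset.range L, w k * centered μ v (t₀ + k) ω) ^ 2 ∂μ ≤
      L * (2 * ∑' d, covBound ς a c A d) := by
  have hexp : ∀ ω, (∑ k ∈ Finset.range L, w k * centered μ v (t₀ + k) ω) ^ 2 =
      ∑ k ∈ Finset.range L, ∑ l ∈ Finset.range L,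
        (w k * w l) * (centered μ v (t₀ + k) ω * centered μ v (t₀ + l) ω) := by
    intro ω
    rw [sq, Finset.sum_mul_sum]
    refine Finset.sum_congr rfl fun k _ => Finset.sum_congr rfl fun l _ => by ring
  simp only [hexp]
  rw [integral_finsetSum _ fun k _ => integrable_finsetSum _ fun l _ =>
    (h.integrable_centered_mul hς _ _).const_mul _]
  have hinner : ∀ k ∈ Finset.range L, ∫ ω, ∑ l ∈ Finset.range L,
      (w k * w l) * (centered μ v (t₀ + k) ω * centered μ v (t₀ + l) ω) ∂μ ≤
        2 * ∑' d, covBound ς a c A d := by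
    intro k _
    rw [integral_finsetSum _ fun l _ => (h.integrable_centered_mul hς _ _).const_mul _]
    refine le_trans (Finset.sum_le_sum fun l _ => ?_)
      (sum_natAbs_sub_le_tsum (covBound_nonneg hc h.moment_nonneg)
        (summable_covBound hς ha) L k)
    rw [integral_const_mul]
    refine (le_abs_self _).trans ?_
    rw [abs_mul, abs_mul]
    have h1 : |w k| * |w l| ≤ 1 := mul_le_one₀ (hw k) (abs_nonneg _) (hw l)
    have h2 := h.abs_integral_centered_mul_le_covBound hς hc (t₀ + k) (t₀ + l)
    rw [show (t₀ + (k : ℤ) - (t₀ + (l : ℤ))).natAbs = ((k : ℤ) - l).natAbs by congr 1; ring] at h2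
    calc |w k| * |w l| * |∫ ω, centered μ v (t₀ + k) ω * centered μ v (t₀ + l) ω ∂μ|
        ≤ 1 * |∫ ω, centered μ v (t₀ + k) ω * centered μ v (t₀ + l) ω ∂μ| := by gcongr
      _ ≤ _ := by rw [one_mul]; exact h2
  calc _ ≤ ∑ _k ∈ Finset.range L, (2 * ∑' d, covBound ς a c A d) := Finset.sum_le_sum hinner
    _ = _ := by simp

theorem abs_blockSum_rpow_le (hς : 1 ≤ ς) (L : ℕ) (w z : ℕ → ℝ) (hw : ∀ k, |w k| ≤ 1) :
    |∑ k ∈ Finset.range L, w k * z k| ^ ς ≤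
      (L : ℝ) ^ (ς - 1) * ∑ k ∈ Finset.range L, |z k| ^ ς := by
  have h1 : |∑ k ∈ Finset.range L, w k * z k| ≤ ∑ k ∈ Finset.range L, |z k| := by
    refine (Finset.abs_sum_le_sum_abs _ _).trans (Finset.sum_le_sum fun k _ => ?_)
    rw [abs_mul]
    exact mul_le_of_le_one_left (abs_nonneg _) (hw k)
  have h2 := Real.rpow_sum_le_const_mul_sum_rpow (Finset.range L) z hς
  rw [Finset.card_range] at h2
  exact (Real.rpow_le_rpow (abs_nonneg _) h1 (by linarith)).trans h2

theorem measurable_blockSum (h : WeaklyDependent μ v ς a c A) (t₀ : ℤ) (L : ℕ) (w : ℕ → ℝ) :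
    Measurable (fun ω => ∑ k ∈ Finset.range L, w k * centered μ v (t₀ + k) ω) :=
  Finset.measurable_sum _ fun _ _ => (h.measurable_centered _).const_mul _

theorem integrable_blockSum_rpow (h : WeaklyDependent μ v ς a c A) (hς : 1 ≤ ς) (t₀ : ℤ) (L : ℕ)
    (w : ℕ → ℝ) (hw : ∀ k, |w k| ≤ 1) :
    Integrable (fun ω => |∑ k ∈ Finset.range L, w k * centered μ v (t₀ + k) ω| ^ ς) μ := by
  have hI : Integrable (fun ω => (L : ℝ) ^ (ς - 1) *
      ∑ k ∈ Finset.range L, |centered μ v (t₀ + k) ω| ^ ς) μ :=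
    (integrable_finsetSum _ fun (k : ℕ) _ => h.integrable_rpow (t₀ + (k : ℤ))).const_mul _
  have hm := h.measurable_blockSum t₀ L w
  refine hI.mono' (hm.abs.pow_const ς).aestronglyMeasurable (ae_of_all _ fun ω => ?_)
  rw [Real.norm_eq_abs, abs_of_nonneg (by positivity)]
  exact abs_blockSum_rpow_le hς L w _ hw

theorem integral_blockSum_rpow_le (h : WeaklyDependent μ v ς a c A) (hς : 1 ≤ ς) (t₀ : ℤ)
    {L : ℕ} (hL : 0 < L) (w : ℕ → ℝ) (hw : ∀ k, |w k| ≤ 1) :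
    ∫ ω, |∑ k ∈ Finset.range L, w k * centered μ v (t₀ + k) ω| ^ ς ∂μ ≤ (L : ℝ) ^ ς * A := by
  have hL0 : (0 : ℝ) < L := by exact_mod_cast hL
  have hI : Integrable (fun ω => (L : ℝ) ^ (ς - 1) *
      ∑ k ∈ Finset.range L, |centered μ v (t₀ + k) ω| ^ ς) μ :=
    (integrable_finsetSum _ fun (k : ℕ) _ => h.integrable_rpow (t₀ + (k : ℤ))).const_mul _
  calc _ ≤ ∫ ω, (L : ℝ) ^ (ς - 1) * ∑ k ∈ Finset.range L, |centered μ v (t₀ + k) ω| ^ ς ∂μ :=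
        integral_mono (h.integrable_blockSum_rpow hς t₀ L w hw) hI
          fun ω => abs_blockSum_rpow_le hς L w _ hw
    _ = (L : ℝ) ^ (ς - 1) * ∑ k ∈ Finset.range L, ∫ ω, |centered μ v (t₀ + k) ω| ^ ς ∂μ := by
        rw [integral_const_mul,
          integral_finsetSum _ fun (k : ℕ) _ => h.integrable_rpow (t₀ + (k : ℤ))]
    _ ≤ (L : ℝ) ^ (ς - 1) * ∑ _k ∈ Finset.range L, A := by
        gcongr with k _
        exact h.moment (t₀ + k)
    _ = (L : ℝ) ^ ς * A := by
        rw [Finset.sum_const, Finset.card_range, nsmul_eq_mul, ← mul_assoc,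
          ← Real.rpow_add_one hL0.ne', sub_add_cancel]

end WeaklyDependent

/-! ### The Fuk–Nagaev inequality for `τ`-mixing processes -/

namespace WeaklyDependent

variable {Ω : Type u} [MeasurableSpace Ω] {μ : Measure Ω} [IsProbabilityMeasure μ]
  {v : ℤ → Ω → ℝ} {ς a c A : ℝ}

/-- The sum over every other block of length `L`: consecutive blocks are `L` apart. -/
theorem measureReal_alternateBlocks_ge_le (h : WeaklyDependent μ v ς a c A) (hς : 2 < ς)
    (ha : (ς - 1) / (ς - 2) < a) (hc : 0 < c) (hA : 0 < A) (t₀ : ℤ) {L n : ℕ} (hL : 0 < L)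
    (hn : 0 < n) (W : ℤ → ℝ) (hW : ∀ t, |W t| ≤ 1) {x : ℝ} (hx : 0 < x) :
    μ.real {ω | 2 * x ≤ ∑ i ∈ Finset.range n, ∑ k ∈ Finset.range L,
        W (t₀ + 2 * i * L + k) * centered μ v (t₀ + 2 * i * L + k) ω} ≤
      (1 + Real.exp 1) * (n * ((L : ℝ) ^ ς * A) / (x / 2) ^ ς) +
        Real.exp 1 * Real.exp (-(x ^ 2 / (4 * Real.exp ς *
          (n * (L * (2 * ∑' d, covBound ς a c A d)))))) +
        n * (L * (c * (L : ℝ) ^ (-a))) / x := by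
  have hL0 : (0 : ℝ) < L := by exact_mod_cast hL
  have hcov : 0 < ∑' d, covBound ς a c A d :=
    (summable_covBound hς ha).tsum_pos (covBound_nonneg hc hA.le) 0
      (by simp only [covBound, if_true]; linarith)
  set ξ : ℕ → Ω → Fin L → ℝ := fun i ω k => v (t₀ + 2 * i * L + (k : ℕ)) ω with hξ
  set H : ℕ → (Fin L → ℝ) → ℝ := fun i z => ∑ k : Fin L, W (t₀ + 2 * i * L + (k : ℕ)) *
    (z k - ∫ ω, v (t₀ + 2 * i * L + (k : ℕ)) ω ∂μ) with hH
  have hHξ : ∀ i ω, H i (ξ i ω) = ∑ k ∈ Finset.range L,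
      W (t₀ + 2 * i * L + k) * centered μ v (t₀ + 2 * i * L + k) ω := by
    intro i ω
    exact Fin.sum_univ_eq_sum_range (fun k : ℕ => W (t₀ + 2 * i * L + k) *
      centered μ v (t₀ + 2 * i * L + k) ω) L
  have hw : ∀ i : ℕ, ∀ k : ℕ, |W (t₀ + 2 * i * L + k)| ≤ 1 := fun i k => hW _
  have hfun : ∀ i, (fun ω => H i (ξ i ω)) = fun ω => ∑ k ∈ Finset.range L,
      W (t₀ + 2 * i * L + k) * centered μ v (t₀ + 2 * i * L + k) ω := fun i => funext (hHξ i)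
  have hsq := fun i : ℕ => h.integral_blockSum_sq_le hς ha hc (t₀ + 2 * i * L) L
    (fun k => W (t₀ + 2 * i * L + k)) (hw i)
  have hrp := fun i : ℕ => h.integral_blockSum_rpow_le (by linarith) (t₀ + 2 * i * L) hL
    (fun k => W (t₀ + 2 * i * L + k)) (hw i)
  have hIrp := fun i : ℕ => h.integrable_blockSum_rpow (by linarith) (t₀ + 2 * i * L) L
    (fun k => W (t₀ + 2 * i * L + k)) (hw i)
  have hMem : ∀ i : ℕ, MemLp (fun ω => ∑ k ∈ Finset.range L,
      W (t₀ + 2 * i * L + k) * centered μ v (t₀ + 2 * i * L + k) ω) 2 μ := fun i =>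
    memLp_finsetSum _ fun k _ => (h.memLp_two_centered hς _).const_mul _
  have key := measureReal_sum_ge_le μ (fun i => past v (t₀ + 2 * i * L - L))
    (fun i => past_le h.measurable _) ξ (fun i => measurable_pi_lambda _ fun k => h.measurable _)
    H ?_ ?_ ?_ (τ := L * (c * (L : ℝ) ^ (-a))) (by positivity) ?_ (ς := ς)
    (A := (L : ℝ) ^ ς * A) (v := L * (2 * ∑' d, covBound ς a c A d)) (by linarith)
    (by positivity) (by positivity) ?_ ?_ ?_ ?_ ?_ ?_ hn hx
  · simp only [hHξ] at key
    exact key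
  · intro i z w
    rw [hH]
    simp only
    rw [← Finset.sum_sub_distrib]
    refine (Finset.abs_sum_le_sum_abs _ _).trans (Finset.sum_le_sum fun k _ => ?_)
    rw [← mul_sub, sub_sub_sub_cancel_right, abs_mul]
    exact mul_le_of_le_one_left (abs_nonneg _) (hW _)
  · intro i
    fun_prop
  · intro m
    simp only [hHξ]
    refine Finset.measurable_sum _ fun i hi => Finset.measurable_sum _ fun k hk =>
      ((measurable_past v ?_).sub_const _).const_mul _
    rw [Finset.mem_range] at hi hk
    have h1 : (i : ℤ) + 1 ≤ m := by exact_mod_cast hi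
    have h2 : (k : ℤ) + 1 ≤ L := by exact_mod_cast hk
    nlinarith
  · intro i
    refine h.tau_le hL hL _ (fun k : Fin L => t₀ + 2 * i * L + ((k : ℕ) : ℤ)) ?_ ?_
    · intro k k' hkk
      simp only [add_lt_add_iff_left, Nat.cast_lt]
      exact hkk
    · intro k
      simp only [sub_add_cancel]
      omega
  · intro i
    rw [hfun]
    exact (hMem i).integrable one_le_two
  · intro i
    rw [hfun, integral_finsetSum _ fun k _ => (h.integrable_centered _).const_mul _]
    refine Finset.sum_eq_zero fun k _ => ?_
    rw [integral_const_mul, h.integral_centered, mul_zero]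
  · intro i
    simp only [hHξ]
    exact (hMem i).integrable_sq
  · intro i
    simp only [hHξ]
    exact hsq i
  · intro i
    simp only [hHξ]
    exact hIrp i
  · intro i
    simp only [hHξ]
    exact hrp i

theorem measureReal_alternateBlocks_abs_ge_le (h : WeaklyDependent μ v ς a c A) (hς : 2 < ς)
    (ha : (ς - 1) / (ς - 2) < a) (hc : 0 < c) (hA : 0 < A) (t₀ : ℤ) {L n : ℕ} (hL : 0 < L)
    (hn : 0 < n) (W : ℤ → ℝ) (hW : ∀ t, |W t| ≤ 1) {x : ℝ} (hx : 0 < x) :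
    μ.real {ω | 2 * x ≤ |∑ i ∈ Finset.range n, ∑ k ∈ Finset.range L,
        W (t₀ + 2 * i * L + k) * centered μ v (t₀ + 2 * i * L + k) ω|} ≤
      2 * ((1 + Real.exp 1) * (n * ((L : ℝ) ^ ς * A) / (x / 2) ^ ς) +
        Real.exp 1 * Real.exp (-(x ^ 2 / (4 * Real.exp ς *
          (n * (L * (2 * ∑' d, covBound ς a c A d)))))) +
        n * (L * (c * (L : ℝ) ^ (-a))) / x) := by
  have h1 := h.measureReal_alternateBlocks_ge_le hς ha hc hA t₀ hL hn W hW hx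
  have h2 := h.measureReal_alternateBlocks_ge_le hς ha hc hA t₀ hL hn (fun t => -W t)
    (fun t => by rw [abs_neg]; exact hW t) hx
  simp only [neg_mul, Finset.sum_neg_distrib] at h2
  refine le_trans ?_ ((add_le_add h1 h2).trans_eq (two_mul _).symm)
  refine le_trans (measureReal_mono ?_) (measureReal_union_le _ _)
  intro ω hω
  simp only [Set.mem_ofPred_eq, le_abs] at hω
  exact hω

end WeaklyDependent

theorem sum_range_two_mul_mul (f : ℕ → ℝ) (n L : ℕ) :
    ∑ t ∈ Finset.range (n * (2 * L)), f t =
      ∑ i ∈ Finset.range n, ∑ k ∈ Finset.range L, f (2 * i * L + k) +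
        ∑ i ∈ Finset.range n, ∑ k ∈ Finset.range L, f (L + 2 * i * L + k) := by
  induction n with
  | zero => simp
  | succ n ih =>
    have e1 : (n + 1) * (2 * L) = n * (2 * L) + (L + L) := by ring
    rw [e1, Finset.sum_range_add, ih, Finset.sum_range_add, Finset.sum_range_succ,
      Finset.sum_range_succ]
    have e2 : ∀ k, n * (2 * L) + k = 2 * n * L + k := fun k => by ring
    simp only [e2]
    have e4 : ∀ k, 2 * n * L + (L + k) = L + 2 * n * L + k := fun k => by ring
    simp only [e4]
    ring

/-- For blocks of length `x ^ e` with `e = (ς - 1) / (a + ς - 1)`, the moment term and the mixing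
term are of the same order in `x`. -/
theorem rpow_exponent_balance {ς a x : ℝ} (hς : 2 < ς) (ha : 0 < a) (hx : 0 < x) :
    x ^ ((ς - 1) / (a + ς - 1) * (ς - 1)) / x ^ ς = x ^ (-(((a + 1) * ς - 1) / (a + ς - 1))) ∧
      x ^ ((ς - 1) / (a + ς - 1) * (-a)) / x = x ^ (-(((a + 1) * ς - 1) / (a + ς - 1))) := by
  have hd : a + ς - 1 ≠ 0 := by linarith
  constructor
  · rw [← Real.rpow_sub hx]
    congr 1
    field_simp
    ring
  · rw [← Real.rpow_sub_one hx.ne']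
    congr 1
    field_simp
    ring

/-- The Fuk–Nagaev inequality for `τ`-mixing processes, with constants that depend only on the
exponents and on the bounds for the moments and the mixing coefficients. -/
theorem exists_fukNagaev {ς a c A : ℝ} (hς : 2 < ς) (ha : (ς - 1) / (ς - 2) < a) (hc : 0 < c)
    (hA : 0 < A) :
    ∃ C₁ C₂ : ℝ, 0 < C₁ ∧ 0 < C₂ ∧ ∀ {Ω : Type u} [MeasurableSpace Ω] (μ : Measure Ω)
      [IsProbabilityMeasure μ] (v : ℤ → Ω → ℝ), WeaklyDependent μ v ς a c A →
      ∀ (T : ℕ) (x : ℝ), 1 ≤ x → x ≤ T →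
        μ.real {ω | 4 * x ≤ |∑ t ∈ Finset.range T, centered μ v ((t : ℤ) + 1) ω|} ≤
          C₁ * (T * x ^ (-(((a + 1) * ς - 1) / (a + ς - 1))) +
            Real.exp (-(C₂ * (x ^ 2 / T)))) := by
  have ha0 : 0 < a := lt_trans (div_pos (by linarith) (by linarith)) ha
  -- `2 * V` bounds the variance of a block divided by its length.
  set V := ∑' d, covBound ς a c A d with hV
  have hV0 : 0 < V :=
    (summable_covBound hς ha).tsum_pos (covBound_nonneg hc hA.le) 0
      (by simp only [covBound, if_true]; linarith)
  set e₀ := (ς - 1) / (a + ς - 1) with he₀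
  have he0 : 0 < e₀ := div_pos (by linarith) (by linarith)
  have he1 : e₀ ≤ 1 := by rw [he₀, div_le_one (by linarith)]; linarith
  set κ := ((a + 1) * ς - 1) / (a + ς - 1) with hκ
  set e := Real.exp 1 with he
  have hepos : 0 < e := Real.exp_pos 1
  refine ⟨4 * ((1 + e) * (2 * 2 ^ (ς - 1) * A * 2 ^ ς) + 2 * c + e),
    1 / (16 * Real.exp ς * V), by positivity, by positivity, ?_⟩
  intro Ω _ μ _ v h T x hx1 hxT
  have hx0 : 0 < x := by linarith
  have hT0 : (0 : ℝ) < T := by linarith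
  set L := ⌈x ^ e₀⌉₊ with hLdef
  have hxe : 1 ≤ x ^ e₀ := Real.one_le_rpow hx1 he0.le
  have hLge : x ^ e₀ ≤ L := Nat.le_ceil _
  have hLle : (L : ℝ) ≤ 2 * x ^ e₀ := by
    have := Nat.ceil_lt_add_one (a := x ^ e₀) (by positivity)
    linarith
  have hL0' : (0 : ℝ) < L := by linarith
  have hL0 : 0 < L := by exact_mod_cast hL0'
  have hLT : L ≤ T := by
    refine Nat.ceil_le.2 (le_trans ?_ hxT)
    calc x ^ e₀ ≤ x ^ (1 : ℝ) := Real.rpow_le_rpow_of_exponent_le hx1 he1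
      _ = x := Real.rpow_one x
  set n := T / (2 * L) + 1 with hn
  have hn0 : 0 < n := Nat.succ_pos _
  have hTn : T ≤ n * (2 * L) := by
    have := Nat.lt_div_mul_add (a := T) (b := 2 * L) (by omega)
    rw [hn, add_mul, one_mul]
    omega
  have hnL : (n : ℝ) * L ≤ 2 * T := by
    have h1 : n * L ≤ 2 * T := by
      have := Nat.div_mul_le_self T (2 * L)
      rw [hn, add_mul, one_mul]
      nlinarith
    exact_mod_cast h1
  -- The weights cut the last blocks off at time `T`, so that all blocks have the same length.
  set W : ℤ → ℝ := fun t => if t ≤ (T : ℤ) then 1 else 0 with hW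
  have hW1 : ∀ t, |W t| ≤ 1 := by
    intro t
    simp only [hW]
    split_ifs <;> simp
  set f : Ω → ℕ → ℝ := fun ω t => W ((t : ℤ) + 1) * centered μ v ((t : ℤ) + 1) ω with hf
  have hsum : ∀ ω, ∑ t ∈ Finset.range T, centered μ v ((t : ℤ) + 1) ω =
      ∑ i ∈ Finset.range n, ∑ k ∈ Finset.range L,
        W (1 + 2 * i * L + k) * centered μ v (1 + 2 * i * L + k) ω +
      ∑ i ∈ Finset.range n, ∑ k ∈ Finset.range L,
        W (1 + L + 2 * i * L + k) * centered μ v (1 + L + 2 * i * L + k) ω := by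
    intro ω
    have e1 : ∑ t ∈ Finset.range T, centered μ v ((t : ℤ) + 1) ω =
        ∑ t ∈ Finset.range (n * (2 * L)), f ω t := by
      rw [← Finset.sum_subset (Finset.range_mono hTn) (f := f ω)]
      · refine Finset.sum_congr rfl fun t ht => ?_
        rw [Finset.mem_range] at ht
        simp only [hf, hW]
        rw [if_pos (by omega), one_mul]
      · intro t _ ht
        rw [Finset.mem_range] at ht
        simp only [hf, hW]
        rw [if_neg (by omega), zero_mul]
    rw [e1, sum_range_two_mul_mul]
    simp only [hf]
    congr 1
    · refine Finset.sum_congr rfl fun i _ => Finset.sum_congr rfl fun k _ => ?_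
      have : ((2 * i * L + k : ℕ) : ℤ) + 1 = 1 + 2 * i * L + k := by push_cast; ring
      rw [this]
    · refine Finset.sum_congr rfl fun i _ => Finset.sum_congr rfl fun k _ => ?_
      have : ((L + 2 * i * L + k : ℕ) : ℤ) + 1 = 1 + L + 2 * i * L + k := by push_cast; ring
      rw [this]
  have h1 := h.measureReal_alternateBlocks_abs_ge_le hς ha hc hA 1 hL0 hn0 W hW1 hx0
  have h2 := h.measureReal_alternateBlocks_abs_ge_le hς ha hc hA (1 + L) hL0 hn0 W hW1 hx0
  have hU : μ.real {ω | 4 * x ≤ |∑ t ∈ Finset.range T, centered μ v ((t : ℤ) + 1) ω|} ≤ _ :=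
    le_trans (le_trans (measureReal_mono (by
      intro ω hω
      simp only [Set.mem_ofPred_eq, hsum] at hω
      have := abs_add_le (∑ i ∈ Finset.range n, ∑ k ∈ Finset.range L,
        W (1 + 2 * i * L + k) * centered μ v (1 + 2 * i * L + k) ω)
        (∑ i ∈ Finset.range n, ∑ k ∈ Finset.range L,
        W (1 + L + 2 * i * L + k) * centered μ v (1 + L + 2 * i * L + k) ω)
      simp only [Set.mem_union, Set.mem_ofPred_eq]
      by_contra! hcon
      linarith [hcon.1, hcon.2])) (measureReal_union_le _ _)) (add_le_add h1 h2)
  refine hU.trans ?_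
  obtain ⟨hb1, hb2⟩ := rpow_exponent_balance hς ha0 hx0
  have t1 : (n : ℝ) * ((L : ℝ) ^ ς * A) / (x / 2) ^ ς ≤
      (2 * 2 ^ (ς - 1) * A * 2 ^ ς) * (T * x ^ (-κ)) := by
    have hLς : (L : ℝ) ^ ς = (L : ℝ) ^ (ς - 1) * L := by
      rw [← Real.rpow_add_one hL0'.ne', sub_add_cancel]
    have hLς' : (L : ℝ) ^ (ς - 1) ≤ 2 ^ (ς - 1) * x ^ (e₀ * (ς - 1)) := by
      rw [Real.rpow_mul hx0.le, ← Real.mul_rpow (by norm_num) (by positivity)]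
      exact Real.rpow_le_rpow hL0'.le hLle (by linarith)
    have hx2 : (x / 2) ^ ς = x ^ ς / 2 ^ ς := Real.div_rpow hx0.le (by norm_num) _
    rw [← hb1, hx2, hLς]
    calc (n : ℝ) * ((L : ℝ) ^ (ς - 1) * L * A) / (x ^ ς / 2 ^ ς)
        = (n * L) * (L : ℝ) ^ (ς - 1) * (A * 2 ^ ς / x ^ ς) := by field_simp
      _ ≤ (2 * T) * (2 ^ (ς - 1) * x ^ (e₀ * (ς - 1))) * (A * 2 ^ ς / x ^ ς) := by gcongr
      _ = _ := by ring
  have t2 : (n : ℝ) * (L * (c * (L : ℝ) ^ (-a))) / x ≤ 2 * c * (T * x ^ (-κ)) := by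
    have hLa : (L : ℝ) ^ (-a) ≤ x ^ (e₀ * (-a)) := by
      rw [Real.rpow_mul hx0.le]
      exact Real.rpow_le_rpow_of_nonpos (by positivity) hLge (by linarith)
    rw [← hb2]
    calc (n : ℝ) * (L * (c * (L : ℝ) ^ (-a))) / x = (n * L) * c * (L : ℝ) ^ (-a) / x := by ring
      _ ≤ (2 * T) * c * x ^ (e₀ * (-a)) / x := by gcongr
      _ = _ := by ring
  have t3 : Real.exp (-(x ^ 2 / (4 * Real.exp ς * (n * (L * (2 * V)))))) ≤
      Real.exp (-(1 / (16 * Real.exp ς * V) * (x ^ 2 / T))) := by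
    refine Real.exp_le_exp.2 (neg_le_neg ?_)
    have : 1 / (16 * Real.exp ς * V) * (x ^ 2 / T) =
        x ^ 2 / (4 * Real.exp ς * (2 * V * (2 * T))) := by
      field_simp
      ring
    rw [this]
    refine div_le_div_of_nonneg_left (by positivity) (by positivity) ?_
    have : (n : ℝ) * (L * (2 * V)) = 2 * V * (n * L) := by ring
    rw [this]
    gcongr
  have hP : 0 ≤ T * x ^ (-κ) := by positivity
  have hE : 0 < Real.exp (-(1 / (16 * Real.exp ς * V) * (x ^ 2 / T))) := Real.exp_pos _
  set P := T * x ^ (-κ)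
  set E := Real.exp (-(1 / (16 * Real.exp ς * V) * (x ^ 2 / T)))
  have u1 := mul_le_mul_of_nonneg_left t1 (by linarith : 0 ≤ 1 + e)
  have u3 := mul_le_mul_of_nonneg_left t3 hepos.le
  have hB0 : 0 ≤ (1 + e) * (2 * 2 ^ (ς - 1) * A * 2 ^ ς) := by positivity
  set B := 2 * 2 ^ (ς - 1) * A * 2 ^ ς
  have w1 : 0 ≤ (1 + e) * B * E := by positivity
  have w2 : 0 ≤ 2 * c * E := by positivity
  have w3 : 0 ≤ e * P := by positivity
  nlinarith

/-! ### The penalty and the effective sparsity -/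

theorem sum_parts_eq {p : ℕ} (P : Groups p) (f : Fin p → ℝ) :
    ∑ G ∈ P.parts, ∑ j ∈ G, f j = ∑ j, f j := by
  have := Finset.sum_biUnion (f := f) P.disjoint
  rw [P.biUnion_parts] at this
  exact this.symm

theorem penalty_nonneg {p : ℕ} {α : ℝ} (h0 : 0 ≤ α) (h1 : α ≤ 1) (P : Groups p) (b : Fin p → ℝ) :
    0 ≤ penalty α P b := by
  have : 0 ≤ 1 - α := by linarith
  unfold penalty
  positivity

theorem penalty_le_sum_abs {p : ℕ} {α : ℝ} (h1 : α ≤ 1) (P : Groups p)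
    (b : Fin p → ℝ) : penalty α P b ≤ ∑ j, |b j| := by
  have h2 : ∑ G ∈ P.parts, √(∑ j ∈ G, b j ^ 2) ≤ ∑ j, |b j| := by
    rw [← sum_parts_eq P fun j => |b j|]
    refine Finset.sum_le_sum fun G _ => ?_
    refine Real.sqrt_le_iff.2 ⟨Finset.sum_nonneg fun j _ => abs_nonneg _, ?_⟩
    calc ∑ j ∈ G, b j ^ 2 = ∑ j ∈ G, |b j| ^ 2 := by simp
      _ ≤ (∑ j ∈ G, |b j|) ^ 2 := Finset.sum_sq_le_sq_sum_of_nonneg fun j _ => abs_nonneg _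
  have h3 := mul_le_mul_of_nonneg_left h2 (by linarith : 0 ≤ 1 - α)
  unfold penalty
  linarith

theorem sum_abs_le_sqrt_card_mul {ι : Type*} (S : Finset ι) (b : ι → ℝ) :
    ∑ j ∈ S, |b j| ≤ √(S.card : ℝ) * √(∑ j ∈ S, b j ^ 2) := by
  rw [← Real.sqrt_mul (by positivity)]
  refine Real.le_sqrt_of_sq_le ?_
  have := sq_sum_le_card_mul_sum_sq (s := S) (f := fun j => |b j|)
  simpa using this

theorem sum_abs_le_sqrt_mul_penalty {p : ℕ} {α : ℝ} (h0 : 0 ≤ α) (h1 : α ≤ 1) (P : Groups p)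
    {g : ℝ} (hg1 : 1 ≤ g) (hg : ∀ G ∈ P.parts, (G.card : ℝ) ≤ g) (b : Fin p → ℝ) :
    ∑ j, |b j| ≤ √g * penalty α P b := by
  have hsg : 1 ≤ √g := Real.one_le_sqrt.2 hg1
  have h2 : ∑ j, |b j| ≤ √g * ∑ G ∈ P.parts, √(∑ j ∈ G, b j ^ 2) := by
    rw [← sum_parts_eq P fun j => |b j|, Finset.mul_sum]
    refine Finset.sum_le_sum fun G hG => (sum_abs_le_sqrt_card_mul G b).trans ?_
    gcongr
    exact hg G hG
  have h3 : 0 ≤ ∑ j, |b j| := Finset.sum_nonneg fun j _ => abs_nonneg _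
  have h4 : ∑ j, |b j| ≤ √g * ∑ j, |b j| := le_mul_of_one_le_left h3 hsg
  have e1 := mul_le_mul_of_nonneg_left h2 (by linarith : 0 ≤ 1 - α)
  have e2 := mul_le_mul_of_nonneg_left h4 h0
  unfold penalty
  linarith

theorem sum_abs_le_sqrt_supp_mul {p : ℕ} (b : Fin p → ℝ) :
    ∑ j, |b j| ≤ √((supp b).card : ℝ) * √(∑ j, b j ^ 2) := by
  have h1 : ∑ j, |b j| = ∑ j ∈ supp b, |b j| := by
    refine (Finset.sum_subset (Finset.subset_univ _) fun j _ hj => ?_).symm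
    simp only [supp, Finset.mem_filter, Finset.mem_univ, true_and, not_not] at hj
    rw [hj, abs_zero]
  rw [h1]
  refine (sum_abs_le_sqrt_card_mul _ b).trans ?_
  gcongr
  exact Finset.subset_univ _

theorem card_supp_le {p : ℕ} (P : Groups p) {g : ℝ} (hg : ∀ G ∈ P.parts, (G.card : ℝ) ≤ g)
    (b : Fin p → ℝ) : ((supp b).card : ℝ) ≤ g * (groupSupp P b).card := by
  classical
  have hsub : supp b ⊆ (groupSupp P b).biUnion id := by
    intro j hj
    simp only [supp, Finset.mem_filter, Finset.mem_univ, true_and] at hj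
    obtain ⟨G, hG, hjG⟩ := P.exists_mem (Finset.mem_univ j)
    simp only [Finset.mem_biUnion, groupSupp, Finset.mem_filter, id]
    exact ⟨G, ⟨hG, j, hjG, hj⟩, hjG⟩
  calc ((supp b).card : ℝ) ≤ ((groupSupp P b).biUnion id).card := by
        exact_mod_cast Finset.card_le_card hsub
    _ ≤ ∑ G ∈ groupSupp P b, (G.card : ℝ) := by exact_mod_cast Finset.card_biUnion_le
    _ ≤ ∑ _G ∈ groupSupp P b, g := Finset.sum_le_sum fun G hG => by
        simp only [groupSupp, Finset.mem_filter] at hG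
        exact hg G hG.1
    _ = g * (groupSupp P b).card := by simp [mul_comm]

/-- Groups of bounded size make the effective sparsity comparable to the number of nonzero
coefficients. -/
theorem card_supp_le_mul_effSparsity {p : ℕ} {α : ℝ} (h0 : 0 ≤ α) (h1 : α ≤ 1) (P : Groups p)
    {g : ℝ} (hg1 : 1 ≤ g) (hg : ∀ G ∈ P.parts, (G.card : ℝ) ≤ g) (b : Fin p → ℝ) :
    ((supp b).card : ℝ) ≤ g * effSparsity α P b := by
  have hS := card_supp_le P hg b
  have h2 : √((supp b).card : ℝ) ≤ √g * √((groupSupp P b).card : ℝ) := by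
    rw [← Real.sqrt_mul (by linarith)]
    exact Real.sqrt_le_sqrt hS
  have hsg : 1 ≤ √g := Real.one_le_sqrt.2 hg1
  have h3 : √((supp b).card : ℝ) ≤ √g * √((supp b).card : ℝ) :=
    le_mul_of_one_le_left (Real.sqrt_nonneg _) hsg
  have h4 : √((supp b).card : ℝ) ≤
      √g * (α * √((supp b).card : ℝ) + (1 - α) * √((groupSupp P b).card : ℝ)) := by
    have e1 := mul_le_mul_of_nonneg_left h2 (by linarith : 0 ≤ 1 - α)
    have e2 := mul_le_mul_of_nonneg_left h3 h0
    linarith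
  calc ((supp b).card : ℝ) = √((supp b).card : ℝ) ^ 2 := (Real.sq_sqrt (by positivity)).symm
    _ ≤ (√g * (α * √((supp b).card : ℝ) + (1 - α) * √((groupSupp P b).card : ℝ))) ^ 2 := by
        gcongr
    _ = _ := by rw [mul_pow, Real.sq_sqrt (by linarith), effSparsity]

theorem one_le_effSparsity {p : ℕ} {α : ℝ} (h0 : 0 ≤ α) (h1 : α ≤ 1) (P : Groups p)
    {b : Fin p → ℝ} (hb : b ≠ 0) : 1 ≤ effSparsity α P b := by
  classical
  obtain ⟨j, hj⟩ := Function.ne_iff.1 hb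
  have hS : 1 ≤ √((supp b).card : ℝ) := by
    rw [Real.one_le_sqrt]
    have : 0 < (supp b).card := Finset.card_pos.2 ⟨j, by simpa [supp] using hj⟩
    exact_mod_cast this
  have hG : 1 ≤ √((groupSupp P b).card : ℝ) := by
    rw [Real.one_le_sqrt]
    obtain ⟨G, hG, hjG⟩ := P.exists_mem (Finset.mem_univ j)
    have : 0 < (groupSupp P b).card := Finset.card_pos.2
      ⟨G, by simp only [groupSupp, Finset.mem_filter]; exact ⟨hG, j, hjG, hj⟩⟩
    exact_mod_cast this
  have : 1 ≤ α * √((supp b).card : ℝ) + (1 - α) * √((groupSupp P b).card : ℝ) := by nlinarith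
  unfold effSparsity
  nlinarith

/-! ### The empirical inner product -/

theorem empNormSq_nonneg {T : ℕ} (v : Fin T → ℝ) : 0 ≤ empNormSq v := by
  unfold empNormSq empInner
  exact div_nonneg (Finset.sum_nonneg fun t _ => mul_self_nonneg _) (Nat.cast_nonneg _)

theorem empInner_mulVec {T p : ℕ} (u : Fin T → ℝ) (X : Matrix (Fin T) (Fin p) ℝ)
    (d : Fin p → ℝ) : empInner u (X.mulVec d) = ∑ j, d j * empInner u (fun t => X t j) := by
  unfold empInner
  simp only [Matrix.mulVec, dotProduct, Finset.mul_sum, mul_div_assoc', ← Finset.sum_div]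
  rw [Finset.sum_comm]
  congr 1
  refine Finset.sum_congr rfl fun j _ => Finset.sum_congr rfl fun t _ => by ring

theorem empNormSq_add_sub {T : ℕ} (u e w : Fin T → ℝ) :
    empNormSq (u + e - w) = empNormSq u + empNormSq e + empNormSq w + 2 * empInner u e -
      2 * empInner u w - 2 * empInner e w := by
  unfold empNormSq empInner
  simp only [Pi.add_apply, Pi.sub_apply]
  rw [← mul_div_assoc, ← mul_div_assoc, ← mul_div_assoc, ← add_div, ← add_div, ← add_div,
    ← sub_div, ← sub_div, Finset.mul_sum, Finset.mul_sum, Finset.mul_sum,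
    ← Finset.sum_add_distrib, ← Finset.sum_add_distrib, ← Finset.sum_add_distrib,
    ← Finset.sum_sub_distrib, ← Finset.sum_sub_distrib]
  congr 1
  exact Finset.sum_congr rfl fun t _ => by ring

theorem two_mul_empInner_le {T : ℕ} (e w : Fin T → ℝ) :
    2 * empInner e w ≤ 2 * empNormSq e + empNormSq w / 2 := by
  have h : 0 ≤ 4 * empNormSq e + empNormSq w - 4 * empInner e w := by
    unfold empNormSq empInner
    rw [← mul_div_assoc, ← mul_div_assoc, ← add_div, ← sub_div, Finset.mul_sum, Finset.mul_sum,
      ← Finset.sum_add_distrib, ← Finset.sum_sub_distrib]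
    refine div_nonneg (Finset.sum_nonneg fun t _ => ?_) (Nat.cast_nonneg _)
    nlinarith [sq_nonneg (2 * e t - w t)]
  linarith

theorem abs_empInner_le {T : ℕ} (u e : Fin T → ℝ) :
    |empInner u e| ≤ √(empNormSq u * empNormSq e) := by
  refine Real.abs_le_sqrt ?_
  unfold empNormSq empInner
  rw [div_pow, div_mul_div_comm, ← sq (T : ℝ)]
  gcongr
  simpa only [sq] using Finset.sum_mul_sq_le_sq_mul_sq Finset.univ u e

/-! ### The oracle bound with finitely many exceptional covariates -/

theorem abs_empInner_mulVec_le {T p : ℕ} (u : Fin T → ℝ) (X : Matrix (Fin T) (Fin p) ℝ)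
    {l h M N : ℝ} (hl : 0 < l) (hh : 0 ≤ h) (B : Finset (Fin p)) (hN : (B.card : ℝ) ≤ N)
    (hB : ∀ j ∉ B, |empInner u (fun t => X t j)| ≤ h * l / 2) (hM0 : 0 ≤ M)
    (hM : ∀ j, |empInner u (fun t => X t j)| ≤ M * l) (d : Fin p → ℝ) :
    |empInner u (X.mulVec d)| ≤ M * l * ∑ j, |d j| ∧
    |empInner u (X.mulVec d)| ≤
      h * l / 2 * (∑ j, |d j|) + M * l * (√N * √(∑ j, d j ^ 2)) := by
  rw [empInner_mulVec]
  have h0 : |∑ j, d j * empInner u (fun t => X t j)| ≤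
      ∑ j, |d j| * |empInner u (fun t => X t j)| := by
    refine (Finset.abs_sum_le_sum_abs _ _).trans (le_of_eq ?_)
    simp only [abs_mul]
  have hML : 0 ≤ M * l := by positivity
  constructor
  · refine h0.trans ?_
    rw [Finset.mul_sum]
    refine Finset.sum_le_sum fun j _ => ?_
    rw [mul_comm]
    exact mul_le_mul_of_nonneg_right (hM j) (abs_nonneg _)
  · refine h0.trans ?_
    have h1 : ∀ j, |d j| * |empInner u (fun t => X t j)| ≤
        h * l / 2 * |d j| + M * l * (if j ∈ B then |d j| else 0) := by
      intro j
      by_cases hj : j ∈ B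
      · rw [if_pos hj]
        have := mul_le_mul_of_nonneg_left (hM j) (abs_nonneg (d j))
        have h2 : 0 ≤ h * l / 2 * |d j| := by positivity
        linarith
      · rw [if_neg hj]
        have := mul_le_mul_of_nonneg_left (hB j hj) (abs_nonneg (d j))
        linarith
    refine (Finset.sum_le_sum fun j _ => h1 j).trans ?_
    rw [Finset.sum_add_distrib, ← Finset.mul_sum, ← Finset.mul_sum, Finset.sum_ite_mem,
      Finset.univ_inter]
    have h3 : ∑ j ∈ B, |d j| ≤ √N * √(∑ j, d j ^ 2) := by
      refine (sum_abs_le_sqrt_card_mul B d).trans ?_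
      gcongr
      exact Finset.subset_univ _
    gcongr

set_option maxHeartbeats 1000000 in
/-- The scalar inequalities behind the deterministic bound for the variance estimator: `a₁`, `a₂`
are the `ℓ₁` and `ℓ₂` norms of the estimation error, `Q` its prediction error, and `E` the squared
norm of the approximation error. -/
theorem exists_abs_sub_le_of_basic_inequality {γ g b₀ M₁ M₂ M N : ℝ} (hγ : 0 < γ) (hg : 1 ≤ g)
    (hb₀ : 0 ≤ b₀) (hM₁ : 0 ≤ M₁) (hM : 0 ≤ M) :
    ∃ c D : ℝ, 0 < c ∧ 0 < D ∧ ∀ s l a₁ a₂ Q E U b₁ β₁ uX eX ue pb pβ : ℝ,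
      0 < l → 1 ≤ s → s * l ≤ 1 → 0 ≤ a₁ → 0 ≤ a₂ → 0 ≤ E → 0 ≤ Q → 0 ≤ β₁ → 0 ≤ pb →
      U + E + Q + 2 * ue - 2 * uX - 2 * eX + 2 * l * pb ≤ U + E + 2 * ue + 2 * l * pβ →
      |uX| ≤ M * l * a₁ → |uX| ≤ (√g)⁻¹ * l / 2 * a₁ + M * l * (√N * a₂) →
      2 * eX ≤ 2 * E + Q / 2 → 0 ≤ E + Q - 2 * eX → |ue| ≤ √(M₂ * M₁) * (s * l) →
      b₁ ≤ √g * pb → pβ ≤ β₁ → a₁ ≤ b₁ + β₁ → β₁ ≤ √g * b₀ * √s → E ≤ M₁ * (s * l ^ 2) →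
      γ * a₂ ^ 2 ≤ Q + c / s * a₁ ^ 2 →
      |U + E + Q + 2 * ue - 2 * uX - 2 * eX + l * pb - U| ≤ D * (s * l) := by
  set k := √g * b₀ with hk
  have hsg : 1 ≤ √g := Real.one_le_sqrt.2 hg
  have hk0 : 0 ≤ k := by positivity
  have hN0 : 0 ≤ √N := Real.sqrt_nonneg _
  set D₁ := √g * (2 * M₁ + 4 * k + 2 * M * √N) with hD₁
  set D₂ := 4 * M₁ + 4 * M * √N + 8 * k with hD₂
  set D₃ := 4 * D₂ / γ + 1 with hD₃
  have hD₁0 : 0 ≤ D₁ := by positivity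
  have hD₂0 : 0 ≤ D₂ := by positivity
  have hD₃0 : 0 < D₃ := by positivity
  refine ⟨γ / (4 * (D₁ ^ 2 + 1)), M₁ + 2 * √(M₂ * M₁) + 2 * k + 2 * M * (D₁ * (1 + D₃)) + 1,
    by positivity, by positivity, ?_⟩
  intro s l a₁ a₂ Q E U b₁ β₁ uX eX ue pb pβ hl hs1 hsl ha1' ha20 hE0 hQ0 hβ0 hpb0 hmin' huX1 huX2
    heX hEQ hue' hpb hpβ ha1 hβ1 he hRE'
  set c := γ / (4 * (D₁ ^ 2 + 1)) with hc
  have hs0 : 0 < s := by linarith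
  have hss : √s * √s = s := Real.mul_self_sqrt hs0.le
  have hs1' : 1 ≤ √s := Real.one_le_sqrt.2 hs1
  have hsls : √s ≤ s := by
    have := mul_le_mul_of_nonneg_left hs1' (Real.sqrt_nonneg s)
    linarith
  have hl1 : l ≤ 1 := (le_mul_of_one_le_left hl.le hs1).trans hsl
  set h := (√g)⁻¹ with hh
  have hh0 : 0 < h := by positivity
  have hh1 : h ≤ 1 := inv_le_one_of_one_le₀ hsg
  have hhg : h * √g = 1 := inv_mul_cancel₀ (by positivity)
  have hpb' : h * b₁ ≤ pb := by
    have := mul_le_mul_of_nonneg_left hpb hh0.le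
    rwa [← mul_assoc, hhg, one_mul] at this
  have hbasic : Q / 2 + l * (h * a₁) ≤ 2 * E + 2 * M * l * (√N * a₂) + 4 * l * β₁ := by
    have t1 : l * (h * a₁) ≤ l * (pb) + l * β₁ := by
      rw [← mul_add]
      refine mul_le_mul_of_nonneg_left ?_ hl.le
      have e1 := mul_le_mul_of_nonneg_left ha1 hh0.le
      have e2 := mul_le_of_le_one_left hβ0 hh1
      linarith
    have t2 : l * pβ ≤ l * β₁ := mul_le_mul_of_nonneg_left hpβ hl.le
    have t3 := (abs_le.1 huX2).2
    linarith
  have hlβ : l * β₁ ≤ k * (s * l) := by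
    have e1 := mul_le_mul_of_nonneg_left hβ1 hl.le
    have e2 := mul_le_mul_of_nonneg_left hsls (by positivity : 0 ≤ k * l)
    linarith
  have hEsl : E ≤ M₁ * (s * l) := by
    refine he.trans (mul_le_mul_of_nonneg_left ?_ hM₁)
    rw [sq, ← mul_assoc]
    exact mul_le_of_le_one_right (by positivity) hl1
  -- `|b - β|₁ ≲ √s + |b - β|₂`
  have ha1b : a₁ ≤ D₁ * (√s + a₂) := by
    have e1 : l * (h * a₁) ≤ l * (2 * M₁ * (s * l) + 2 * M * (√N * a₂) + 4 * β₁) := by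
      linarith
    have e2 := le_of_mul_le_mul_left e1 hl
    have e3 : h * a₁ ≤ (2 * M₁ + 4 * k + 2 * M * √N) * (√s + a₂) := by
      have f1 : 2 * M₁ * (s * l) ≤ 2 * M₁ * √s := by
        refine mul_le_mul_of_nonneg_left (hsl.trans hs1') (by positivity)
      have f2 : 0 ≤ (2 * M₁ + 4 * k) * a₂ := by positivity
      have f3 : 0 ≤ 2 * M * √N * √s := by positivity
      linarith
    calc a₁ = √g * (h * a₁) := by rw [← mul_assoc, mul_comm (√g), hhg, one_mul]
      _ ≤ √g * ((2 * M₁ + 4 * k + 2 * M * √N) * (√s + a₂)) := by gcongr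
      _ = _ := by rw [hD₁]; ring
  have hQb : Q ≤ D₂ * (1 + a₂) := by
    have f1 : 0 ≤ l * (h * a₁) := by positivity
    have f2 : M₁ * (s * l) ≤ M₁ := mul_le_of_le_one_right hM₁ hsl
    have f3 : k * (s * l) ≤ k := mul_le_of_le_one_right hk0 hsl
    have f4 : M * l * (√N * a₂) ≤ M * √N * a₂ := by
      have : 0 ≤ M * √N * a₂ := by positivity
      have := mul_le_of_le_one_left this hl1
      linarith
    have f5 : 0 ≤ (4 * M₁ + 8 * k) * a₂ := by positivity
    have f6 : 0 ≤ M * √N := by positivity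
    rw [hD₂]
    linarith
  have hcD : c * D₁ ^ 2 ≤ γ / 4 := by
    rw [hc, div_mul_eq_mul_div, div_le_div_iff₀ (by positivity) (by norm_num)]
    linarith
  have hc0 : 0 < c := by positivity
  have ha1sq : c / s * a₁ ^ 2 ≤ γ / 2 * (1 + a₂ ^ 2) := by
    have e1 : a₁ ^ 2 ≤ D₁ ^ 2 * (2 * (s + a₂ ^ 2)) := by
      calc a₁ ^ 2 ≤ (D₁ * (√s + a₂)) ^ 2 := by gcongr
        _ = D₁ ^ 2 * (√s + a₂) ^ 2 := mul_pow _ _ _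
        _ ≤ _ := by
            refine mul_le_mul_of_nonneg_left ?_ (sq_nonneg _)
            refine add_sq_le.trans (le_of_eq ?_)
            rw [sq √s, hss]
    have e2 : s + a₂ ^ 2 ≤ s * (1 + a₂ ^ 2) := by
      have := le_mul_of_one_le_left (sq_nonneg a₂) hs1
      linarith
    calc c / s * a₁ ^ 2 ≤ c / s * (D₁ ^ 2 * (2 * (s * (1 + a₂ ^ 2)))) := by
          refine mul_le_mul_of_nonneg_left (e1.trans ?_) (by positivity)
          gcongr
      _ = (c * D₁ ^ 2) * (2 * (1 + a₂ ^ 2)) := by field_simp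
      _ ≤ γ / 4 * (2 * (1 + a₂ ^ 2)) := by gcongr
      _ = _ := by ring
  -- `|b - β|₂ ≲ 1`
  have ha2b : a₂ ≤ D₃ := by
    have e1 : γ / 2 * a₂ ^ 2 ≤ D₂ * (1 + a₂) + γ / 2 := by linarith
    rcases le_total a₂ 1 with h1 | h1
    · have : 0 ≤ 4 * D₂ / γ := by positivity
      linarith
    · have e2 : γ / 2 * a₂ * a₂ ≤ (2 * D₂ + γ / 2) * a₂ := by
        have f1 := le_mul_of_one_le_right hD₂0 h1
        have f2 := le_mul_of_one_le_right (by positivity : 0 ≤ γ / 2) h1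
        linarith
      have e3 := le_of_mul_le_mul_right e2 (by linarith)
      have e4 : γ * a₂ ≤ 4 * D₂ + γ := by linarith
      rw [hD₃, div_add_one hγ.ne', le_div_iff₀ hγ]
      linarith
  have ha1c : l * a₁ ≤ D₁ * (1 + D₃) * (s * l) := by
    have e1 : √s + a₂ ≤ (1 + D₃) * s := by
      have := le_mul_of_one_le_right hD₃0.le hs1
      linarith
    have e2 := ha1b.trans (mul_le_mul_of_nonneg_left e1 hD₁0)
    have e3 := mul_le_mul_of_nonneg_left e2 hl.le
    linarith
  have hsl0 : 0 < s * l := by positivity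
  have huXb : |uX| ≤ M * (D₁ * (1 + D₃)) * (s * l) := by
    have := mul_le_mul_of_nonneg_left ha1c hM
    linarith
  have hlp : 0 ≤ l * pb := by positivity
  have hlpβ : l * pβ ≤ l * β₁ := mul_le_mul_of_nonneg_left hpβ hl.le
  have q1 := abs_le.1 hue'
  have q2 := abs_le.1 huXb
  have z1 : 0 ≤ M₁ * (s * l) := by positivity
  have z2 : 0 ≤ k * (s * l) := by positivity
  have z3 : 0 ≤ √(M₂ * M₁) * (s * l) := by positivity
  have z4 : 0 ≤ M * (D₁ * (1 + D₃)) * (s * l) := (abs_nonneg _).trans huXb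
  rw [abs_le]
  constructor
  · linarith [q1.1, q2.2]
  · linarith [q1.2, q2.1]

/-- A deterministic bound for the variance estimator. Off a set `B` of at most `N` covariates the
correlations with the error are dominated by the penalty; on `B` they are only bounded by a
multiple `M` of it. Then `b - β` satisfies `|b - β|₁ ≲ √s + |b - β|₂`, and the lower bound for the
quadratic form, in which `c` is small compared with the constants, turns this into
`|b - β|₂ ≲ 1` and `|b - β|₁ ≲ √s`. -/
theorem exists_abs_sigmaHatSq_sub_le {γ g b₀ M₁ M₂ M N : ℝ} (hγ : 0 < γ) (hg : 1 ≤ g)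
    (hb₀ : 0 ≤ b₀) (hM₁ : 0 ≤ M₁) (hM₂ : 0 ≤ M₂) (hM : 0 ≤ M) :
    ∃ c D : ℝ, 0 < c ∧ 0 < D ∧ ∀ {T p : ℕ} (u m : Fin T → ℝ) (X : Matrix (Fin T) (Fin p) ℝ)
      (l α s : ℝ) (P : Groups p) (β b : Fin p → ℝ) (B : Finset (Fin p)),
      0 < l → 0 ≤ α → α ≤ 1 → (∀ G ∈ P.parts, (G.card : ℝ) ≤ g) → s = effSparsity α P β →
      1 ≤ s → s * l ≤ 1 → IsSgLasso (m + u) X l α P b → √(∑ j, β j ^ 2) ≤ b₀ →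
      empNormSq (m - X.mulVec β) ≤ M₁ * (s * l ^ 2) → empNormSq u ≤ M₂ →
      (B.card : ℝ) ≤ N → (∀ j ∉ B, |empInner u (fun t => X t j)| ≤ (√g)⁻¹ * l / 2) →
      (∀ j, |empInner u (fun t => X t j)| ≤ M * l) →
      (∀ d : Fin p → ℝ, γ * ∑ j, d j ^ 2 ≤
        empNormSq (X.mulVec d) + c / s * (∑ j, |d j|) ^ 2) →
      |sigmaHatSq (m + u) X l α P b - empNormSq u| ≤ D * (s * l) := by
  obtain ⟨c, D, hc, hD, key⟩ := exists_abs_sub_le_of_basic_inequality (M₂ := M₂) (N := N) hγ hg hb₀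
    hM₁ hM
  refine ⟨c, D, hc, hD, ?_⟩
  intro T p u m X l α s P β b B hl hα0 hα1 hgP hs hs1 hsl hmin hβ he hu hBN hB hBM hRE
  have hs0 : 0 < s := by linarith
  set e := m - X.mulVec β with hedef
  set d := b - β with hd
  have hy1 : (m + u) - X.mulVec b = u + e - X.mulVec d := by
    rw [hedef, hd, Matrix.mulVec_sub]; abel
  have hy2 : (m + u) - X.mulVec β = u + e - X.mulVec 0 := by
    rw [hedef, Matrix.mulVec_zero]; abel
  have hmin' := hmin β
  have hz1 : empNormSq (X.mulVec (0 : Fin p → ℝ)) = 0 := by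
    simp [empNormSq, empInner]
  have hz2 : ∀ w : Fin T → ℝ, empInner w (X.mulVec (0 : Fin p → ℝ)) = 0 := by
    simp [empInner]
  rw [hy1, hy2, empNormSq_add_sub, empNormSq_add_sub, hz1, hz2, hz2, add_zero, mul_zero,
    sub_zero, sub_zero] at hmin'
  obtain ⟨huX1, huX2⟩ := abs_empInner_mulVec_le u X hl (inv_nonneg.2 (Real.sqrt_nonneg g)) B hBN hB
    hM hBM d
  have heX := two_mul_empInner_le e (X.mulVec d)
  have hue := abs_empInner_le u e
  have hpb := sum_abs_le_sqrt_mul_penalty hα0 hα1 P hg hgP b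
  have hpb0 := penalty_nonneg hα0 hα1 P b
  have hpβ := penalty_le_sum_abs hα1 P β
  have ha1 : ∑ j, |d j| ≤ ∑ j, |b j| + ∑ j, |β j| := by
    rw [← Finset.sum_add_distrib]
    exact Finset.sum_le_sum fun j _ => abs_sub _ _
  have hβ1 : ∑ j, |β j| ≤ √g * b₀ * √s := by
    refine (sum_abs_le_sqrt_supp_mul β).trans ?_
    have h1 : √((supp β).card : ℝ) ≤ √g * √s := by
      rw [← Real.sqrt_mul (by linarith), hs]
      exact Real.sqrt_le_sqrt (card_supp_le_mul_effSparsity hα0 hα1 P hg hgP β)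
    calc _ ≤ (√g * √s) * b₀ := by gcongr
      _ = √g * b₀ * √s := by ring
  have hRE' := hRE d
  have ha1' : 0 ≤ ∑ j, |d j| := Finset.sum_nonneg fun j _ => abs_nonneg _
  have hβ0 : 0 ≤ ∑ j, |β j| := Finset.sum_nonneg fun j _ => abs_nonneg _
  have ha2 : √(∑ j, d j ^ 2) ^ 2 = ∑ j, d j ^ 2 :=
    Real.sq_sqrt (Finset.sum_nonneg fun j _ => sq_nonneg _)
  rw [← ha2] at hRE'
  have ha20 : 0 ≤ √(∑ j, d j ^ 2) := Real.sqrt_nonneg _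
  have hQ0 := empNormSq_nonneg (X.mulVec d)
  have hE0 := empNormSq_nonneg e
  have hU0 := empNormSq_nonneg u
  have hEQ : 0 ≤ empNormSq e + empNormSq (X.mulVec d) - 2 * empInner e (X.mulVec d) := by
    have := empNormSq_nonneg (0 + e - X.mulVec d)
    rw [empNormSq_add_sub] at this
    have z1 : empNormSq (0 : Fin T → ℝ) = 0 := by simp [empNormSq, empInner]
    have z2 : ∀ w : Fin T → ℝ, empInner 0 w = 0 := by simp [empInner]
    rw [z1, z2, z2] at this
    linarith
  have hue' : |empInner u e| ≤ √(M₂ * M₁) * (s * l) := by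
    refine hue.trans ?_
    calc √(empNormSq u * empNormSq e) ≤ √(M₂ * (M₁ * (s * l) ^ 2)) := by
          refine Real.sqrt_le_sqrt (mul_le_mul hu (he.trans ?_) hE0 hM₂)
          rw [mul_pow]
          gcongr
          nlinarith
      _ = √(M₂ * M₁) * (s * l) := by
          rw [← mul_assoc, Real.sqrt_mul (by positivity), Real.sqrt_sq (by positivity)]
  unfold sigmaHatSq
  rw [hy1, empNormSq_add_sub]
  exact key s l _ _ _ _ _ _ _ _ _ _ _ _ hl hs1 hsl ha1' ha20 hE0 hQ0 hβ0 hpb0 hmin' huX1 huX2 heX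
    hEQ hue' hpb hpβ ha1 hβ1 he hRE'

/-! ### Consequences of the assumptions on the data -/

theorem two_lt_varsigma {q r : ℝ} (hr : 4 < r) (hq : 2 * r / (r - 2) < q) :
    2 < q ∧ 2 < varsigma q r := by
  rw [div_lt_iff₀ (by linarith)] at hq
  have h2 : 2 < q := by nlinarith
  refine ⟨h2, ?_⟩
  unfold varsigma
  rw [lt_div_iff₀ (by linarith)]
  linarith

theorem integral_centered_rpow_le {Ω : Type u} [MeasurableSpace Ω] {μ : Measure Ω}
    [IsProbabilityMeasure μ] {v : ℤ → Ω → ℝ} {ς R : ℝ} (hς : 1 ≤ ς) (hR : 0 ≤ R) (t : ℤ)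
    (hm : Measurable (v t)) (hv : eLpNorm (v t) (ENNReal.ofReal ς) μ ≤ ENNReal.ofReal R) :
    Integrable (v t) μ ∧ Integrable (fun ω => |centered μ v t ω| ^ ς) μ ∧
      ∫ ω, |centered μ v t ω| ^ ς ∂μ ≤ (2 * R) ^ ς := by
  have h1 : (1 : ℝ≥0∞) ≤ ENNReal.ofReal ς := by
    rw [← ENNReal.ofReal_one]; exact ENNReal.ofReal_le_ofReal hς
  have hmem : MemLp (v t) (ENNReal.ofReal ς) μ :=
    ⟨hm.aestronglyMeasurable, hv.trans_lt ENNReal.ofReal_lt_top⟩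
  have hint : Integrable (v t) μ := hmem.integrable h1
  have hmemc : MemLp (centered μ v t) (ENNReal.ofReal ς) μ := hmem.sub (memLp_const _)
  have hς0 : ENNReal.ofReal ς ≠ 0 := (zero_lt_one.trans_le h1).ne'
  have htr : (ENNReal.ofReal ς).toReal = ς := ENNReal.toReal_ofReal (by linarith)
  have hmean : ‖∫ ω, v t ω ∂μ‖ₑ ≤ ENNReal.ofReal R := by
    refine (enorm_integral_le_lintegral_enorm _).trans ?_
    rw [← eLpNorm_one_eq_lintegral_enorm]
    exact (eLpNorm_le_eLpNorm_of_exponent_le h1 hm.aestronglyMeasurable).trans hv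
  have hcn : eLpNorm (centered μ v t) (ENNReal.ofReal ς) μ ≤ ENNReal.ofReal (2 * R) := by
    have e1 : eLpNorm (centered μ v t) (ENNReal.ofReal ς) μ ≤ eLpNorm (v t) (ENNReal.ofReal ς) μ +
        eLpNorm (fun _ => ∫ ω, v t ω ∂μ) (ENNReal.ofReal ς) μ :=
      eLpNorm_sub_le hm.aestronglyMeasurable aestronglyMeasurable_const h1
    have e2 : eLpNorm (fun _ : Ω => ∫ ω, v t ω ∂μ) (ENNReal.ofReal ς) μ =
        ‖∫ ω, v t ω ∂μ‖ₑ := by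
      rw [eLpNorm_const _ hς0 (IsProbabilityMeasure.ne_zero μ)]
      simp
    rw [e2] at e1
    refine e1.trans ((add_le_add hv hmean).trans_eq ?_)
    rw [← ENNReal.ofReal_add hR hR, two_mul]
  have hI := hmemc.integrable_norm_rpow hς0 ENNReal.ofReal_ne_top
  rw [htr] at hI
  simp only [Real.norm_eq_abs] at hI
  refine ⟨hint, hI, ?_⟩
  rw [hmemc.eLpNorm_eq_integral_rpow_norm hς0 ENNReal.ofReal_ne_top, htr,
    ENNReal.ofReal_le_ofReal_iff (by linarith)] at hcn
  simp only [Real.norm_eq_abs] at hcn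
  have hnn : 0 ≤ ∫ ω, |centered μ v t ω| ^ ς ∂μ := integral_nonneg fun _ => by positivity
  rwa [Real.rpow_inv_le_iff_of_pos hnn (by linarith) (by linarith)] at hcn

/-- Products of two processes with bounded moments of orders `q` and `r`, by Hölder's inequality.
The summand `1` keeps the moment bound positive when `K ≤ 0`. -/
theorem weaklyDependent_mul {Ω : Type u} [MeasurableSpace Ω] {μ : Measure Ω}
    [IsProbabilityMeasure μ] {f h : ℤ → Ω → ℝ} {q r ς a c K : ℝ} (hq : 0 < q) (hr : 0 < r)
    (hς : 1 ≤ ς) (hςqr : ς⁻¹ = q⁻¹ + r⁻¹) (hf : ∀ t, Measurable (f t)) (hh : ∀ t, Measurable (h t))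
    (hfK : ∀ t, eLpNorm (f t) (ENNReal.ofReal q) μ ≤ ENNReal.ofReal K)
    (hhK : ∀ t, eLpNorm (h t) (ENNReal.ofReal r) μ ≤ ENNReal.ofReal K)
    (hmix : ∀ k : ℕ, 1 ≤ k → tauMixing μ (fun t ω => f t ω * h t ω) k ≤
      ENNReal.ofReal (c * (k : ℝ) ^ (-a))) :
    WeaklyDependent μ (fun t ω => f t ω * h t ω) ς a c ((2 * (max K 0) ^ 2) ^ ς + 1) := by
  have hK : ENNReal.ofReal K = ENNReal.ofReal (max K 0) := by
    rcases le_total K 0 with h0 | h0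
    · rw [max_eq_right h0, ENNReal.ofReal_of_nonpos h0, ENNReal.ofReal_zero]
    · rw [max_eq_left h0]
  have hm : ∀ t, Measurable (fun ω => f t ω * h t ω) := fun t => (hf t).mul (hh t)
  have hHT : ENNReal.HolderTriple (ENNReal.ofReal q) (ENNReal.ofReal r) (ENNReal.ofReal ς) := by
    constructor
    rw [← ENNReal.ofReal_inv_of_pos hq, ← ENNReal.ofReal_inv_of_pos hr,
      ← ENNReal.ofReal_inv_of_pos (by linarith), hςqr,
      ENNReal.ofReal_add (by positivity) (by positivity)]
  have hnorm : ∀ t, eLpNorm (fun ω => f t ω * h t ω) (ENNReal.ofReal ς) μ ≤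
      ENNReal.ofReal ((max K 0) ^ 2) := by
    intro t
    have e1 : eLpNorm (f t • h t) (ENNReal.ofReal ς) μ ≤
        eLpNorm (f t) (ENNReal.ofReal q) μ * eLpNorm (h t) (ENNReal.ofReal r) μ :=
      eLpNorm_smul_le_mul_eLpNorm (hh t).aestronglyMeasurable (hf t).aestronglyMeasurable
    refine e1.trans ((mul_le_mul' (hfK t) (hhK t)).trans_eq ?_)
    rw [hK, sq, ENNReal.ofReal_mul (le_max_right _ _)]
  have key := fun t => integral_centered_rpow_le (v := fun t ω => f t ω * h t ω) hς
    (by positivity) t (hm t) (hnorm t)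
  exact ⟨hm, fun t => (key t).1, fun t => (key t).2.1,
    fun t => (key t).2.2.trans (by linarith), hmix⟩

/-- The eigenvalue condition as a lower bound for the quadratic form. -/
theorem mul_sum_sq_le_covMatrix {Ω : Type u} [MeasurableSpace Ω] {μ : Measure Ω}
    {x : ℤ → ℕ → Ω → ℝ} {γ : ℝ} (h : CovarianceAssumption μ x γ) (t : ℤ) (p : ℕ)
    (d : Fin p → ℝ) :
    γ * ∑ j, d j ^ 2 ≤ ∑ j, ∑ l, d j * d l * ∫ ω, x t j ω * x t l ω ∂μ := by
  set S := covMatrix μ x t p with hS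
  have hsymm : (S - γ • (1 : Matrix (Fin p) (Fin p) ℝ)).IsHermitian := by
    refine Matrix.IsHermitian.sub ?_ ?_
    · ext j l
      simp [hS, covMatrix, mul_comm]
    · ext j l
      simp [Matrix.one_apply, eq_comm]
  have hpsd : (S - γ • (1 : Matrix (Fin p) (Fin p) ℝ)).PosSemidef := by
    rw [hsymm.posSemidef_iff_eigenvalues_nonneg]
    intro i
    have hv := hsymm.mulVec_eigenvectorBasis i
    have hne : (hsymm.eigenvectorBasis i) ≠ 0 := hsymm.eigenvectorBasis.orthonormal.ne_zero i
    have hev : Module.End.HasEigenvalue (Matrix.toLin' S) (hsymm.eigenvalues i + γ) := by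
      refine Module.End.hasEigenvalue_of_hasEigenvector
        (x := WithLp.ofLp (hsymm.eigenvectorBasis i)) ⟨?_, ?_⟩
      · rw [Module.End.mem_eigenspace_iff, Matrix.toLin'_apply, add_smul]
        rw [Matrix.sub_mulVec, Matrix.smul_mulVec, Matrix.one_mulVec, sub_eq_iff_eq_add] at hv
        exact hv
      · intro h0
        exact hne (by ext j; exact congrFun h0 j)
    have := h t p _ hev
    simp only [Pi.zero_apply]
    linarith
  have hd := hpsd.dotProduct_mulVec_nonneg d
  rw [Matrix.sub_mulVec, Matrix.smul_mulVec, Matrix.one_mulVec, dotProduct_sub,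
    dotProduct_smul] at hd
  have e1 : star d ⬝ᵥ S.mulVec d = ∑ j, ∑ l, d j * d l * ∫ ω, x t j ω * x t l ω ∂μ := by
    simp only [dotProduct, Matrix.mulVec, Finset.mul_sum, hS, covMatrix, Matrix.of_apply]
    refine Finset.sum_congr rfl fun j _ => Finset.sum_congr rfl fun l _ => ?_
    simp only [Pi.star_apply, star_trivial]
    ring
  have e2 : star d ⬝ᵥ d = ∑ j, d j ^ 2 := by
    simp only [dotProduct, Pi.star_apply, star_trivial, sq]
  rw [e1, e2, smul_eq_mul] at hd
  linarith

/-- A uniform bound for the entries of the sample covariance matrix transfers the eigenvalue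
condition to the sample. -/
theorem mul_sum_sq_le_empNormSq_add {Ω : Type u} [MeasurableSpace Ω] {μ : Measure Ω}
    {x : ℤ → ℕ → Ω → ℝ} {γ : ℝ} (h : CovarianceAssumption μ x γ) {T p : ℕ} (hT : 0 < T) {η : ℝ}
    (ω : Ω) (hη : ∀ j l : Fin p, |∑ t ∈ Finset.range T,
      centered μ (fun t ω => x t j ω * x t l ω) ((t : ℤ) + 1) ω| ≤ T * η) (d : Fin p → ℝ) :
    γ * ∑ j, d j ^ 2 ≤
      empNormSq ((design x T p ω).mulVec d) + η * (∑ j, |d j|) ^ 2 := by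
  have hT0 : (0 : ℝ) < T := by exact_mod_cast hT
  set m : ℕ → Fin p → Fin p → ℝ := fun t j l =>
    ∫ ω, x ((t : ℤ) + 1) j ω * x ((t : ℤ) + 1) l ω ∂μ with hm
  set z : ℕ → Fin p → ℝ := fun t j => x ((t : ℤ) + 1) j ω with hz
  have h1 : T * (γ * ∑ j, d j ^ 2) ≤
      ∑ t ∈ Finset.range T, ∑ j, ∑ l, d j * d l * m t j l := by
    calc T * (γ * ∑ j, d j ^ 2) = ∑ _t ∈ Finset.range T, γ * ∑ j, d j ^ 2 := by simp
      _ ≤ _ := Finset.sum_le_sum fun t _ => mul_sum_sq_le_covMatrix h _ p d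
  have h2 : T * empNormSq ((design x T p ω).mulVec d) =
      ∑ t ∈ Finset.range T, ∑ j, ∑ l, d j * d l * (z t j * z t l) := by
    unfold empNormSq empInner
    rw [mul_div_cancel₀ _ hT0.ne', ← Fin.sum_univ_eq_sum_range
      (fun t => ∑ j, ∑ l, d j * d l * (z t j * z t l)) T]
    refine Finset.sum_congr rfl fun t _ => ?_
    simp only [Matrix.mulVec, dotProduct, design, Matrix.of_apply]
    rw [Finset.sum_mul_sum]
    refine Finset.sum_congr rfl fun j _ => Finset.sum_congr rfl fun l _ => ?_
    simp only [hz]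
    ring
  have h3 : ∑ t ∈ Finset.range T, ∑ j, ∑ l, d j * d l * m t j l -
      ∑ t ∈ Finset.range T, ∑ j, ∑ l, d j * d l * (z t j * z t l) ≤
        T * (η * (∑ j, |d j|) ^ 2) := by
    have e1 : ∑ t ∈ Finset.range T, ∑ j, ∑ l, d j * d l * m t j l -
        ∑ t ∈ Finset.range T, ∑ j, ∑ l, d j * d l * (z t j * z t l) =
        ∑ j, ∑ l, d j * d l * -(∑ t ∈ Finset.range T,
          centered μ (fun t ω => x t j ω * x t l ω) ((t : ℤ) + 1) ω) := by
      have hcomm : ∀ f : ℕ → Fin p → Fin p → ℝ, ∑ t ∈ Finset.range T, ∑ j, ∑ l, f t j l =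
          ∑ j, ∑ l, ∑ t ∈ Finset.range T, f t j l := by
        intro f
        rw [Finset.sum_comm]
        exact Finset.sum_congr rfl fun j _ => Finset.sum_comm
      rw [hcomm, hcomm, ← Finset.sum_sub_distrib]
      refine Finset.sum_congr rfl fun j _ => ?_
      rw [← Finset.sum_sub_distrib]
      refine Finset.sum_congr rfl fun l _ => ?_
      rw [← Finset.sum_sub_distrib, ← Finset.sum_neg_distrib, Finset.mul_sum]
      refine Finset.sum_congr rfl fun t _ => ?_
      simp only [centered, hm, hz]
      ring
    rw [e1]
    calc _ ≤ ∑ j, ∑ l, |d j| * |d l| * (T * η) := by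
          refine Finset.sum_le_sum fun j _ => Finset.sum_le_sum fun l _ => ?_
          refine (le_abs_self _).trans ?_
          rw [abs_mul, abs_mul, abs_neg]
          exact mul_le_mul_of_nonneg_left (hη j l) (by positivity)
      _ = _ := by
          rw [sq, Finset.sum_mul_sum, ← mul_assoc, Finset.mul_sum]
          refine Finset.sum_congr rfl fun j _ => ?_
          rw [Finset.mul_sum]
          exact Finset.sum_congr rfl fun l _ => by ring
  have h4 : T * (γ * ∑ j, d j ^ 2) ≤
      T * (empNormSq ((design x T p ω).mulVec d) + η * (∑ j, |d j|) ^ 2) := by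
    rw [mul_add, h2]
    linarith
  exact le_of_mul_le_mul_left h4 hT0

theorem integral_sum_sq_eq {Ω : Type u} [MeasurableSpace Ω] {μ : Measure Ω}
    (z : ℕ → Ω → ℝ) (hz : ∀ j, MemLp (z j) 2 μ) (β : ℕ → ℝ) (n : ℕ) :
    ∫ ω, (∑ j ∈ Finset.range n, β j * z j ω) ^ 2 ∂μ =
      ∑ j : Fin n, ∑ l : Fin n, β j * β l * ∫ ω, z j ω * z l ω ∂μ := by
  have hI : ∀ j l, Integrable (fun ω => z j ω * z l ω) μ := fun j l => (hz j).integrable_mul (hz l)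
  have e : ∀ ω, (∑ j ∈ Finset.range n, β j * z j ω) ^ 2 =
      ∑ j : Fin n, ∑ l : Fin n, β j * β l * (z j ω * z l ω) := by
    intro ω
    rw [← Fin.sum_univ_eq_sum_range (fun j => β j * z j ω), sq, Finset.sum_mul_sum]
    refine Finset.sum_congr rfl fun j _ => Finset.sum_congr rfl fun l _ => by ring
  simp only [e]
  rw [integral_finsetSum _ fun j _ => integrable_finsetSum _ fun l _ => (hI _ _).const_mul _]
  refine Finset.sum_congr rfl fun j _ => ?_
  rw [integral_finsetSum _ fun l _ => (hI _ _).const_mul _]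
  exact Finset.sum_congr rfl fun l _ => integral_const_mul _ _

/-- The coefficients are square summable: their partial sums of squares are controlled by the
second moments of the partial sums of the series, which converge. -/
theorem exists_sqrt_sum_sq_le {Ω : Type u} [MeasurableSpace Ω] {μ : Measure Ω}
    {m : ℤ → Ω → ℝ} {x : ℤ → ℕ → Ω → ℝ} {β : ℕ → ℝ} {γ : ℝ} (hγ : 0 < γ)
    (hcov : CovarianceAssumption μ x γ) (hx : ∀ j, MemLp (x 0 j) 2 μ) (hmm : Measurable (m 0))
    (hser : Tendsto (fun n : ℕ => eLpNorm (fun ω => ∑ j ∈ Finset.range n, β j * x 0 j ω - m 0 ω)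
      2 μ) atTop (𝓝 0)) :
    ∃ b₀ : ℝ, 0 ≤ b₀ ∧ ∀ p, √(∑ j, trunc β p j ^ 2) ≤ b₀ := by
  set S : ℕ → Ω → ℝ := fun n ω => ∑ j ∈ Finset.range n, β j * x 0 j ω with hS
  have hSmem : ∀ n, MemLp (S n) 2 μ := fun n =>
    memLp_finsetSum _ fun j _ => (hx j).const_mul _
  obtain ⟨N, hN⟩ :=
    (hser.eventually (ge_mem_nhds (by norm_num : (0 : ℝ≥0∞) < 1))).exists_forall_of_atTop
  have hbound : ∀ n ≥ N, eLpNorm (S n) 2 μ ≤ eLpNorm (S N) 2 μ + 2 := by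
    intro n hn
    have hdn : AEStronglyMeasurable (fun ω => S n ω - m 0 ω) μ :=
      (hSmem n).1.sub hmm.aestronglyMeasurable
    have hdN : AEStronglyMeasurable (fun ω => S N ω - m 0 ω) μ :=
      (hSmem N).1.sub hmm.aestronglyMeasurable
    have e1 : S n = ((fun ω => S n ω - m 0 ω) - (fun ω => S N ω - m 0 ω)) + S N := by
      ext ω; simp
    calc eLpNorm (S n) 2 μ ≤ eLpNorm ((fun ω => S n ω - m 0 ω) - (fun ω => S N ω - m 0 ω)) 2 μ +
          eLpNorm (S N) 2 μ := by
            conv_lhs => rw [e1]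
            exact eLpNorm_add_le (hdn.sub hdN) (hSmem N).1 one_le_two
      _ ≤ (eLpNorm (fun ω => S n ω - m 0 ω) 2 μ + eLpNorm (fun ω => S N ω - m 0 ω) 2 μ) +
          eLpNorm (S N) 2 μ := by
            gcongr
            exact eLpNorm_sub_le hdn hdN one_le_two
      _ ≤ (1 + 1) + eLpNorm (S N) 2 μ := by
            gcongr
            · exact hN n hn
            · exact hN N le_rfl
      _ = _ := by rw [add_comm]; norm_num
  set R : ℝ := (eLpNorm (S N) 2 μ + 2).toReal with hR
  have hfin : eLpNorm (S N) 2 μ + 2 ≠ ∞ := by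
    simp [(hSmem N).2.ne]
  have hsq : ∀ n ≥ N, ∫ ω, S n ω ^ 2 ∂μ ≤ R ^ 2 := by
    intro n hn
    have h1 := hbound n hn
    rw [← ENNReal.ofReal_toReal hfin, (hSmem n).eLpNorm_eq_integral_rpow_norm (by norm_num)
      (by norm_num), ENNReal.ofReal_le_ofReal_iff ENNReal.toReal_nonneg] at h1
    have hnn : 0 ≤ ∫ ω, S n ω ^ 2 ∂μ := integral_nonneg fun _ => sq_nonneg _
    simp only [ENNReal.toReal_ofNat, Real.rpow_ofNat, Real.norm_eq_abs, sq_abs] at h1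
    rw [Real.rpow_inv_le_iff_of_pos hnn ENNReal.toReal_nonneg (by norm_num)] at h1
    simpa using h1
  have hmain : ∀ n ≥ N, γ * ∑ j : Fin n, β j ^ 2 ≤ R ^ 2 := by
    intro n hn
    refine le_trans ?_ (hsq n hn)
    rw [integral_sum_sq_eq (x 0) hx β n]
    exact mul_sum_sq_le_covMatrix hcov 0 n fun j => β j
  refine ⟨√(R ^ 2 / γ), Real.sqrt_nonneg _, fun p => Real.sqrt_le_sqrt ?_⟩
  rw [le_div_iff₀ hγ, mul_comm]
  refine le_trans ?_ (hmain (max N p) (le_max_left _ _))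
  refine mul_le_mul_of_nonneg_left ?_ hγ.le
  unfold trunc
  rw [Fin.sum_univ_eq_sum_range (fun j => β j ^ 2), Fin.sum_univ_eq_sum_range (fun j => β j ^ 2)]
  exact Finset.sum_le_sum_of_subset_of_nonneg (Finset.range_mono (le_max_right _ _))
    fun j _ _ => sq_nonneg _

theorem sigmaSq_le {Ω : Type u} [MeasurableSpace Ω] {μ : Measure Ω} [IsProbabilityMeasure μ]
    {u : ℤ → Ω → ℝ} {R : ℝ} (hu2 : ∀ t, Integrable (fun ω => u t ω ^ 2) μ)
    (hR : ∀ t, ∫ ω, u t ω ^ 2 ∂μ ≤ R) {T : ℕ} (hT : 0 < T) : sigmaSq μ u T ≤ R := by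
  have hT0 : (0 : ℝ) < T := by exact_mod_cast hT
  unfold sigmaSq empNormSq empInner sample
  simp only [← sq]
  rw [integral_div, integral_finsetSum _ fun t _ => hu2 _, div_le_iff₀ hT0]
  calc _ ≤ ∑ _t : Fin T, R := Finset.sum_le_sum fun t _ => hR _
    _ = R * T := by simp [mul_comm]

/-- The sample second moment of the errors fluctuates at the rate `1 / √T`, by Chebyshev's
inequality and the finite long-run variance. -/
theorem isBigOP_empNormSq_sub_sigmaSq {Ω : Type u} [MeasurableSpace Ω] {μ : Measure Ω}
    [IsProbabilityMeasure μ] {u : ℤ → Ω → ℝ}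
    (h : HasFiniteLongRunVariance μ (fun t ω => u t ω ^ 2)) :
    IsBigOP μ (fun T ω => empNormSq (sample u T ω) - sigmaSq μ u T) (fun T => (√(T : ℝ))⁻¹) := by
  obtain ⟨hmem, V, hV⟩ := h
  intro ε hε
  have hV1 : ∀ᶠ T : ℕ in atTop, variance (fun ω => (√(T : ℝ))⁻¹ *
      ∑ t, sample (fun t ω => u t ω ^ 2) T ω t) μ ≤ |V| + 1 :=
    hV.eventually (ge_mem_nhds (by linarith [le_abs_self V]))
  set C := √((|V| + 1) / ε) with hC
  have hC0 : 0 < C := Real.sqrt_pos.2 (by positivity)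
  refine ⟨C, hC0, ?_⟩
  filter_upwards [hV1, eventually_gt_atTop 0] with T hT hT0
  have hT0' : (0 : ℝ) < T := by exact_mod_cast hT0
  have hsT : 0 < √(T : ℝ) := Real.sqrt_pos.2 hT0'
  set Z : Ω → ℝ := fun ω => (√(T : ℝ))⁻¹ * ∑ t, sample (fun t ω => u t ω ^ 2) T ω t with hZ
  have hZmem : MemLp Z 2 μ := (memLp_finsetSum _ fun t _ => hmem _).const_mul _
  have hZe : ∀ ω, empNormSq (sample u T ω) = (√(T : ℝ))⁻¹ * Z ω := by
    intro ω
    simp only [empNormSq, empInner, hZ, sample]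
    rw [← mul_assoc, ← mul_inv, Real.mul_self_sqrt hT0'.le, div_eq_inv_mul]
    simp only [sq]
  have hσ : sigmaSq μ u T = (√(T : ℝ))⁻¹ * ∫ ω, Z ω ∂μ := by
    unfold sigmaSq
    simp only [hZe]
    rw [integral_const_mul]
  have hch := meas_ge_le_variance_div_sq hZmem hC0
  have hsub : {ω | C * |(√(T : ℝ))⁻¹| < |empNormSq (sample u T ω) - sigmaSq μ u T|} ⊆
      {ω | C ≤ |Z ω - ∫ ω', Z ω' ∂μ|} := by
    intro ω hω
    simp only [Set.mem_ofPred_eq, hZe, hσ, ← mul_sub, abs_mul] at hω ⊢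
    rw [mul_comm] at hω
    exact (lt_of_mul_lt_mul_left hω (abs_nonneg _)).le
  refine (measure_mono hsub).trans (hch.trans (ENNReal.ofReal_le_ofReal ?_))
  rw [hC, Real.sq_sqrt (by positivity), div_le_iff₀ (by positivity)]
  refine hT.trans (le_of_eq ?_)
  field_simp

/-! ### Rates -/

theorem lambdaRate_pos {κ δ : ℝ} (hδ : 0 < δ) {p T : ℕ} (hp : 0 < p) (hT : 0 < T) :
    0 < lambdaRate κ δ p T := by
  have hp0 : (0 : ℝ) < p := by exact_mod_cast hp
  have hT0 : (0 : ℝ) < T := by exact_mod_cast hT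
  exact lt_max_of_lt_left (by positivity)

theorem one_le_log_eight_mul_div {δ : ℝ} (hδ : 0 < δ) (hδ1 : δ ≤ 1) {p : ℕ} (hp : 0 < p) :
    1 ≤ Real.log (8 * (p : ℝ) / δ) := by
  have hp1 : (1 : ℝ) ≤ p := by exact_mod_cast hp
  rw [Real.le_log_iff_exp_le (by positivity), le_div_iff₀ hδ]
  have := Real.exp_one_lt_d9
  nlinarith [Real.exp_pos 1]

theorem log_div_le_lambdaRate_sq {κ δ : ℝ} (hδ : 0 < δ) (hδ1 : δ ≤ 1) {p T : ℕ}
    (hp : 0 < p) : Real.log (8 * (p : ℝ) / δ) / T ≤ lambdaRate κ δ p T ^ 2 := by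
  have h1 : √(Real.log (8 * (p : ℝ) / δ) / T) ≤ lambdaRate κ δ p T := le_max_right _ _
  have h2 : 0 ≤ Real.log (8 * (p : ℝ) / δ) / T :=
    div_nonneg (by linarith [one_le_log_eight_mul_div hδ hδ1 hp]) (Nat.cast_nonneg _)
  calc _ = √(Real.log (8 * (p : ℝ) / δ) / T) ^ 2 := (Real.sq_sqrt h2).symm
    _ ≤ _ := by gcongr

theorem sqrt_le_mul_lambdaRate {κ δ : ℝ} (hδ : 0 < δ) (hδ1 : δ ≤ 1) {p T : ℕ}
    (hp : 0 < p) (hT : 0 < T) : √(T : ℝ) ≤ T * lambdaRate κ δ p T := by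
  have hT0 : (0 : ℝ) < T := by exact_mod_cast hT
  have h0 := lambdaRate_pos (κ := κ) hδ hp hT
  refine Real.sqrt_le_iff.2 ⟨by positivity, ?_⟩
  have h1 := log_div_le_lambdaRate_sq (κ := κ) (T := T) hδ hδ1 hp
  rw [div_le_iff₀ hT0] at h1
  have h2 := one_le_log_eight_mul_div hδ hδ1 hp
  rw [mul_pow, sq (T : ℝ)]
  nlinarith

/-- At a multiple `θ` of the rate `lambdaRate`, the Fuk–Nagaev tail is of order `1 / p`. -/
theorem mul_fukNagaev_tail_le {κ δ C₂ θ : ℝ} (hκ : 0 < κ) (hδ : 0 < δ) (hδ1 : δ ≤ 1) {p T : ℕ}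
    (hp : 0 < p) (hT : 0 < T) (hθ : 0 < θ) (hC₂ : 0 ≤ C₂) (hC : 1 ≤ C₂ * θ ^ 2) :
    p * (T * (θ * (T * lambdaRate κ δ p T)) ^ (-κ) +
      Real.exp (-(C₂ * ((θ * (T * lambdaRate κ δ p T)) ^ 2 / T)))) ≤
        θ ^ (-κ) + Real.exp (1 - C₂ * θ ^ 2) := by
  have hp0 : (0 : ℝ) < p := by exact_mod_cast hp
  have hT0 : (0 : ℝ) < T := by exact_mod_cast hT
  set ρ := lambdaRate κ δ p T with hρ
  have hρ0 : 0 < ρ := lambdaRate_pos hδ hp hT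
  rw [mul_add]
  refine add_le_add ?_ ?_
  · set w : ℝ := (p : ℝ) / (δ * (T : ℝ) ^ (κ - 1)) with hw
    have hw0 : 0 < w := by positivity
    have hρw : w ^ (1 / κ) ≤ ρ := le_max_left _ _
    have h1 : ρ ^ (-κ) ≤ w⁻¹ := by
      calc ρ ^ (-κ) ≤ (w ^ (1 / κ)) ^ (-κ) :=
            Real.rpow_le_rpow_of_nonpos (by positivity) hρw (by linarith)
        _ = w⁻¹ := by
            rw [← Real.rpow_mul hw0.le, ← Real.rpow_neg_one]
            congr 1
            field_simp
    calc p * (T * (θ * (T * ρ)) ^ (-κ)) = θ ^ (-κ) * (p * T * (T : ℝ) ^ (-κ) * ρ ^ (-κ)) := by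
          rw [Real.mul_rpow hθ.le (by positivity), Real.mul_rpow hT0.le hρ0.le]; ring
      _ ≤ θ ^ (-κ) * (p * T * (T : ℝ) ^ (-κ) * w⁻¹) := by gcongr
      _ = θ ^ (-κ) * (δ * ((T : ℝ) * (T : ℝ) ^ (-κ) * (T : ℝ) ^ (κ - 1))) := by
          rw [hw, inv_div]; field_simp
      _ = θ ^ (-κ) * δ := by
          rw [mul_assoc (T : ℝ), ← Real.rpow_add hT0]
          rw [show -κ + (κ - 1) = -1 by ring, Real.rpow_neg_one, mul_inv_cancel₀ hT0.ne', mul_one]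
      _ ≤ θ ^ (-κ) := mul_le_of_le_one_right (by positivity) hδ1
  · set l := Real.log (8 * (p : ℝ) / δ) with hl
    have hl1 : 1 ≤ l := one_le_log_eight_mul_div hδ hδ1 hp
    have hpl : (p : ℝ) ≤ Real.exp l := by
      rw [hl, Real.exp_log (by positivity), le_div_iff₀ hδ]
      nlinarith
    have h1 : θ ^ 2 * l ≤ (θ * (T * ρ)) ^ 2 / T := by
      have := log_div_le_lambdaRate_sq (κ := κ) (T := T) hδ hδ1 hp
      rw [div_le_iff₀ hT0] at this
      calc θ ^ 2 * l ≤ θ ^ 2 * (ρ ^ 2 * T) := by gcongr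
        _ = _ := by field_simp
    have h2 := mul_le_mul_of_nonneg_left h1 hC₂
    calc p * Real.exp (-(C₂ * ((θ * (T * ρ)) ^ 2 / T)))
        ≤ Real.exp l * Real.exp (-(C₂ * (θ ^ 2 * l))) := by gcongr
      _ = Real.exp (-((C₂ * θ ^ 2 - 1) * l)) := by rw [← Real.exp_add]; congr 1; ring
      _ ≤ Real.exp (1 - C₂ * θ ^ 2) := Real.exp_le_exp.2 (by nlinarith)

/-- For fixed `δ`, the rate `lambdaRate` times `s` is of at most the order of `varianceRate`. -/
theorem exists_mul_lambdaRate_le {κ δ : ℝ} (hκ : 0 < κ) (hδ : 0 < δ) (hδ1 : δ ≤ 1) :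
    ∃ D : ℝ, 0 < D ∧ ∀ (s : ℝ) (p T : ℕ), 0 ≤ s → 2 ≤ p → 0 < T →
      s * lambdaRate κ δ p T ≤ D * varianceRate κ s p T := by
  set b := Real.log (8 / δ) / Real.log 2 + 1 with hb
  have hlog2 : 0 < Real.log 2 := Real.log_pos (by norm_num)
  have h8 : 0 ≤ Real.log (8 / δ) := Real.log_nonneg (by rw [le_div_iff₀ hδ]; linarith)
  refine ⟨max (δ ^ (-(1 / κ))) √b, lt_max_of_lt_left (by positivity), ?_⟩
  intro s p T hs hp hT
  have hp0 : (0 : ℝ) < p := by exact_mod_cast (by omega : 0 < p)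
  have hp2 : (2 : ℝ) ≤ p := by exact_mod_cast hp
  have hT0 : (0 : ℝ) < T := by exact_mod_cast hT
  have hlogp : Real.log 2 ≤ Real.log p := Real.log_le_log (by norm_num) hp2
  have hr1 : s * (p : ℝ) ^ (1 / κ) / (T : ℝ) ^ (1 - 1 / κ) ≤ varianceRate κ s p T :=
    le_max_left _ _
  have hr2 : s * √(Real.log (p : ℝ) / (T : ℝ)) ≤ varianceRate κ s p T := le_max_right _ _
  have hr0 : 0 ≤ varianceRate κ s p T := le_trans (by positivity) hr1
  unfold lambdaRate
  rw [mul_max_of_nonneg _ _ hs]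
  refine max_le ?_ ?_
  · have e1 : ((p : ℝ) / (δ * (T : ℝ) ^ (κ - 1))) ^ (1 / κ) =
        δ ^ (-(1 / κ)) * ((p : ℝ) ^ (1 / κ) / (T : ℝ) ^ (1 - 1 / κ)) := by
      rw [Real.div_rpow hp0.le (by positivity), Real.mul_rpow hδ.le (by positivity),
        ← Real.rpow_mul hT0.le, Real.rpow_neg hδ.le,
        show (κ - 1) * (1 / κ) = 1 - 1 / κ by field_simp]
      field_simp
    rw [e1]
    calc s * (δ ^ (-(1 / κ)) * ((p : ℝ) ^ (1 / κ) / (T : ℝ) ^ (1 - 1 / κ)))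
        = δ ^ (-(1 / κ)) * (s * (p : ℝ) ^ (1 / κ) / (T : ℝ) ^ (1 - 1 / κ)) := by ring
      _ ≤ _ := mul_le_mul (le_max_left _ _) hr1 (by positivity) (le_max_of_le_left (by positivity))
  · have e1 : Real.log (8 * (p : ℝ) / δ) ≤ b * Real.log p := by
      have : Real.log (8 * (p : ℝ) / δ) = Real.log (8 / δ) + Real.log p := by
        rw [← Real.log_mul (by positivity) (by positivity)]; congr 1; ring
      rw [this, hb, add_mul, one_mul]
      have : Real.log (8 / δ) ≤ Real.log (8 / δ) / Real.log 2 * Real.log p := by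
        rw [div_mul_eq_mul_div, le_div_iff₀ hlog2]
        gcongr
      linarith
    have e2 : √(Real.log (8 * (p : ℝ) / δ) / T) ≤ √b * √(Real.log p / T) := by
      rw [← Real.sqrt_mul (by positivity), mul_div_assoc']
      gcongr
    calc s * √(Real.log (8 * (p : ℝ) / δ) / T) ≤ s * (√b * √(Real.log p / T)) := by gcongr
      _ = √b * (s * √(Real.log p / T)) := by ring
      _ ≤ _ := mul_le_mul (le_max_right _ _) hr2 (by positivity) (le_max_of_le_left (by positivity))

theorem inv_sqrt_le_varianceRate {κ s : ℝ} {p T : ℕ} (hs : 1 ≤ s) (hp : 2 ≤ p) :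
    (√(T : ℝ))⁻¹ ≤ (√(Real.log 2))⁻¹ * varianceRate κ s p T := by
  have hp2 : (2 : ℝ) ≤ p := by exact_mod_cast hp
  have hlog2 : 0 < Real.log 2 := Real.log_pos (by norm_num)
  have hlogp : Real.log 2 ≤ Real.log p := Real.log_le_log (by norm_num) hp2
  rw [inv_mul_eq_div, le_div_iff₀ (Real.sqrt_pos.2 hlog2)]
  calc (√(T : ℝ))⁻¹ * √(Real.log 2) = √(Real.log 2 / T) := by
        rw [Real.sqrt_div hlog2.le]; ring
    _ ≤ √(Real.log p / T) := by gcongr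
    _ ≤ s * √(Real.log p / T) := le_mul_of_one_le_left (Real.sqrt_nonneg _) hs
    _ ≤ _ := le_max_right _ _

theorem sq_mul_log_div_le {κ s e : ℝ} {p T : ℕ} (hs : 1 ≤ s) (he : 0 ≤ e)
    (hp : 2 ≤ p) (h : varianceRate κ s p T ≤ √e) :
    s ^ 2 * (Real.log p / T) ≤ e := by
  have hp2 : (2 : ℝ) ≤ p := by exact_mod_cast hp
  have hlog : 0 ≤ Real.log p / T :=
    div_nonneg (Real.log_nonneg (by linarith)) (Nat.cast_nonneg _)
  have h1 : s * √(Real.log p / T) ≤ √e := (le_max_right _ _).trans h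
  have h2 := mul_self_le_mul_self (by positivity) h1
  rw [Real.mul_self_sqrt he, mul_mul_mul_comm, Real.mul_self_sqrt hlog, ← sq] at h2
  exact h2

theorem eventually_mul_sq_le {κ : ℝ} {s : ℕ → ℝ} {p : ℕ → ℕ} (hs : ∀ᶠ T in atTop, 1 ≤ s T)
    (hp : ∀ᶠ T in atTop, 2 ≤ p T)
    (hrate : Tendsto (fun T => varianceRate κ (s T) (p T) T) atTop (𝓝 0)) {R : ℝ} (hR : 0 < R) :
    ∀ᶠ T : ℕ in atTop, R * s T ^ 2 ≤ T := by
  have hlog2 : 0 < Real.log 2 := Real.log_pos (by norm_num)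
  have he : 0 < √(Real.log 2 / R) := Real.sqrt_pos.2 (by positivity)
  filter_upwards [hs, hp, hrate.eventually (ge_mem_nhds he), eventually_gt_atTop 0]
    with T hs1 hp2 hr hT
  have hT0 : (0 : ℝ) < T := by exact_mod_cast hT
  have h := sq_mul_log_div_le hs1 (by positivity) hp2 hr
  have hp2' : (2 : ℝ) ≤ p T := by exact_mod_cast hp2
  have hlogp : Real.log 2 ≤ Real.log (p T) := Real.log_le_log (by norm_num) hp2'
  rw [le_div_iff₀ hR, mul_div_assoc', div_mul_eq_mul_div, div_le_iff₀ hT0] at h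
  have h2 : R * s T ^ 2 * Real.log 2 ≤ T * Real.log 2 := by
    calc R * s T ^ 2 * Real.log 2 ≤ R * s T ^ 2 * Real.log (p T) := by gcongr
      _ ≤ _ := by linarith
  exact le_of_mul_le_mul_right h2 hlog2

/-- The exponential growth condition holds for every positive constant: the rate tending to zero
means that `log p` is negligible against `T / s ^ 2`. -/
theorem tendsto_sq_mul_exp_neg {κ C : ℝ} (hC : 0 < C) {s : ℕ → ℝ} {p : ℕ → ℕ}
    (hs : ∀ᶠ T in atTop, 1 ≤ s T) (hp : ∀ᶠ T in atTop, 2 ≤ p T)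
    (hrate : Tendsto (fun T => varianceRate κ (s T) (p T) T) atTop (𝓝 0)) :
    Tendsto (fun T : ℕ => (p T : ℝ) ^ 2 * Real.exp (-(C * (T / s T ^ 2)))) atTop (𝓝 0) := by
  have hinf : Tendsto (fun T : ℕ => (T : ℝ) / s T ^ 2) atTop atTop := by
    refine tendsto_atTop.2 fun R => ?_
    filter_upwards [eventually_mul_sq_le hs hp hrate (lt_max_of_lt_right one_pos : 0 < max R 1), hs]
      with T h1 h2
    rw [le_div_iff₀ (by positivity)]
    exact (mul_le_mul_of_nonneg_right (le_max_left _ _) (sq_nonneg _)).trans h1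
  have hexp : Tendsto (fun T : ℕ => Real.exp (-(C / 2 * (T / s T ^ 2)))) atTop (𝓝 0) :=
    Real.tendsto_exp_neg_atTop_nhds_zero.comp (hinf.const_mul_atTop (by positivity))
  have he : 0 < √(C / 4) := Real.sqrt_pos.2 (by positivity)
  refine squeeze_zero' (Eventually.of_forall fun T => by positivity) ?_ hexp
  filter_upwards [hs, hp, hrate.eventually (ge_mem_nhds he), eventually_gt_atTop 0]
    with T hs1 hp2 hr hT
  have hT0 : (0 : ℝ) < T := by exact_mod_cast hT
  have hp0 : (0 : ℝ) < p T := by exact_mod_cast (by omega : 0 < p T)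
  have h := sq_mul_log_div_le hs1 (by positivity) hp2 hr
  have hlog : 2 * Real.log (p T) ≤ C / 2 * (T / s T ^ 2) := by
    rw [mul_div_assoc', div_le_iff₀ hT0] at h
    rw [mul_div_assoc', le_div_iff₀ (by positivity)]
    linarith
  have hpe : (p T : ℝ) ^ 2 = Real.exp (2 * Real.log (p T)) := by
    rw [two_mul, Real.exp_add, Real.exp_log hp0, sq]
  rw [hpe, ← Real.exp_add]
  refine Real.exp_le_exp.2 ?_
  linarith

/-! ### Exceptional events -/

/-- Markov's inequality for the number of exceedances. -/
theorem measure_lt_card_filter_le {Ω : Type u} [MeasurableSpace Ω] (μ : Measure Ω)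
    [IsProbabilityMeasure μ] {ι : Type*} [Fintype ι] (Z : ι → Ω → ℝ) (hZ : ∀ j, Measurable (Z j))
    {y K N : ℝ} (hN : 0 < N) (hK : ∑ j, μ.real {ω | y ≤ Z j ω} ≤ K) :
    μ {ω | N < ((Finset.univ.filter fun j => y ≤ Z j ω).card : ℝ)} ≤ ENNReal.ofReal (K / N) := by
  have hms : ∀ j, MeasurableSet {ω | y ≤ Z j ω} := fun j => measurableSet_le measurable_const (hZ j)
  set f : Ω → ℝ := fun ω => ∑ j, {ω | y ≤ Z j ω}.indicator (fun _ => (1 : ℝ)) ω with hf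
  have hfi : ∀ j, Integrable ({ω | y ≤ Z j ω}.indicator (fun _ => (1 : ℝ))) μ :=
    fun j => (integrable_const _).indicator (hms j)
  have hcard : ∀ ω, ((Finset.univ.filter fun j => y ≤ Z j ω).card : ℝ) = f ω := by
    intro ω
    rw [Finset.card_filter]
    push_cast
    refine Finset.sum_congr rfl fun j _ => ?_
    simp [Set.indicator_apply]
  have hint : ∫ ω, f ω ∂μ ≤ K := by
    rw [hf, integral_finsetSum _ fun j _ => hfi j]
    refine le_trans (le_of_eq (Finset.sum_congr rfl fun j _ => ?_)) hK
    rw [integral_indicator (hms j)]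
    simp
  have hmk := mul_meas_ge_le_integral_of_nonneg (μ := μ) (f := f)
    (ae_of_all _ fun ω => Finset.sum_nonneg fun j _ =>
      Set.indicator_nonneg (fun _ _ => zero_le_one) _)
    (integrable_finsetSum _ fun j _ => hfi j) N
  rw [← ofReal_measureReal (measure_ne_top μ _)]
  refine ENNReal.ofReal_le_ofReal ?_
  rw [le_div_iff₀ hN, mul_comm]
  refine le_trans (mul_le_mul_of_nonneg_left (measureReal_mono ?_) hN.le) (hmk.trans hint)
  intro ω hω
  simp only [Set.mem_ofPred_eq, hcard] at hω ⊢
  exact hω.le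

theorem measure_exists_le {Ω : Type u} [MeasurableSpace Ω] (μ : Measure Ω)
    [IsProbabilityMeasure μ] {ι : Type*} [Fintype ι] (Z : ι → Ω → ℝ) {y K : ℝ}
    (hK : ∑ j, μ.real {ω | y ≤ Z j ω} ≤ K) :
    μ {ω | ∃ j, y ≤ Z j ω} ≤ ENNReal.ofReal K := by
  have : {ω | ∃ j, y ≤ Z j ω} = ⋃ j, {ω | y ≤ Z j ω} := by ext; simp
  rw [this, ← ofReal_measureReal (measure_ne_top μ _)]
  exact ENNReal.ofReal_le_ofReal ((measureReal_iUnion_fintype_le _).trans hK)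

theorem IsBigOP.tendstoInMeasure {Ω : Type u} [MeasurableSpace Ω] {μ : Measure Ω}
    {Z : ℕ → Ω → ℝ} {r : ℕ → ℝ} (h : IsBigOP μ Z r) (hr : Tendsto r atTop (𝓝 0)) :
    TendstoInMeasure μ Z atTop (fun _ => 0) := by
  rw [tendstoInMeasure_iff_norm]
  intro η hη
  rw [ENNReal.tendsto_nhds_zero]
  intro ε hε
  obtain ⟨e, he0, hee⟩ : ∃ e : ℝ, 0 < e ∧ ENNReal.ofReal e ≤ ε := by
    rcases eq_or_ne ε ∞ with rfl | hne
    · exact ⟨1, one_pos, le_top⟩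
    · exact ⟨ε.toReal, ENNReal.toReal_pos hε.ne' hne, ENNReal.ofReal_toReal_le⟩
  obtain ⟨C, hC, hev⟩ := h e he0
  have hCr : Tendsto (fun T => C * |r T|) atTop (𝓝 0) := by
    simpa using (hr.abs).const_mul C
  filter_upwards [hev, hCr.eventually (gt_mem_nhds hη)] with T h1 h2
  refine (measure_mono ?_).trans (h1.trans hee)
  intro ω hω
  simp only [Set.mem_ofPred_eq, sub_zero, Real.norm_eq_abs] at hω ⊢
  linarith

/-- The expected number of covariates whose correlation with the errors exceeds a multiple `θ` of
the rate is bounded, and small when `θ` is large. -/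
theorem eventually_sum_measureReal_noise_le {Ω : Type u} [MeasurableSpace Ω] {μ : Measure Ω}
    {κ δ C₁ C₂ : ℝ} (hκ : 0 < κ) (hδ : 0 < δ) (hδ1 : δ ≤ 1) (hC₁ : 0 < C₁) (hC₂ : 0 < C₂)
    {w : ℕ → ℤ → Ω → ℝ}
    (hFN : ∀ (j T : ℕ) (x : ℝ), 1 ≤ x → x ≤ T →
      μ.real {ω | 4 * x ≤ |∑ t ∈ Finset.range T, centered μ (w j) ((t : ℤ) + 1) ω|} ≤
        C₁ * (T * x ^ (-κ) + Real.exp (-(C₂ * (x ^ 2 / T)))))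
    {p : ℕ → ℕ} (hp : ∀ᶠ T in atTop, 2 ≤ p T)
    (hρ : Tendsto (fun T => lambdaRate κ δ (p T) T) atTop (𝓝 0)) {θ : ℝ} (hθ : 0 < θ)
    (hC : 1 ≤ C₂ * θ ^ 2) :
    ∀ᶠ T in atTop, ∑ j : Fin (p T), μ.real {ω | 4 * (θ * (T * lambdaRate κ δ (p T) T)) ≤
      |∑ t ∈ Finset.range T, centered μ (w j) ((t : ℤ) + 1) ω|} ≤
        C₁ * (θ ^ (-κ) + Real.exp (1 - C₂ * θ ^ 2)) := by
  have hθρ : Tendsto (fun T => θ * lambdaRate κ δ (p T) T) atTop (𝓝 0) := by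
    simpa using hρ.const_mul θ
  have hsq : Tendsto (fun T : ℕ => θ * √(T : ℝ)) atTop atTop :=
    (Real.tendsto_sqrt_atTop.comp tendsto_natCast_atTop_atTop).const_mul_atTop hθ
  filter_upwards [hp, hθρ.eventually (ge_mem_nhds one_pos), hsq.eventually_ge_atTop 1,
    eventually_gt_atTop 0] with T hp2 h1 h2 hT
  have hT0 : (0 : ℝ) < T := by exact_mod_cast hT
  have hx1 : 1 ≤ θ * (T * lambdaRate κ δ (p T) T) :=
    h2.trans (mul_le_mul_of_nonneg_left
      (sqrt_le_mul_lambdaRate hδ hδ1 (by omega) hT) hθ.le)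
  have hxT : θ * (T * lambdaRate κ δ (p T) T) ≤ T := by
    have := mul_le_mul_of_nonneg_left h1 hT0.le
    linarith
  calc _ ≤ ∑ _j : Fin (p T), C₁ * (T * (θ * (T * lambdaRate κ δ (p T) T)) ^ (-κ) +
        Real.exp (-(C₂ * ((θ * (T * lambdaRate κ δ (p T) T)) ^ 2 / T)))) :=
        Finset.sum_le_sum fun j _ => hFN j T _ hx1 hxT
    _ = C₁ * (p T * (T * (θ * (T * lambdaRate κ δ (p T) T)) ^ (-κ) +
        Real.exp (-(C₂ * ((θ * (T * lambdaRate κ δ (p T) T)) ^ 2 / T))))) := by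
        rw [Finset.sum_const, Finset.card_univ, Fintype.card_fin, nsmul_eq_mul]; ring
    _ ≤ _ := mul_le_mul_of_nonneg_left
        (mul_fukNagaev_tail_le hκ hδ hδ1 (by omega) hT hθ hC₂.le hC) hC₁.le

/-- The sample covariances are uniformly within `c / s` of their means, for every fixed `c > 0`. -/
theorem eventually_measure_covariance_le {Ω : Type u} [MeasurableSpace Ω] {μ : Measure Ω}
    [IsProbabilityMeasure μ] {κ ν C₁ C₂ : ℝ} (hC₂ : 0 < C₂)
    {w : ℕ → ℕ → ℤ → Ω → ℝ}
    (hFN : ∀ (j l T : ℕ) (x : ℝ), 1 ≤ x → x ≤ T →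
      μ.real {ω | 4 * x ≤ |∑ t ∈ Finset.range T, centered μ (w j l) ((t : ℤ) + 1) ω|} ≤
        C₁ * (T * x ^ (-ν) + Real.exp (-(C₂ * (x ^ 2 / T)))))
    {s : ℕ → ℝ} {p : ℕ → ℕ} (hs : ∀ᶠ T in atTop, 1 ≤ s T) (hp : ∀ᶠ T in atTop, 2 ≤ p T)
    (hrate : Tendsto (fun T => varianceRate κ (s T) (p T) T) atTop (𝓝 0))
    (hpoly : Tendsto (fun T : ℕ => s T ^ ν * (p T : ℝ) ^ 2 * (T : ℝ) ^ (1 - ν)) atTop (𝓝 0))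
    {c ε : ℝ} (hc : 0 < c) (hc4 : c ≤ 4) (hε : 0 < ε) :
    ∀ᶠ T in atTop, μ {ω | ∃ jl : Fin (p T) × Fin (p T), T * (c / s T) ≤
      |∑ t ∈ Finset.range T, centered μ (w jl.1 jl.2) ((t : ℤ) + 1) ω|} ≤ ENNReal.ofReal ε := by
  have hlim : Tendsto (fun T : ℕ => C₁ * ((c / 4) ^ (-ν) *
      (s T ^ ν * (p T : ℝ) ^ 2 * (T : ℝ) ^ (1 - ν)) +
      (p T : ℝ) ^ 2 * Real.exp (-(C₂ * (c / 4) ^ 2 * (T / s T ^ 2))))) atTop (𝓝 0) := by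
    have := ((hpoly.const_mul ((c / 4) ^ (-ν))).add (tendsto_sq_mul_exp_neg
      (by positivity : 0 < C₂ * (c / 4) ^ 2) hs hp hrate)).const_mul C₁
    simpa using this
  filter_upwards [hs, hlim.eventually (ge_mem_nhds hε), eventually_gt_atTop 0,
    eventually_mul_sq_le hs hp hrate (by positivity : 0 < 4 / c)] with T hs1 hle hT hsT
  have hT0 : (0 : ℝ) < T := by exact_mod_cast hT
  have hs0 : 0 < s T := by linarith
  set x := c / 4 * (T / s T) with hx
  have hx1 : 1 ≤ x := by
    rw [hx, mul_div_assoc', le_div_iff₀ hs0, one_mul]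
    have e1 : s T ≤ s T ^ 2 := by nlinarith
    have e2 : 4 / c * s T ≤ T := (mul_le_mul_of_nonneg_left e1 (by positivity)).trans hsT
    rw [div_mul_eq_mul_div, div_le_iff₀ hc] at e2
    linarith
  have hxT : x ≤ T := by
    rw [hx]
    have e1 : (T : ℝ) / s T ≤ T := div_le_self hT0.le hs1
    have e2 : 0 ≤ (T : ℝ) / s T := by positivity
    nlinarith
  have h4x : T * (c / s T) = 4 * x := by rw [hx]; field_simp
  rw [h4x]
  refine measure_exists_le μ (fun (jl : Fin (p T) × Fin (p T)) ω =>
    |∑ t ∈ Finset.range T, centered μ (w jl.1 jl.2) ((t : ℤ) + 1) ω|) ?_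
  refine le_trans ?_ hle
  calc _ ≤ ∑ _jl : Fin (p T) × Fin (p T), C₁ * (T * x ^ (-ν) +
        Real.exp (-(C₂ * (x ^ 2 / T)))) := Finset.sum_le_sum fun jl _ => hFN _ _ T x hx1 hxT
    _ = C₁ * ((p T : ℝ) ^ 2 * (T * x ^ (-ν)) +
          (p T : ℝ) ^ 2 * Real.exp (-(C₂ * (x ^ 2 / T)))) := by
        rw [Finset.sum_const, Finset.card_univ, Fintype.card_prod, Fintype.card_fin, nsmul_eq_mul]
        push_cast
        ring
    _ = _ := by
        have e1 : x ^ 2 / T = (c / 4) ^ 2 * (T / s T ^ 2) := by rw [hx]; field_simp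
        have e2 : T * x ^ (-ν) = (c / 4) ^ (-ν) * (s T ^ ν * (T : ℝ) ^ (1 - ν)) := by
          rw [hx, Real.mul_rpow (by positivity) (by positivity),
            Real.div_rpow hT0.le hs0.le, Real.rpow_neg hs0.le, div_inv_eq_mul,
            sub_eq_add_neg, Real.rpow_add hT0, Real.rpow_one]
          ring
        rw [e1, e2]
        congr 2
        · ring
        · rw [mul_assoc]

theorem empInner_sample_design {Ω : Type u} (u : ℤ → Ω → ℝ) (x : ℤ → ℕ → Ω → ℝ) (T p : ℕ) (ω : Ω)
    (j : Fin p) : empInner (sample u T ω) (fun t => design x T p ω t j) =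
      (∑ t ∈ Finset.range T, u ((t : ℤ) + 1) ω * x ((t : ℤ) + 1) j ω) / T := by
  unfold empInner sample design
  rw [← Fin.sum_univ_eq_sum_range (fun t => u ((t : ℤ) + 1) ω * x ((t : ℤ) + 1) j ω) T]
  rfl

theorem memLp_two_of_eLpNorm_le {Ω : Type u} [MeasurableSpace Ω] {μ : Measure Ω}
    [IsProbabilityMeasure μ] {f : Ω → ℝ} {q K : ℝ} (hq : 2 ≤ q) (hf : Measurable f)
    (h : eLpNorm f (ENNReal.ofReal q) μ ≤ ENNReal.ofReal K) :
    MemLp f 2 μ ∧ ∫ ω, f ω ^ 2 ∂μ ≤ (max K 0) ^ 2 := by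
  have h2q : (2 : ℝ≥0∞) ≤ ENNReal.ofReal q := by
    rw [show (2 : ℝ≥0∞) = ENNReal.ofReal 2 by simp]
    exact ENNReal.ofReal_le_ofReal hq
  have h1 : eLpNorm f 2 μ ≤ ENNReal.ofReal (max K 0) :=
    (eLpNorm_le_eLpNorm_of_exponent_le h2q hf.aestronglyMeasurable).trans
      (h.trans (ENNReal.ofReal_le_ofReal (le_max_left _ _)))
  have hmem : MemLp f 2 μ := ⟨hf.aestronglyMeasurable, h1.trans_lt ENNReal.ofReal_lt_top⟩
  refine ⟨hmem, ?_⟩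
  rw [hmem.eLpNorm_eq_integral_rpow_norm (by norm_num) (by norm_num),
    ENNReal.ofReal_le_ofReal_iff (le_max_right _ _)] at h1
  have hnn : 0 ≤ ∫ ω, f ω ^ 2 ∂μ := integral_nonneg fun _ => sq_nonneg _
  simp only [ENNReal.toReal_ofNat, Real.rpow_ofNat, Real.norm_eq_abs, sq_abs] at h1
  rw [Real.rpow_inv_le_iff_of_pos hnn (le_max_right _ _) (by norm_num)] at h1
  simpa using h1

/-! ### Convergence of the variance estimator -/

/-- The variance estimator is within `O_P` of the rate, given the tail bounds for the correlations
`u x_j` and the products `x_j x_l`. -/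
theorem isBigOP_sigmaHatSq_sub {Ω : Type u} [MeasurableSpace Ω] {μ : Measure Ω}
    [IsProbabilityMeasure μ] {q r a b c K G κ ν C₁ C₂ C₃ C₄ C₀ : ℝ} (hq : 2 ≤ q) (hr : 2 ≤ r)
    (hκ : 0 < κ) (hC₁ : 0 < C₁) (hC₂ : 0 < C₂) (hC₄ : 0 < C₄) (hG : 1 ≤ G) (hC₀ : 0 < C₀)
    (hC₀C₂ : 1 ≤ C₂ * (C₀ / (8 * √G)) ^ 2)
    {y m u : ℤ → Ω → ℝ} {x : ℤ → ℕ → Ω → ℝ} {β : ℕ → ℝ} {γ α δ : ℝ}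
    {p : ℕ → ℕ} {P : ∀ T, Groups (p T)} {s lam : ℕ → ℝ} {βhat : ∀ T, Ω → Fin (p T) → ℝ}
    (hFNu : ∀ (j T : ℕ) (z : ℝ), 1 ≤ z → z ≤ T →
      μ.real {ω | 4 * z ≤ |∑ t ∈ Finset.range T,
        centered μ (fun t ω => u t ω * x t j ω) ((t : ℤ) + 1) ω|} ≤
        C₁ * (T * z ^ (-κ) + Real.exp (-(C₂ * (z ^ 2 / T)))))
    (hFNx : ∀ (j l T : ℕ) (z : ℝ), 1 ≤ z → z ≤ T →
      μ.real {ω | 4 * z ≤ |∑ t ∈ Finset.range T,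
        centered μ (fun t ω => x t j ω * x t l ω) ((t : ℤ) + 1) ω|} ≤
        C₃ * (T * z ^ (-ν) + Real.exp (-(C₄ * (z ^ 2 / T)))))
    (hlin : LinearProjection μ y m u x β) (hdata : DataAssumption μ u x q r a b c K)
    (hγ : 0 < γ) (hcov : CovarianceAssumption μ x γ) (hα0 : 0 ≤ α) (hα1 : α ≤ 1)
    (hgr : ∀ᶠ T in atTop, ∀ S ∈ (P T).parts, (S.card : ℝ) ≤ G)
    (hs : ∀ T, s T = effSparsity α (P T) (trunc β (p T)))
    (hp : ∀ᶠ T in atTop, 2 ≤ p T) (hβ : ∀ᶠ T in atTop, trunc β (p T) ≠ 0)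
    (hδ : 0 < δ) (hδ1 : δ < 1) (hreg : RegularizationAssumption κ δ C₀ p lam)
    (hrt : RateAssumption μ m x β ν p s lam)
    (hlrv : HasFiniteLongRunVariance μ (fun t ω => u t ω ^ 2))
    (hlasso : ∀ T, ∀ᵐ ω ∂μ, IsSgLasso (sample y T ω) (design x T (p T) ω) (lam T) α (P T)
      (βhat T ω))
    (hrate : Tendsto (fun T => varianceRate κ (s T) (p T) T) atTop (𝓝 0)) :
    IsBigOP μ (fun T ω => sigmaHatSq (sample y T ω) (design x T (p T) ω) (lam T) α (P T)
      (βhat T ω) - sigmaSq μ u T) (fun T => varianceRate κ (s T) (p T) T) := by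
  have hsG : 1 ≤ √G := Real.one_le_sqrt.2 hG
  have hs1 : ∀ᶠ T in atTop, 1 ≤ s T := by
    filter_upwards [hβ] with T hT
    rw [hs]
    exact one_le_effSparsity hα0 hα1 _ hT
  obtain ⟨L₁, hL⟩ := hreg
  obtain ⟨D, hD0, hD⟩ := exists_mul_lambdaRate_le hκ hδ hδ1.le
  have hρ : Tendsto (fun T => lambdaRate κ δ (p T) T) atTop (𝓝 0) := by
    have h1 : Tendsto (fun T => D * varianceRate κ (s T) (p T) T) atTop (𝓝 0) := by
      simpa using hrate.const_mul D
    refine squeeze_zero' ?_ ?_ h1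
    · filter_upwards [hp, eventually_gt_atTop 0] with T hp2 hT
      exact (lambdaRate_pos hδ (by omega) hT).le
    · filter_upwards [hp, hs1, eventually_gt_atTop 0] with T hp2 hs1 hT
      exact (le_mul_of_one_le_left (lambdaRate_pos hδ (by omega) hT).le hs1).trans
        (hD _ _ _ (by linarith) hp2 hT)
  obtain ⟨b₀, hb₀, hβb⟩ := exists_sqrt_sum_sq_le hγ hcov
    (fun j => (memLp_two_of_eLpNorm_le hr (hlin.measurable_x 0 j) (hdata.moment_x 0 j)).1)
    (hlin.measurable_m 0) (hlin.series 0)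
  have hu := fun t => memLp_two_of_eLpNorm_le hq (hlin.measurable_u t) (hdata.moment_u t)
  set w : ℕ → ℤ → Ω → ℝ := fun j t ω => u t ω * x t j ω with hw
  have hcent : ∀ j t ω, centered μ (w j) t ω = u t ω * x t j ω := by
    intro j t ω
    simp only [centered, hw, hlin.orthogonal t j, sub_zero]
  set W : ℕ → ℕ → Ω → ℝ := fun T j ω =>
    |∑ t ∈ Finset.range T, centered μ (w j) ((t : ℤ) + 1) ω| with hW
  have hWm : ∀ T j, Measurable (W T j) := by
    intro T j
    refine Measurable.abs (Finset.measurable_sum _ fun t _ => ?_)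
    exact ((hlin.measurable_u _).mul (hlin.measurable_x _ j)).sub_const _
  have hWe : ∀ (T : ℕ) (ω : Ω) (j : Fin (p T)), 0 < T →
      |empInner (sample u T ω) (fun t => design x T (p T) ω t j)| = W T j ω / T := by
    intro T ω j hT
    have hT0 : (0 : ℝ) < T := by exact_mod_cast hT
    rw [empInner_sample_design, abs_div, abs_of_pos hT0]
    simp only [hW, hcent]
  intro ε hε
  set ε' := ε / 5 with hε'
  have hε'0 : 0 < ε' := by positivity
  -- The misspecification error and the fluctuation of the errors.
  obtain ⟨M₁, hM₁, hE1⟩ := hrt.misspecification ε' hε'0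
  obtain ⟨M₃, hM₃, hE2⟩ := isBigOP_empNormSq_sub_sigmaSq hlrv ε' hε'0
  -- The expected number of exceptional covariates is bounded.
  set θ₀ := C₀ / (8 * √G) with hθ₀
  have hθ₀0 : 0 < θ₀ := by positivity
  set K₀ := C₁ * (θ₀ ^ (-κ) + Real.exp (1 - C₂ * θ₀ ^ 2)) with hK₀
  have hK₀0 : 0 < K₀ := by positivity
  set N := K₀ / ε' with hN
  have hN0 : 0 < N := by positivity
  have hE3 := eventually_sum_measureReal_noise_le hκ hδ hδ1.le hC₁ hC₂ hFNu hp hρ hθ₀0 hC₀C₂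
  -- A threshold `θ` which no correlation exceeds, up to probability `ε'`.
  obtain ⟨θ, hθ1, hθ0, hθε⟩ : ∃ θ : ℝ, 1 ≤ C₂ * θ ^ 2 ∧ 0 < θ ∧
      C₁ * (θ ^ (-κ) + Real.exp (1 - C₂ * θ ^ 2)) ≤ ε' := by
    have h2 : Tendsto (fun θ : ℝ => C₂ * θ ^ 2) atTop atTop :=
      (tendsto_pow_atTop two_ne_zero).const_mul_atTop hC₂
    have h3 : Tendsto (fun θ : ℝ => Real.exp (1 - C₂ * θ ^ 2)) atTop (𝓝 0) := by
      refine Real.tendsto_exp_atBot.comp ?_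
      simpa only [sub_eq_add_neg, Function.comp_def] using
        tendsto_atBot_add_const_left _ (1 : ℝ) (tendsto_neg_atTop_atBot.comp h2)
    have h4 : Tendsto (fun θ : ℝ => C₁ * (θ ^ (-κ) + Real.exp (1 - C₂ * θ ^ 2))) atTop (𝓝 0) := by
      simpa using ((tendsto_rpow_neg_atTop hκ).add h3).const_mul C₁
    exact ((h2.eventually_ge_atTop 1).and ((eventually_gt_atTop 0).and
      (h4.eventually (ge_mem_nhds hε'0)))).exists
  have hE4 := eventually_sum_measureReal_noise_le hκ hδ hδ1.le hC₁ hC₂ hFNu hp hρ hθ0 hθ1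
  set M := 4 * θ / C₀ with hM
  have hM0 : 0 < M := by positivity
  set M₂ := (max K 0) ^ 2 + M₃ with hM₂
  have hM₂0 : 0 ≤ M₂ := by positivity
  obtain ⟨c₁, D₁, hc₁, hD₁, hdet⟩ := exists_abs_sigmaHatSq_sub_le (N := N) hγ hG hb₀ hM₁.le hM₂0
    hM0.le
  -- The entries of the sample covariance matrix.
  set c₂ := min c₁ 4 with hc₂
  have hc₂0 : 0 < c₂ := lt_min hc₁ (by norm_num)
  have hE5 := eventually_measure_covariance_le hC₄ hFNx hs1 hp hrate hrt.polynomial hc₂0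
    (min_le_right _ _) hε'0
  have hslim : Tendsto (fun T => |L₁| * (D * varianceRate κ (s T) (p T) T)) atTop (𝓝 0) := by
    simpa using (hrate.const_mul D).const_mul |L₁|
  set Cfin := D₁ * (|L₁| * D) + M₃ * (√(Real.log 2))⁻¹ + 1 with hCfin
  refine ⟨Cfin, by positivity, ?_⟩
  filter_upwards [hE1, hE2, hE3, hE4, hE5, hL, hs1, hp, hgr,
    hslim.eventually (ge_mem_nhds one_pos), eventually_gt_atTop 0]
    with T hE1 hE2 hE3 hE4 hE5 hL hs1 hp2 hgr hsl1 hT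
  have hT0 : (0 : ℝ) < T := by exact_mod_cast hT
  set ρ := lambdaRate κ δ (p T) T with hρdef
  have hρ0 : 0 < ρ := lambdaRate_pos hδ (by omega) hT
  have hl0 : 0 < lam T := lt_of_lt_of_le (by positivity) hL.1
  have hs0 : 0 < s T := by linarith
  have hslr : s T * lam T ≤ |L₁| * (D * varianceRate κ (s T) (p T) T) := by
    calc s T * lam T ≤ s T * (|L₁| * ρ) := by
          refine mul_le_mul_of_nonneg_left (hL.2.trans ?_) hs0.le
          exact mul_le_mul_of_nonneg_right (le_abs_self _) hρ0.le
      _ = |L₁| * (s T * ρ) := by ring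
      _ ≤ _ := mul_le_mul_of_nonneg_left (hD _ _ _ hs0.le hp2 hT) (abs_nonneg _)
  have hP3 := measure_lt_card_filter_le μ (fun j : Fin (p T) => W T j) (fun j => hWm T j) hN0 hE3
  have hP4 := measure_exists_le μ (fun j : Fin (p T) => W T j) (hE4.trans hθε)
  rw [show K₀ / N = ε' by rw [hN]; field_simp] at hP3
  have hnull : μ {ω | ¬ IsSgLasso (sample y T ω) (design x T (p T) ω) (lam T) α (P T)
      (βhat T ω)} = 0 := ae_iff.1 (hlasso T)
  set A1 := {ω | M₁ * |s T * lam T ^ 2| <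
    |empNormSq (sample m T ω - (design x T (p T) ω).mulVec (trunc β (p T)))|}
  set A2 := {ω | M₃ * |(√(T : ℝ))⁻¹| < |empNormSq (sample u T ω) - sigmaSq μ u T|}
  set A3 := {ω | N < ((Finset.univ.filter fun j : Fin (p T) =>
    4 * (θ₀ * (T * ρ)) ≤ W T j ω).card : ℝ)}
  set A4 := {ω | ∃ j : Fin (p T), 4 * (θ * (T * ρ)) ≤ W T j ω}
  set A5 := {ω | ∃ jl : Fin (p T) × Fin (p T), T * (c₂ / s T) ≤ |∑ t ∈ Finset.range T,
    centered μ (fun t ω => x t jl.1 ω * x t jl.2 ω) ((t : ℤ) + 1) ω|}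
  set A6 := {ω | ¬ IsSgLasso (sample y T ω) (design x T (p T) ω) (lam T) α (P T) (βhat T ω)}
  have hsub : {ω | Cfin * |varianceRate κ (s T) (p T) T| <
      |sigmaHatSq (sample y T ω) (design x T (p T) ω) (lam T) α (P T) (βhat T ω) -
        sigmaSq μ u T|} ⊆ ((((A1 ∪ A2) ∪ A3) ∪ A4) ∪ A5) ∪ A6 := by
    intro ω hω
    by_contra hcon
    simp only [Set.mem_union, not_or] at hcon
    obtain ⟨⟨⟨⟨⟨n1, n2⟩, n3⟩, n4⟩, n5⟩, n6⟩ := hcon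
    simp only [A1, A2, A3, A4, A5, A6, Set.mem_ofPred_eq, not_lt, not_exists, not_le, not_not]
      at n1 n2 n3 n4 n5 n6
    rw [abs_of_nonneg (empNormSq_nonneg _), abs_of_nonneg (by positivity)] at n1
    rw [abs_of_nonneg (a := (√(T : ℝ))⁻¹) (by positivity)] at n2
    have hyω : sample y T ω = sample m T ω + sample u T ω := by
      ext t
      simp only [sample, Pi.add_apply, hlin.model]
    rw [hyω] at n6
    have hσ : sigmaSq μ u T ≤ (max K 0) ^ 2 :=
      sigmaSq_le (fun t => (hu t).1.integrable_sq) (fun t => (hu t).2) hT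
    have hT1 : (√(T : ℝ))⁻¹ ≤ 1 := by
      refine inv_le_one_of_one_le₀ (Real.one_le_sqrt.2 ?_)
      exact_mod_cast hT
    have hu2 : empNormSq (sample u T ω) ≤ M₂ := by
      have := (abs_le.1 n2).2
      have h3 := mul_le_of_le_one_right hM₃.le hT1
      rw [hM₂]
      linarith
    have hmain := hdet (sample u T ω) (sample m T ω) (design x T (p T) ω) (lam T) α (s T) (P T)
      (trunc β (p T)) (βhat T ω)
      (Finset.univ.filter fun j : Fin (p T) => 4 * (θ₀ * (T * ρ)) ≤ W T j ω) hl0 hα0 hα1 hgr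
      (hs T) hs1 (hslr.trans hsl1) n6 (hβb (p T)) n1 hu2 n3 ?_ ?_ ?_
    · rw [← hyω] at hmain
      have hr0 : 0 ≤ varianceRate κ (s T) (p T) T :=
        le_max_of_le_left (by positivity)
      have h1 := mul_le_mul_of_nonneg_left hslr hD₁.le
      have h2 := mul_le_mul_of_nonneg_left
        (inv_sqrt_le_varianceRate (κ := κ) (T := T) hs1 hp2) hM₃.le
      have h3 := abs_sub_le
        (sigmaHatSq (sample y T ω) (design x T (p T) ω) (lam T) α (P T) (βhat T ω))
        (empNormSq (sample u T ω)) (sigmaSq μ u T)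
      simp only [Set.mem_ofPred_eq] at hω
      rw [abs_of_nonneg hr0, hCfin] at hω
      linarith
    · intro j hj
      simp only [Finset.mem_filter, Finset.mem_univ, true_and, not_le] at hj
      rw [hWe T ω j hT, div_le_iff₀ hT0]
      refine hj.le.trans ?_
      have e1 : 4 * (θ₀ * (T * ρ)) = (√G)⁻¹ * (C₀ * ρ) / 2 * T := by
        rw [hθ₀]; field_simp; ring
      rw [e1]
      have := hL.1
      gcongr
    · intro j
      rw [hWe T ω j hT, div_le_iff₀ hT0]
      refine (n4 j).le.trans ?_
      have e1 : 4 * (θ * (T * ρ)) = M * (C₀ * ρ) * T := by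
        rw [hM]; field_simp
      rw [e1]
      have := hL.1
      gcongr
    · intro d
      refine (mul_sum_sq_le_empNormSq_add hcov hT ω (η := c₂ / s T)
        (fun j l => (n5 (j, l)).le) d).trans ?_
      have : c₂ / s T ≤ c₁ / s T := by
        gcongr
        exact min_le_left _ _
      gcongr
  calc μ _ ≤ μ (((((A1 ∪ A2) ∪ A3) ∪ A4) ∪ A5) ∪ A6) := measure_mono hsub
    _ ≤ ((((μ A1 + μ A2) + μ A3) + μ A4) + μ A5) + μ A6 := by
        refine (measure_union_le _ _).trans (add_le_add ?_ le_rfl)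
        refine (measure_union_le _ _).trans (add_le_add ?_ le_rfl)
        refine (measure_union_le _ _).trans (add_le_add ?_ le_rfl)
        refine (measure_union_le _ _).trans (add_le_add ?_ le_rfl)
        exact measure_union_le _ _
    _ ≤ ((((ENNReal.ofReal ε' + ENNReal.ofReal ε') + ENNReal.ofReal ε') + ENNReal.ofReal ε') +
          ENNReal.ofReal ε') + 0 := by
        gcongr
        exact hnull.le
    _ = ENNReal.ofReal ε := by
        rw [add_zero, ← ENNReal.ofReal_add (by positivity) (by positivity),
          ← ENNReal.ofReal_add (by positivity) (by positivity),
          ← ENNReal.ofReal_add (by positivity) (by positivity),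
          ← ENNReal.ofReal_add (by positivity) (by positivity)]
        congr 1
        rw [hε']
        ring

end SGL

theorem mainTheorem8 (q r a b c K : ℝ) (g : ℕ)
    (hr : 4 < r) (hq : 2 * r / (r - 2) < q)
    (ha : (SGL.varsigma q r - 1) / (SGL.varsigma q r - 2) < a)
    (hb : (r - 2) / (r - 4) < b) (hc : 0 < c) :
    ∃ C₀ : ℝ, 0 < C₀ ∧
      ∀ {Ω : Type*} [MeasurableSpace Ω] (μ : Measure Ω) [IsProbabilityMeasure μ]
        (y m u : ℤ → Ω → ℝ) (x : ℤ → ℕ → Ω → ℝ) (β : ℕ → ℝ) (γ α δ : ℝ)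
        (p : ℕ → ℕ) (P : ∀ T, SGL.Groups (p T)) (s lam : ℕ → ℝ)
        (βhat : ∀ T, Ω → Fin (p T) → ℝ),
        SGL.LinearProjection μ y m u x β →
        SGL.DataAssumption μ u x q r a b c K →
        0 < γ → SGL.CovarianceAssumption μ x γ →
        0 ≤ α → α ≤ 1 →
        (∀ T, ∀ G ∈ (P T).parts, G.card ≤ g) →
        (∀ T, s T = SGL.effSparsity α (P T) (SGL.trunc β (p T))) →
        (∀ᶠ T in atTop, 2 ≤ p T) →
        (∀ᶠ T in atTop, SGL.trunc β (p T) ≠ 0) →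
        0 < δ → δ < 1 →
        SGL.RegularizationAssumption (SGL.kappa a q r) δ C₀ p lam →
        SGL.RateAssumption μ m x β (SGL.muExp b r) p s lam →
        SGL.HasFiniteLongRunVariance μ (fun t ω => u t ω ^ 2) →
        (∀ T, ∀ᵐ ω ∂μ, SGL.IsSgLasso (SGL.sample y T ω) (SGL.design x T (p T) ω)
          (lam T) α (P T) (βhat T ω)) →
        Tendsto (fun T => SGL.varianceRate (SGL.kappa a q r) (s T) (p T) T) atTop (𝓝 0) →
        SGL.IsBigOP μ
            (fun T ω => SGL.sigmaHatSq (SGL.sample y T ω) (SGL.design x T (p T) ω)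
              (lam T) α (P T) (βhat T ω) - SGL.sigmaSq μ u T)
            (fun T => SGL.varianceRate (SGL.kappa a q r) (s T) (p T) T) ∧
          TendstoInMeasure μ
            (fun T ω => SGL.sigmaHatSq (SGL.sample y T ω) (SGL.design x T (p T) ω)
              (lam T) α (P T) (βhat T ω) - SGL.sigmaSq μ u T)
            atTop (fun _ => 0) := by
  obtain ⟨hq2, hς⟩ := SGL.two_lt_varsigma hr hq
  set ς := SGL.varsigma q r with hςdef
  have ha0 : 0 < a := lt_trans (div_pos (by linarith) (by linarith)) ha
  have hb' : (r / 2 - 1) / (r / 2 - 2) < b := by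
    have : (r / 2 - 1) / (r / 2 - 2) = (r - 2) / (r - 4) := by
      rw [show r / 2 - 1 = (r - 2) / 2 by ring, show r / 2 - 2 = (r - 4) / 2 by ring]
      exact div_div_div_cancel_right₀ two_ne_zero _ _
    rwa [this]
  have hb0 : 0 < b := lt_trans (div_pos (by linarith) (by linarith)) hb
  have hκ : 0 < SGL.kappa a q r := by
    unfold SGL.kappa
    rw [← hςdef]
    exact div_pos (by nlinarith) (by linarith)
  have hν : ((b + 1) * (r / 2) - 1) / (b + r / 2 - 1) = SGL.muExp b r := by
    unfold SGL.muExp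
    rw [div_eq_div_iff (by linarith) (by linarith)]
    ring
  obtain ⟨C₁, C₂, hC₁, hC₂, hFN⟩ := SGL.exists_fukNagaev (ς := ς) (a := a) (c := c)
    (A := (2 * (max K 0) ^ 2) ^ ς + 1) hς ha hc (by positivity)
  obtain ⟨C₃, C₄, _, hC₄, hFN'⟩ := SGL.exists_fukNagaev (ς := r / 2) (a := b) (c := c)
    (A := (2 * (max K 0) ^ 2) ^ (r / 2) + 1) (by linarith) hb' hc (by positivity)
  set G : ℝ := max g 1 with hG
  have hG1 : 1 ≤ G := le_max_right _ _
  have hsG : 0 < √G := Real.sqrt_pos.2 (by linarith)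
  -- With this choice the Gaussian part of the tail bound at the level of the penalty is at most
  -- `δ / (8 p)`.
  refine ⟨8 * √G * (√C₂)⁻¹, by positivity, ?_⟩
  intro Ω _ μ _ y m u x β γ α δ p P s lam βhat hlin hdata hγ hcov hα0 hα1 hgr hs hp hβ hδ hδ1 hreg
    hrt hlrv hlasso hrate
  have hO := SGL.isBigOP_sigmaHatSq_sub (C₁ := C₁) (C₃ := C₃) (G := G) (κ := SGL.kappa a q r)
    (ν := SGL.muExp b r) (C₀ := 8 * √G * (√C₂)⁻¹) hq2.le (by linarith) hκ hC₁ hC₂ hC₄ hG1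
    (by positivity) ?_ ?_ ?_ hlin hdata hγ hcov hα0 hα1 ?_ hs hp hβ hδ hδ1 hreg hrt hlrv hlasso
    hrate
  · exact ⟨hO, hO.tendstoInMeasure hrate⟩
  · have : 8 * √G * (√C₂)⁻¹ / (8 * √G) = (√C₂)⁻¹ := by field_simp
    rw [this, inv_pow, Real.sq_sqrt hC₂.le, mul_inv_cancel₀ hC₂.ne']
  · intro j T z hz1 hzT
    refine hFN μ _ (SGL.weaklyDependent_mul (by linarith) (by linarith) (by linarith) ?_
      hlin.measurable_u (fun t => hlin.measurable_x t j) hdata.moment_u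
      (fun t => hdata.moment_x t j) (hdata.mixing_ux j)) T z hz1 hzT
    rw [hςdef, SGL.varsigma]
    have : q ≠ 0 := by linarith
    have : r ≠ 0 := by linarith
    field_simp
    ring
  · intro j l T z hz1 hzT
    rw [← hν]
    refine hFN' μ _ (SGL.weaklyDependent_mul (by linarith) (by linarith) (by linarith) ?_
      (fun t => hlin.measurable_x t j) (fun t => hlin.measurable_x t l)
      (fun t => hdata.moment_x t j) (fun t => hdata.moment_x t l) (hdata.mixing_xx j l))
      T z hz1 hzT
    field_simp
    ring
  · refine Eventually.of_forall fun T S hS => le_trans ?_ (le_max_left _ _)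
    exact_mod_cast hgr T S hS
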